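/- **Setting.** Let $1\le n<d$ be integers and $\rho>2$. *Kernel.* Let $K:\mathbb R^d\setminus\{0\}\to\mathbb R$ be odd, with partial derivatives up to order two, and suppose that for some constant $C>0$ $$|K(x)|\le \frac{C}{|x|^{n}},\qquad |\partial_{x^i}K(x)|\le\frac{C}{|x|^{n+1}},\qquad |\partial_{x^i}\partial_{x^j}K(x)|\le\frac{C}{|x|^{n+2}}$$ for all $1\le i,j\le d$ and $x\neq0$. *Truncations.* Let $\varphi_{\mathbb R}:[0,\infty)\to[0,\infty)$ be a nondecreasing $C^2$ function with $\chi_{[4,\infty)}\le\varphi_{\mathbb R}\le\chi_{[1/4,\infty)}$ and $\chi_{[1/3,3]}\le C'|\varphi_{\mathbb R}'|$ for some $C'>0$, and put $\varphi_\epsilon(x)=\varphi_{\mathbb R}(|x|^2/\epsilon^2)$ for $\epsilon>0$. *Operators.* Let $M(\mathbb R^d)$ be the space of finite real Borel measures on $\mathbb R^d$, with the total variation norm $\|\nu\|$. For $\nu\in M(\mathbb R^d)$ set $$T_{\varphi_\epsilon}\nu(x)=\int \varphi_\epsilon(x-y)K(x-y)\,d\nu(y),\qquad \mathcal T_\varphi\nu=\{T_{\varphi_\epsilon}\nu\}_{\epsilon>0},$$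 and, for a Borel measure $\mu$ and a function $f$, $T^\mu_{\varphi_\epsilon}f(x)=\int \varphi_\epsilon(x-y)K(x-y)f(y)\,d\mu(y)$, $\mathcal T^\mu_\varphi f=\{T^\mu_{\varphi_\epsilon}f\}_{\epsilon>0}$. For a family $\mathcal F=\{F_\epsilon\}_{\epsilon>0}$ of functions on $\mathbb R^d$ set $$\mathcal V_\rho(\mathcal F)(x)=\sup_{\{\epsilon_m\}}\Big(\sum_{m\in\mathbb Z}|F_{\epsilon_{m+1}}(x)-F_{\epsilon_m}(x)|^\rho\Big)^{1/\rho}\in[0,\infty],$$ the supremum being over all decreasing sequences $\{\epsilon_m\}_{m\in\mathbb Z}\subset(0,\infty)$. For a Borel measure $\sigma$, the operator $\mathcal V_\rho\circ\mathcal T_\varphi$ is *bounded from $M(\mathbb R^d)$ to $L^{1,\infty}(\sigma)$ with constant at most $A$* if $$\lambda\,\sigma(\{x:(\mathcal V_\rho\circ\mathcal T_\varphi)\nu(x)>\lambda\})\le A\|\nu\|\qquad\text{for all }\nu\in M(\mathbb R^d),\ \lambda>0 .$$ *Measure.* Let $\mu$ be a Borel measure in $\mathbb R^d$ which is $n$-dimensional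 AD regular, i.e. there is $c>0$ with $c^{-1}r^n\le\mu(B(x,r))\le c\,r^n$ for all $x\in\operatorname{supp}\mu$ and $0<r\le\operatorname{diam}(\operatorname{supp}\mu)$, and whose support is not a single point. **Theorem.** Assume that there exist constants $C_0>0$ and $C_1\ge 0$ such that for each ball $B$ centred on $\operatorname{supp}\mu$ there is a set $F=F_B\subset\mathbb R^d$ such that (a) $\mu(F\cap B)\ge C_0\,\mu(B)$; (b) $\mathcal V_\rho\circ\mathcal T_\varphi$ is bounded from $M(\mathbb R^d)$ to $L^{1,\infty}(\mathcal H^n_F)$ with constant at most $C_1$, where $\mathcal H^n_F$ is the $n$-dimensional Hausdorff measure restricted to $F$. Then $\mathcal V_\rho\circ\mathcal T_\varphi$ is bounded from $M(\mathbb R^d)$ to $L^{1,\infty}(\mu)$. Moreover, for every $1<p<\infty$, $\mathcal V_\rho\circ\mathcal T^\mu_\varphi$ is a well-defined bounded operator on $L^p(\mu)$: for $f\in L^p(\mu)$ the integrals $T^\mu_{\varphi_\epsilon}f(x)$ converge absolutely for all $x\in\mathbb R^d$ and $\epsilon>0$, $(\mathcal V_\rho\circ\mathcal T^\mu_\varphi)f$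 is $\mu$-measurable, and $\|(\mathcal V_\rho\circ\mathcal T^\mu_\varphi)f\|_{L^p(\mu)}\le C_p\|f\|_{L^p(\mu)}$ with $C_p$ independent of $f$. -/

import Mathlib

open MeasureTheory Set
open scoped ENNReal NNReal

noncomputable section

namespace SmoothVariation

/-- `ℝ^d` with its Euclidean norm. -/
abbrev Space (d : ℕ) : Type := EuclideanSpace ℝ (Fin d)

/-- The `i`-th vector of the canonical basis of `ℝ^d`. -/
abbrev basisVec {d : ℕ} (i : Fin d) : Space d := EuclideanSpace.single i (1 : ℝ)

/-- The odd kernels `K : ℝ^d ∖ {0} → ℝ` of homogeneity `-n`: the partial derivatives of order at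
most two exist away from the origin and obey the standard size conditions. The value `K 0` is
irrelevant. -/
structure IsOddKernel {d : ℕ} (n : ℕ) (K : Space d → ℝ) : Prop where
  odd : ∀ x, x ≠ 0 → K (-x) = -K x
  diff₁ : ∀ i x, x ≠ 0 → LineDifferentiableAt ℝ K x (basisVec i)
  diff₂ : ∀ i j x, x ≠ 0 →
    LineDifferentiableAt ℝ (fun y => lineDeriv ℝ K y (basisVec i)) x (basisVec j)
  bounds : ∃ C : ℝ, 0 < C ∧ ∀ x, x ≠ 0 →
    |K x| ≤ C / ‖x‖ ^ n ∧
    (∀ i, |lineDeriv ℝ K x (basisVec i)| ≤ C / ‖x‖ ^ (n + 1)) ∧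
    (∀ i j, |lineDeriv ℝ (fun y => lineDeriv ℝ K y (basisVec i)) x (basisVec j)|
      ≤ C / ‖x‖ ^ (n + 2))

/-- The profiles `φ : [0,∞) → [0,∞)` of the smooth truncations: nondecreasing, of class `C²`,
with `χ_{[4,∞)} ≤ φ ≤ χ_{[1/4,∞)}`, and with `|φ'|` bounded below on `[1/3,3]`. The values of `φ`
on the negative half line are irrelevant. -/
structure IsTruncationProfile (φ : ℝ → ℝ) : Prop where
  mono : MonotoneOn φ (Ici 0)
  smooth : ContDiffOn ℝ 2 φ (Ici 0)
  lower : ∀ t ∈ Ici (0 : ℝ), (Ici (4 : ℝ)).indicator (fun _ => (1 : ℝ)) t ≤ φ t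
  upper : ∀ t ∈ Ici (0 : ℝ), φ t ≤ (Ici (1 / 4 : ℝ)).indicator (fun _ => (1 : ℝ)) t
  deriv_lower : ∃ c : ℝ, 0 < c ∧ ∀ t ∈ Icc (1 / 3 : ℝ) 3, c ≤ |deriv φ t|

/-- The smoothly truncated kernel `K φ_ε`, where `φ_ε(x) = φ(|x|² / ε²)`. -/
def truncKernel {d : ℕ} (K : Space d → ℝ) (φ : ℝ → ℝ) (ε : ℝ) (x : Space d) : ℝ :=
  φ (‖x‖ ^ 2 / ε ^ 2) * K x

/-- `T_{φ_ε} ν (x) = ∫ φ_ε(x - y) K(x - y) dν(y)` for a finite real Borel measure `ν`. (The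
truncated kernel is bounded and Borel, so it is integrable for every `ν`.) -/
def truncMeasure {d : ℕ} (K : Space d → ℝ) (φ : ℝ → ℝ) (ν : SignedMeasure (Space d))
    (ε : ℝ) (x : Space d) : ℝ :=
  ∫ᵛ y, truncKernel K φ ε (x - y) ∂•ν

/-- `T_{φ_ε}^μ f (x) = ∫ φ_ε(x - y) K(x - y) f(y) dμ(y)`. -/
def truncFun {d : ℕ} (K : Space d → ℝ) (φ : ℝ → ℝ) (μ : Measure (Space d)) (f : Space d → ℝ)
    (ε : ℝ) (x : Space d) : ℝ :=
  ∫ y, truncKernel K φ ε (x - y) * f y ∂μ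

/-- The `ρ`-variation at `x` of a family `{F_ε}_{ε > 0}`, as an extended nonnegative number: the
supremum over decreasing sequences `ε : ℤ → (0,∞)`. (Repeated values only contribute zero terms,
so that allowing them does not change the supremum.) -/
def rhoVariation {X : Type*} (ρ : ℝ) (F : ℝ → X → ℝ) (x : X) : ℝ≥0∞ :=
  ⨆ (ε : ℤ → ℝ) (_ : Antitone ε) (_ : ∀ m, 0 < ε m),
    (∑' m : ℤ, ENNReal.ofReal |F (ε (m + 1)) x - F (ε m) x| ^ ρ) ^ (1 / ρ)

/-- `μ` is `n`-dimensional Ahlfors-David regular. -/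
def IsADRegular {d : ℕ} (n : ℕ) (μ : Measure (Space d)) : Prop :=
  ∃ C : ℝ, 0 < C ∧ ∀ x ∈ μ.support, ∀ r : ℝ, 0 < r → ENNReal.ofReal r ≤ Metric.ediam μ.support →
    ENNReal.ofReal (C⁻¹ * r ^ n) ≤ μ (Metric.ball x r) ∧
    μ (Metric.ball x r) ≤ ENNReal.ofReal (C * r ^ n)

/-- The operator `V_ρ ∘ T_φ` is bounded from the space `M(ℝ^d)` of finite real Borel measures,
normed by total variation, to `L^{1,∞}(σ)`, with constant at most `C`. -/
def WeakBound {d : ℕ} (K : Space d → ℝ) (φ : ℝ → ℝ) (ρ : ℝ) (σ : Measure (Space d))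
    (C : ℝ≥0) : Prop :=
  ∀ (ν : SignedMeasure (Space d)) (t : ℝ≥0), 0 < t →
    t * σ {x | t < rhoVariation ρ (truncMeasure K φ ν) x} ≤ C * ν.variation univ

/-- The operator `V_ρ ∘ T_φ^μ` is well defined and bounded on `L^p(μ)`: for `f ∈ L^p(μ)` the
integrals defining `T_{φ_ε}^μ f (x)` converge absolutely for all `x` and `ε > 0`, and the
`ρ`-variation is measurable with `L^p(μ)` norm at most a constant times that of `f`. -/
def BoundedOnLp {d : ℕ} (K : Space d → ℝ) (φ : ℝ → ℝ) (ρ : ℝ) (μ : Measure (Space d))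
    (p : ℝ≥0∞) : Prop :=
  ∃ C : ℝ≥0, ∀ f : Space d → ℝ, MemLp f p μ →
    (∀ x, ∀ ε : ℝ, 0 < ε → Integrable (fun y => truncKernel K φ ε (x - y) * f y) μ) ∧
    AEMeasurable (rhoVariation ρ (truncFun K φ μ f)) μ ∧
    eLpNorm (rhoVariation ρ (truncFun K φ μ f)) p μ ≤ C * eLpNorm f p μ

end SmoothVariation

end

open SmoothVariation

/-!
The proof is David's good `λ` method, for the variation operator `V` of the signed measures `s τ`
with `τ` finite and `|s| ≤ 1`.

On the kernel side, only the size and first order smoothness of `K` are used. As a function of `ε`,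
the truncated kernel at `u` has total variation at most `C / |u|^n`, and the difference of its
values at `u` and `v` has total variation at most `C |u - v| / |u|^(n+1)`
(`exists_isTruncatedFamily`); in the logarithmic variable the profile `φ` has a Lipschitz
derivative with compact support, which gives the second bound. Since the `ρ`-variation is a seminorm
dominated by the total variation, the potential of the part of a measure far from a ball of radius
`r` has nearly the same variation at any two points within `O(r)` of the ball, up to a multiple of
the maximal function `sup_r τ(B(x,r)) / r^n` (`IsTruncatedFamily.rhoVariation_far_le_of_ball`).

Let `B` be a ball centred on `supp μ` whose distance to a point of `supp μ` where `V ≤ λ` is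
comparable to its radius, and let `F` be a big piece for `B`. Where the maximal function is at most
`γλ`, the far part contributes at most `(1 + e)λ` to `V` on `B`, and the near part exceeds `eλ` only
on a small portion of `F ∩ B`, because of the weak type bound on `F` and of `μ ≤ A ℋ^n`. Hence a
fixed proportion of `B` avoids the set where `V > (1 + 2e)λ` and the maximal function is small.
Summing over a Vitali family of such balls gives the good `λ` inequality
`μ {V > (1 + 2e)λ} ≤ q μ {V > λ} + μ {M > γλ}` with `q < 1` independent of `e`
(`HasBigPieces.exists_good_lambda`). If `V > λ` on all of `supp μ`, there is no such ball, but then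
the big pieces bound `λ μ(ℝ^d)` by the mass of `τ`; for this reason the maximal function `M`
includes the mean `τ(ℝ^d) / μ(ℝ^d)`.

Multiplying by `λ` and taking suprema yields the weak type `(1,1)` bound: the supremum is finite for
compactly supported measures, and the general case follows since `V` is lower semicontinuous under
pointwise convergence of the potentials (`HasBigPieces.exists_polarWeakBound`). Summing the same
inequality over the levels `λ = b^i`, `i ∈ ℤ`, with weights `b^{ip}`, yields the `L^p` bound
(`HasBigPieces.exists_lintegral_rpow_le`); the weak type bound ensures that the sums converge, and
those for `M` are bounded as in the Marcinkiewicz interpolation theorem. Measurability of the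
variation is lower semicontinuity.
-/

namespace SmoothVariation

open Filter Topology

/-! ### The variation seminorm of a function of the truncation parameter -/

/-- The `ρ`-variation of a function of `ε ∈ (0,∞)`, so that `rhoVariation ρ F x` is the
`ρ`-variation of `ε ↦ F ε x`. -/
noncomputable def paramVar (ρ : ℝ) (g : ℝ → ℝ) : ℝ≥0∞ :=
  ⨆ (ε : ℤ → ℝ) (_ : Antitone ε) (_ : ∀ m, 0 < ε m),
    (∑' m : ℤ, ENNReal.ofReal |g (ε (m + 1)) - g (ε m)| ^ ρ) ^ (1 / ρ)

lemma rhoVariation_eq_paramVar {X : Type*} (ρ : ℝ) (F : ℝ → X → ℝ) (x : X) :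
    rhoVariation ρ F x = paramVar ρ (fun ε => F ε x) := rfl

lemma le_paramVar {ρ : ℝ} {g : ℝ → ℝ} {ε : ℤ → ℝ} (h : Antitone ε) (h' : ∀ m, 0 < ε m) :
    (∑' m : ℤ, ENNReal.ofReal |g (ε (m + 1)) - g (ε m)| ^ ρ) ^ (1 / ρ) ≤ paramVar ρ g :=
  le_iSup_of_le ε (le_iSup_of_le h (le_iSup_of_le h' le_rfl))

lemma paramVar_congr {ρ : ℝ} {g g' : ℝ → ℝ} (h : ∀ ε, 0 < ε → g ε = g' ε) :
    paramVar ρ g = paramVar ρ g' := by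
  unfold paramVar
  refine iSup_congr fun ε => iSup_congr fun _ => iSup_congr fun h' => ?_
  simp only [h _ (h' _)]

/-- Minkowski's inequality for infinite sums of extended nonnegative numbers. -/
lemma ennreal_Lp_add_le_tsum {ι : Type*} {ρ : ℝ} (hρ : 1 ≤ ρ) (f g : ι → ℝ≥0∞) :
    (∑' i, (f i + g i) ^ ρ) ^ (1 / ρ) ≤ (∑' i, f i ^ ρ) ^ (1 / ρ) + (∑' i, g i ^ ρ) ^ (1 / ρ) := by
  let _ : MeasurableSpace ι := ⊤
  have := ENNReal.lintegral_Lp_add_le (μ := Measure.count) (p := ρ) (f := f) (g := g)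
    (measurable_from_top.aemeasurable) (measurable_from_top.aemeasurable) hρ
  simpa [lintegral_count] using this

lemma paramVar_add_le {ρ : ℝ} (hρ : 1 ≤ ρ) (g g' : ℝ → ℝ) :
    paramVar ρ (fun ε => g ε + g' ε) ≤ paramVar ρ g + paramVar ρ g' := by
  refine iSup_le fun ε => iSup_le fun h => iSup_le fun h' => ?_
  refine le_trans ?_ (add_le_add (le_paramVar h h') (le_paramVar h h'))
  refine le_trans ?_ (ennreal_Lp_add_le_tsum hρ _ _)
  have hρ0 : 0 ≤ ρ := by linarith
  gcongr with m
  rw [← ENNReal.ofReal_add (abs_nonneg _) (abs_nonneg _)]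
  refine ENNReal.ofReal_le_ofReal ?_
  rw [add_sub_add_comm]
  exact abs_add_le _ _

lemma paramVar_comp_le {ρ : ℝ} (g : ℝ → ℝ) {θ : ℝ → ℝ} (hθ : MonotoneOn θ (Ioi 0))
    (hpos : ∀ ε, 0 < ε → 0 < θ ε) : paramVar ρ (fun ε => g (θ ε)) ≤ paramVar ρ g := by
  refine iSup_le fun ε => iSup_le fun h => iSup_le fun h' => ?_
  exact le_paramVar (ε := fun m => θ (ε m)) (fun i j hij => hθ (h' _) (h' _) (h hij))
    (fun m => hpos _ (h' m))

lemma tsum_rpow_rpow_le {ι : Type*} {ρ : ℝ} (hρ : 1 ≤ ρ) (f : ι → ℝ≥0∞) :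
    (∑' i, f i ^ ρ) ^ (1 / ρ) ≤ ∑' i, f i := by
  have hρ0 : 0 < ρ := by linarith
  rw [one_div, ENNReal.rpow_inv_le_iff hρ0]
  have key : ∀ S : ℝ≥0∞, S ^ ρ = S * S ^ (ρ - 1) := by
    intro S
    conv_rhs => rw [← ENNReal.rpow_one S, ← ENNReal.rpow_mul, one_mul,
      ← ENNReal.rpow_add_of_nonneg _ _ zero_le_one (by linarith)]
    congr 1; ring
  rw [key (∑' i, f i), ← ENNReal.tsum_mul_right]
  refine ENNReal.tsum_le_tsum fun i => ?_
  rw [key]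
  exact mul_le_mul_right (ENNReal.rpow_le_rpow (ENNReal.le_tsum i) (by linarith)) _

/-- For `ρ ≥ 1` the `ρ`-variation is at most the total variation. -/
lemma paramVar_le_of_tsum_le {ρ : ℝ} (hρ : 1 ≤ ρ) {g : ℝ → ℝ} {B : ℝ≥0∞}
    (h : ∀ ε : ℤ → ℝ, Antitone ε → (∀ m, 0 < ε m) →
      ∑' m : ℤ, ENNReal.ofReal |g (ε (m + 1)) - g (ε m)| ≤ B) : paramVar ρ g ≤ B :=
  iSup_le fun ε => iSup_le fun h₁ => iSup_le fun h₂ =>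
    (tsum_rpow_rpow_le hρ _).trans (h ε h₁ h₂)

/-- A function of `ε` is, up to a constant, the sum of its parts above and below the level `s`. -/
lemma paramVar_le_split {ρ : ℝ} (hρ : 1 ≤ ρ) (g : ℝ → ℝ) (s : ℝ) :
    paramVar ρ g ≤ paramVar ρ (fun ε => g (max ε s)) + paramVar ρ (fun ε => g (min ε s)) := by
  refine le_trans (le_of_eq ?_) (paramVar_add_le hρ _ _)
  have h : ∀ ε, g (max ε s) + g (min ε s) = g ε + g s := by
    intro ε
    rcases le_total ε s with h | h
    · rw [max_eq_right h, min_eq_left h, add_comm]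
    · rw [max_eq_left h, min_eq_right h]
  simp only [h]
  unfold paramVar
  simp only [add_sub_add_right_eq_sub]

/-- The `ρ`-variation is lower semicontinuous for pointwise convergence on `(0,∞)`. -/
lemma eventually_lt_paramVar {ι : Type*} {l : Filter ι} {ρ : ℝ} (hρ : 1 ≤ ρ) {G : ι → ℝ → ℝ}
    {g : ℝ → ℝ} (h : ∀ ε, 0 < ε → Tendsto (fun i => G i ε) l (𝓝 (g ε))) {a : ℝ≥0∞}
    (ha : a < paramVar ρ g) : ∀ᶠ i in l, a < paramVar ρ (G i) := by
  have hρ0 : 0 < ρ := by linarith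
  simp only [paramVar, lt_iSup_iff] at ha
  obtain ⟨ε, h₁, h₂, ha⟩ := ha
  rw [one_div, ENNReal.lt_rpow_inv_iff hρ0, ENNReal.tsum_eq_iSup_sum, lt_iSup_iff] at ha
  obtain ⟨S, hS⟩ := ha
  have hlim : Tendsto (fun i => ∑ m ∈ S, ENNReal.ofReal |G i (ε (m + 1)) - G i (ε m)| ^ ρ) l
      (𝓝 (∑ m ∈ S, ENNReal.ofReal |g (ε (m + 1)) - g (ε m)| ^ ρ)) := by
    refine tendsto_finsetSum _ fun m _ => ?_
    exact (ENNReal.continuous_rpow_const.tendsto _).comp (ENNReal.tendsto_ofReal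
      (((h _ (h₂ _)).sub (h _ (h₂ _))).abs))
  filter_upwards [hlim.eventually_const_lt hS] with i hi
  refine lt_of_lt_of_le ?_ (le_paramVar h₁ h₂)
  rw [one_div, ENNReal.lt_rpow_inv_iff hρ0]
  exact hi.trans_le (ENNReal.sum_le_tsum _)

lemma paramVar_le_liminf {ι : Type*} {l : Filter ι} {ρ : ℝ} (hρ : 1 ≤ ρ) {G : ι → ℝ → ℝ}
    {g : ℝ → ℝ} (h : ∀ ε, 0 < ε → Tendsto (fun i => G i ε) l (𝓝 (g ε))) :
    paramVar ρ g ≤ liminf (fun i => paramVar ρ (G i)) l := by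
  refine le_of_forall_lt fun a ha => ?_
  obtain ⟨b, hab, hb⟩ := exists_between ha
  exact hab.trans_le (le_liminf_of_le (by isBoundedDefault)
    ((eventually_lt_paramVar hρ h hb).mono fun _ hi => hi.le))

lemma lowerSemicontinuous_rhoVariation {X : Type*} [TopologicalSpace X] {ρ : ℝ} (hρ : 1 ≤ ρ)
    {F : ℝ → X → ℝ} (hF : ∀ ε, 0 < ε → Continuous (F ε)) :
    LowerSemicontinuous (rhoVariation ρ F) := fun x _ ha =>
  eventually_lt_paramVar hρ (fun ε hε => (hF ε hε).tendsto x) ha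

/-- A monotone sequence with values in `[α, β]` has total variation at most `β - α`. -/
lemma tsum_abs_sub_le_of_monotone {a : ℤ → ℝ} (ha : Monotone a) {α β : ℝ}
    (h : ∀ m, a m ∈ Icc α β) :
    ∑' m : ℤ, ENNReal.ofReal |a (m + 1) - a m| ≤ ENNReal.ofReal (β - α) := by
  have h1 : ∀ m, ENNReal.ofReal |a (m + 1) - a m| = volume (Ioc (a m) (a (m + 1))) := by
    intro m
    rw [Real.volume_Ioc, abs_of_nonneg (sub_nonneg.2 (ha (by lia)))]
  simp only [h1]
  rw [← measure_iUnion (show Pairwise (Function.onFun Disjoint fun m => Ioc (a m) (a (m + 1))) from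
    ha.pairwise_disjoint_on_Ioc_succ) (fun m => measurableSet_Ioc),
    ← Real.volume_Icc]
  refine measure_mono (iUnion_subset fun m x hx => ?_)
  exact ⟨(h m).1.trans hx.1.le, hx.2.trans (h (m + 1)).2⟩

/-! ### Smooth truncation profiles -/

namespace IsTruncationProfile

variable {φ : ℝ → ℝ}

lemma eq_zero (hφ : IsTruncationProfile φ) {t : ℝ} (h₀ : 0 ≤ t) (h : t < 1 / 4) : φ t = 0 := by
  have h₁ := hφ.upper t h₀
  have h₂ := hφ.lower t h₀
  rw [indicator_of_notMem (by simpa using h)] at h₁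
  rw [indicator_of_notMem (by simp; linarith)] at h₂
  exact le_antisymm h₁ h₂

lemma eq_one (hφ : IsTruncationProfile φ) {t : ℝ} (h : 4 ≤ t) : φ t = 1 := by
  have h₁ := hφ.upper t (by simp; linarith)
  have h₂ := hφ.lower t (by simp; linarith)
  rw [indicator_of_mem (by simp; linarith)] at h₁
  rw [indicator_of_mem (by simpa using h)] at h₂
  exact le_antisymm h₁ h₂

lemma mem_Icc (hφ : IsTruncationProfile φ) {t : ℝ} (h : 0 ≤ t) : φ t ∈ Icc (0 : ℝ) 1 := by
  have h₁ := hφ.upper t h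
  have h₂ := hφ.lower t h
  constructor
  · exact le_trans (indicator_nonneg (fun _ _ => zero_le_one) _) h₂
  · exact h₁.trans (indicator_le_self' (fun _ _ => zero_le_one) _)

/-- In the logarithmic variable the profile is a `C²` function on the line. -/
lemma contDiff_comp_exp (hφ : IsTruncationProfile φ) :
    ContDiff ℝ 2 (fun x => φ (Real.exp x)) := by
  have : ContDiffOn ℝ 2 (fun x => φ (Real.exp x)) univ :=
    hφ.smooth.comp Real.contDiff_exp.contDiffOn (fun x _ => (Real.exp_pos x).le)
  exact contDiffOn_univ.1 this

lemma comp_exp_eq_zero (hφ : IsTruncationProfile φ) {x : ℝ} (h : x ≤ -2) :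
    φ (Real.exp x) = 0 := by
  refine hφ.eq_zero (Real.exp_pos x).le ((Real.exp_le_exp.2 h).trans_lt ?_)
  have h2 : (2 : ℝ) < Real.exp 1 := by linarith [Real.exp_one_gt_d9]
  rw [Real.exp_neg, one_div]
  refine inv_strictAnti₀ (by norm_num) ?_
  have : Real.exp 2 = Real.exp 1 * Real.exp 1 := by rw [← Real.exp_add]; norm_num
  nlinarith

lemma comp_exp_eq_one (hφ : IsTruncationProfile φ) {x : ℝ} (h : 2 ≤ x) :
    φ (Real.exp x) = 1 := by
  refine hφ.eq_one (le_trans ?_ (Real.exp_le_exp.2 h))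
  have h2 : (2 : ℝ) < Real.exp 1 := by linarith [Real.exp_one_gt_d9]
  have : Real.exp 2 = Real.exp 1 * Real.exp 1 := by rw [← Real.exp_add]; norm_num
  nlinarith

/-- The derivative of the profile in the logarithmic variable is Lipschitz. -/
lemma exists_lipschitz_deriv (hφ : IsTruncationProfile φ) :
    ∃ L : ℝ, 0 ≤ L ∧ ∀ x y,
      |deriv (fun x => φ (Real.exp x)) x - deriv (fun x => φ (Real.exp x)) y| ≤ L * |x - y| := by
  set g : ℝ → ℝ := fun x => φ (Real.exp x) with hg
  have hcd : ContDiff ℝ 1 (deriv g) :=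
    (contDiff_succ_iff_deriv.1 (hφ.contDiff_comp_exp.of_le (m := 1 + 1) (by norm_num))).2.2
  have hsupp : HasCompactSupport (deriv g) := by
    refine HasCompactSupport.intro (K := Icc (-2) 2) isCompact_Icc fun x hx => ?_
    rcases lt_or_ge x (-2) with h | h
    · have : g =ᶠ[𝓝 x] fun _ => (0 : ℝ) := by
        filter_upwards [Iio_mem_nhds h] with y hy using hφ.comp_exp_eq_zero hy.le
      rw [this.deriv_eq]; simp
    · have h2 : 2 < x := by
        by_contra hc
        exact hx ⟨h, not_lt.1 hc⟩
      have : g =ᶠ[𝓝 x] fun _ => (1 : ℝ) := by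
        filter_upwards [Ioi_mem_nhds h2] with y hy using hφ.comp_exp_eq_one (le_of_lt hy)
      rw [this.deriv_eq]; simp
  obtain ⟨C, hC⟩ := hcd.lipschitzWith_of_hasCompactSupport hsupp (by norm_num)
  refine ⟨C, C.2, fun x y => ?_⟩
  simpa [Real.dist_eq] using hC.dist_le_mul x y

/-- The total variation of the difference of two translates of the profile, in the logarithmic
variable, is controlled by the size of the translation: the difference is constant outside an
interval of bounded length, where it is Lipschitz with a constant proportional to the
translation. -/
lemma exists_tsum_translate_sub_le (hφ : IsTruncationProfile φ) :
    ∃ L : ℝ, 0 ≤ L ∧ ∀ α β : ℝ, |α - β| ≤ 2 → ∀ x : ℤ → ℝ, Monotone x →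
      ∑' m : ℤ, ENNReal.ofReal
        |(φ (Real.exp (x (m + 1) + α)) - φ (Real.exp (x (m + 1) + β))) -
          (φ (Real.exp (x m + α)) - φ (Real.exp (x m + β)))| ≤ ENNReal.ofReal (L * |α - β|) := by
  obtain ⟨L, hL0, hL⟩ := hφ.exists_lipschitz_deriv
  set g : ℝ → ℝ := fun x => φ (Real.exp x) with hg
  have hdiff : Differentiable ℝ g := hφ.contDiff_comp_exp.differentiable (by norm_num)
  refine ⟨6 * L, by positivity, fun α β hαβ x hx => ?_⟩
  set H : ℝ → ℝ := fun t => g (t + α) - g (t + β) with hH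
  have hHd : ∀ t, HasDerivAt H (deriv g (t + α) - deriv g (t + β)) t := by
    intro t
    exact ((hdiff (t + α)).hasDerivAt.comp_add_const t α).sub
      ((hdiff (t + β)).hasDerivAt.comp_add_const t β)
  have hHlip : ∀ s t, |H t - H s| ≤ L * |α - β| * |t - s| := by
    intro s t
    refine Convex.norm_image_sub_le_of_norm_hasDerivWithin_le (s := univ)
      (fun y _ => (hHd y).hasDerivWithinAt) (fun y _ => ?_) convex_univ (mem_univ s) (mem_univ t)
    simpa using hL (y + α) (y + β)
  set a := -2 - max α β with ha
  set b := 2 - min α β with hb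
  have hab : a ≤ b := by
    have := min_le_max (a := α) (b := β)
    rw [ha, hb]; linarith
  have hlen : b - a ≤ 6 := by
    have : max α β - min α β = |α - β| := by rw [max_sub_min_eq_abs, abs_sub_comm]
    rw [ha, hb]; linarith
  have hclip : ∀ t, H t = H (max a (min b t)) := by
    intro t
    rcases le_total t a with h | h
    · rw [min_eq_right (h.trans hab), max_eq_left h]
      have h1 := le_max_left α β
      have h2 := le_max_right α β
      simp only [hH, hg]
      rw [hφ.comp_exp_eq_zero (by linarith), hφ.comp_exp_eq_zero (by linarith),
        hφ.comp_exp_eq_zero (by linarith), hφ.comp_exp_eq_zero (by linarith)]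
    · rcases le_total b t with h' | h'
      · rw [min_eq_left h', max_eq_right hab]
        have h1 := min_le_left α β
        have h2 := min_le_right α β
        simp only [hH, hg]
        rw [hφ.comp_exp_eq_one (by linarith), hφ.comp_exp_eq_one (by linarith),
          hφ.comp_exp_eq_one (by linarith), hφ.comp_exp_eq_one (by linarith)]
      · rw [min_eq_right h', max_eq_right h]
  have hmono : Monotone fun m => max a (min b (x m)) := fun i j hij =>
    max_le_max_left _ (min_le_min_left _ (hx hij))
  calc ∑' m : ℤ, ENNReal.ofReal |H (x (m + 1)) - H (x m)|
      ≤ ∑' m : ℤ, ENNReal.ofReal (L * |α - β|) *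
          ENNReal.ofReal |max a (min b (x (m + 1))) - max a (min b (x m))| := by
        refine ENNReal.tsum_le_tsum fun m => ?_
        rw [← ENNReal.ofReal_mul (by positivity), hclip (x (m + 1)), hclip (x m)]
        exact ENNReal.ofReal_le_ofReal (hHlip _ _)
    _ ≤ ENNReal.ofReal (L * |α - β|) * ENNReal.ofReal (b - a) := by
        rw [ENNReal.tsum_mul_left]
        gcongr
        exact tsum_abs_sub_le_of_monotone hmono
          fun m => ⟨le_max_left _ _, max_le hab (min_le_left _ _)⟩
    _ ≤ ENNReal.ofReal (6 * L * |α - β|) := by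
        rw [← ENNReal.ofReal_mul (by positivity)]
        refine ENNReal.ofReal_le_ofReal ?_
        have : 0 ≤ L * |α - β| := by positivity
        nlinarith

end IsTruncationProfile

/-! ### Kernels -/

/-- A mean value estimate from directional derivatives along the coordinate axes only, over the
path which changes the coordinates one at a time. -/
lemma abs_sub_le_of_lineDeriv_le {d : ℕ} {K : Space d → ℝ} {u v : Space d} {B : ℝ}
    (hd : ∀ p, ‖p - u‖ ≤ ‖v - u‖ → ∀ i, LineDifferentiableAt ℝ K p (basisVec i))
    (hB : ∀ p, ‖p - u‖ ≤ ‖v - u‖ → ∀ i, |lineDeriv ℝ K p (basisVec i)| ≤ B) :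
    |K v - K u| ≤ d * B * ‖v - u‖ := by
  -- `P k t` has the first `k` coordinates of `v`, the `k`-th one moving, and then those of `u`
  set P : ℕ → ℝ → Space d := fun k t => WithLp.toLp 2 fun i : Fin d =>
    if (i : ℕ) < k then v i else if (i : ℕ) = k then u i + t * (v i - u i) else u i with hP
  have hPn : ∀ k, ∀ t ∈ Icc (0 : ℝ) 1, ‖P k t - u‖ ≤ ‖v - u‖ := by
    intro k t ht
    rw [EuclideanSpace.norm_eq, EuclideanSpace.norm_eq]
    refine Real.sqrt_le_sqrt (Finset.sum_le_sum fun i _ => ?_)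
    simp only [hP, PiLp.sub_apply, Real.norm_eq_abs]
    gcongr 1
    split_ifs
    · exact le_rfl
    · rw [add_sub_cancel_left, abs_mul, abs_of_nonneg ht.1]
      exact mul_le_of_le_one_left (abs_nonneg _) ht.2
    · simp
  have hP1 : ∀ k, P k 1 = P (k + 1) 0 := by
    intro k
    ext i
    simp only [hP]
    rcases lt_trichotomy (i : ℕ) k with h | h | h
    · simp [h, h.trans (Nat.lt_succ_self k)]
    · simp [h]
    · have h1 : ¬ (i : ℕ) < k := by lia
      have h2 : ¬ (i : ℕ) = k := by lia
      have h3 : ¬ (i : ℕ) < k + 1 := by lia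
      simp [h1, h2, h3]
  have hstep : ∀ k, k < d → |K (P k 1) - K (P k 0)| ≤ B * ‖v - u‖ := by
    intro k hk
    set c := v ⟨k, hk⟩ - u ⟨k, hk⟩ with hc
    have hshift : ∀ t s, P k (t + s) = P k t + (c * s) • basisVec (⟨k, hk⟩ : Fin d) := by
      intro t s
      ext i
      simp only [hP, PiLp.add_apply, PiLp.smul_apply, PiLp.single_apply, smul_eq_mul]
      rcases lt_trichotomy (i : ℕ) k with h | h | h
      · have : i ≠ ⟨k, hk⟩ := by rintro rfl; simp at h
        simp [h, this]
      · have : i = ⟨k, hk⟩ := Fin.ext h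
        subst this
        simp [hc]; ring
      · have h1 : ¬ (i : ℕ) < k := by lia
        have h2 : ¬ (i : ℕ) = k := by lia
        have : i ≠ ⟨k, hk⟩ := by rintro rfl; simp at h
        simp [h1, h2, this]
    have hder : ∀ t ∈ Icc (0 : ℝ) 1, HasDerivAt (fun t => K (P k t))
        (lineDeriv ℝ K (P k t) (basisVec (⟨k, hk⟩ : Fin d)) * c) t := by
      intro t ht
      have h1 : HasDerivAt (fun s : ℝ => K (P k t + s • basisVec (⟨k, hk⟩ : Fin d)))
          (lineDeriv ℝ K (P k t) (basisVec ⟨k, hk⟩)) 0 :=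
        (hd _ (hPn k t ht) ⟨k, hk⟩).hasLineDerivAt
      have h2 : HasDerivAt (fun y : ℝ => c * (y - t)) c t := by
        simpa using ((hasDerivAt_id t).sub_const t).const_mul c
      have h3 := HasDerivAt.comp t (h₂ := fun s : ℝ => K (P k t + s • basisVec (⟨k, hk⟩ : Fin d)))
        (h := fun y : ℝ => c * (y - t)) (by simpa using h1) h2
      refine h3.congr_of_eventuallyEq (Eventually.of_forall fun y => ?_)
      simp only [Function.comp]
      rw [← hshift t (y - t), add_sub_cancel]
    have hcn : |c| ≤ ‖v - u‖ := by
      have := PiLp.norm_apply_le (v - u) (⟨k, hk⟩ : Fin d)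
      simpa [hc] using this
    have := Convex.norm_image_sub_le_of_norm_hasDerivWithin_le (s := Icc (0 : ℝ) 1)
      (f := fun t => K (P k t)) (C := B * ‖v - u‖)
      (fun y hy => (hder y hy).hasDerivWithinAt) (fun y hy => ?_) (convex_Icc 0 1)
      (left_mem_Icc.2 zero_le_one) (right_mem_Icc.2 zero_le_one)
    · simpa using this
    · rw [Real.norm_eq_abs, abs_mul]
      have h0 := hB _ (hPn k y hy) ⟨k, hk⟩
      exact mul_le_mul h0 hcn (abs_nonneg _) ((abs_nonneg _).trans h0)
  have hsum : ∀ k, k ≤ d → |K (P k 0) - K (P 0 0)| ≤ k * (B * ‖v - u‖) := by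
    intro k
    induction k with
    | zero => simp
    | succ k ih =>
      intro hk
      have h1 := ih (by lia)
      have h2 := hstep k (by lia)
      rw [hP1] at h2
      have := abs_sub_le (K (P (k + 1) 0)) (K (P k 0)) (K (P 0 0))
      push_cast
      linarith
  have h0 : P 0 0 = u := by ext i; simp [hP]
  have hd' : P d 0 = v := by ext i; simp [hP]
  have := hsum d le_rfl
  rw [h0, hd'] at this
  linarith

lemma norm_ge_half_of_norm_sub_le {d : ℕ} {u v : Space d} (h : ‖u - v‖ ≤ ‖u‖ / 2) :
    ‖u‖ / 2 ≤ ‖v‖ := by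
  have := norm_sub_norm_le u v
  linarith

namespace IsOddKernel

variable {d n : ℕ} {K : Space d → ℝ}

/-- The Hörmander-type smoothness estimate. -/
lemma exists_abs_sub_le (hK : IsOddKernel n K) : ∃ L : ℝ, 0 ≤ L ∧ ∀ u v : Space d, u ≠ 0 →
    ‖u - v‖ ≤ ‖u‖ / 2 → |K u - K v| ≤ L * ‖u - v‖ / ‖u‖ ^ (n + 1) := by
  obtain ⟨C, hC0, hC⟩ := hK.bounds
  refine ⟨d * (C * 2 ^ (n + 1)), by positivity, fun u v hu huv => ?_⟩
  have hu0 : 0 < ‖u‖ := norm_pos_iff.2 hu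
  have hp : ∀ p : Space d, ‖p - u‖ ≤ ‖v - u‖ → ‖u‖ / 2 ≤ ‖p‖ := by
    intro p hp
    refine norm_ge_half_of_norm_sub_le ?_
    rw [norm_sub_rev]
    rw [norm_sub_rev] at huv
    exact hp.trans huv
  have hp0 : ∀ p : Space d, ‖p - u‖ ≤ ‖v - u‖ → p ≠ 0 := fun p h =>
    norm_pos_iff.1 ((half_pos hu0).trans_le (hp p h))
  have := abs_sub_le_of_lineDeriv_le (K := K) (u := u) (v := v)
    (B := C * 2 ^ (n + 1) / ‖u‖ ^ (n + 1))
    (fun p h i => hK.diff₁ i p (hp0 p h)) (fun p h i => ?_)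
  · rw [abs_sub_comm, norm_sub_rev u v]
    refine this.trans (le_of_eq ?_)
    ring
  · refine ((hC p (hp0 p h)).2.1 i).trans ?_
    have h1 : (‖u‖ / 2) ^ (n + 1) ≤ ‖p‖ ^ (n + 1) := pow_le_pow_left₀ (by positivity) (hp p h) _
    calc C / ‖p‖ ^ (n + 1) ≤ C / (‖u‖ / 2) ^ (n + 1) := by gcongr
      _ = C * 2 ^ (n + 1) / ‖u‖ ^ (n + 1) := by rw [div_pow]; field_simp

lemma continuousAt (hK : IsOddKernel n K) {x : Space d} (hx : x ≠ 0) : ContinuousAt K x := by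
  obtain ⟨L, hL0, hL⟩ := hK.exists_abs_sub_le
  have hx0 : 0 < ‖x‖ := norm_pos_iff.2 hx
  have hlim : Tendsto (fun v => L * ‖x - v‖ / ‖x‖ ^ (n + 1)) (𝓝 x) (𝓝 0) := by
    have : ContinuousAt (fun v => L * ‖x - v‖ / ‖x‖ ^ (n + 1)) x := by fun_prop
    simpa [ContinuousAt] using this
  rw [ContinuousAt, tendsto_iff_dist_tendsto_zero]
  refine squeeze_zero' (Eventually.of_forall fun _ => dist_nonneg) ?_ hlim
  filter_upwards [Metric.closedBall_mem_nhds x (half_pos hx0)] with v hv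
  rw [Metric.mem_closedBall, dist_comm, dist_eq_norm] at hv
  rw [Real.dist_eq, abs_sub_comm]
  exact hL x v hx hv

end IsOddKernel

/-- The estimates on a family `k_ε` of truncated kernels of homogeneity `-n` that enter the
boundedness of the variation operator. -/
structure IsTruncatedFamily {d : ℕ} (n : ℕ) (C : ℝ) (k : ℝ → Space d → ℝ) : Prop where
  nonneg : 0 ≤ C
  continuous : ∀ ε, 0 < ε → Continuous (k ε)
  size : ∀ ε, 0 < ε → ∀ u, |k ε u| ≤ C / ‖u‖ ^ n
  eq_zero : ∀ ε, 0 < ε → ∀ u, ‖u‖ < ε / 2 → k ε u = 0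
  eq_of_le : ∀ ε ε', 0 < ε → 0 < ε' → ∀ u, 2 * ε ≤ ‖u‖ → 2 * ε' ≤ ‖u‖ → k ε u = k ε' u
  tsum_le : ∀ u, ∀ ε : ℤ → ℝ, Antitone ε → (∀ m, 0 < ε m) →
    ∑' m : ℤ, ENNReal.ofReal |k (ε (m + 1)) u - k (ε m) u| ≤ ENNReal.ofReal (C / ‖u‖ ^ n)
  tsum_sub_le : ∀ u v, u ≠ 0 → ‖u - v‖ ≤ ‖u‖ / 2 →
    ∀ ε : ℤ → ℝ, Antitone ε → (∀ m, 0 < ε m) →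
    ∑' m : ℤ, ENNReal.ofReal |(k (ε (m + 1)) u - k (ε (m + 1)) v) - (k (ε m) u - k (ε m) v)| ≤
      ENNReal.ofReal (C * ‖u - v‖ / ‖u‖ ^ (n + 1))

lemma abs_log_norm_sub_le {d : ℕ} {u v : Space d} (hu : u ≠ 0) (h : ‖u - v‖ ≤ ‖u‖ / 2) :
    |Real.log ‖u‖ - Real.log ‖v‖| ≤ 2 * ‖u - v‖ / ‖u‖ := by
  have hu0 : 0 < ‖u‖ := norm_pos_iff.2 hu
  have hv := norm_ge_half_of_norm_sub_le h
  have hv0 : 0 < ‖v‖ := (half_pos hu0).trans_le hv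
  have h1 : ‖u‖ - ‖v‖ ≤ ‖u - v‖ := norm_sub_norm_le u v
  have h2 : ‖v‖ - ‖u‖ ≤ ‖u - v‖ := by rw [norm_sub_rev]; exact norm_sub_norm_le v u
  have h3 : Real.log (‖u‖ / ‖v‖) ≤ ‖u‖ / ‖v‖ - 1 := Real.log_le_sub_one_of_pos (by positivity)
  have h4 : Real.log (‖v‖ / ‖u‖) ≤ ‖v‖ / ‖u‖ - 1 := Real.log_le_sub_one_of_pos (by positivity)
  rw [Real.log_div hu0.ne' hv0.ne'] at h3
  rw [Real.log_div hv0.ne' hu0.ne'] at h4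
  rw [abs_le]
  constructor
  · have : ‖v‖ / ‖u‖ - 1 ≤ 2 * ‖u - v‖ / ‖u‖ := by
      rw [div_sub_one hu0.ne']
      gcongr
      linarith [norm_nonneg (u - v)]
    linarith
  · have : ‖u‖ / ‖v‖ - 1 ≤ 2 * ‖u - v‖ / ‖u‖ := by
      rw [div_sub_one hv0.ne', div_le_div_iff₀ hv0 hu0]
      nlinarith [norm_nonneg (u - v)]
    linarith

/-- The smooth truncations of an odd kernel form an admissible family. -/
lemma exists_isTruncatedFamily {d n : ℕ} {K : Space d → ℝ} (hK : IsOddKernel n K)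
    {φ : ℝ → ℝ} (hφ : IsTruncationProfile φ) :
    ∃ C, IsTruncatedFamily n C (truncKernel K φ) := by
  obtain ⟨C, hC0, hC⟩ := hK.bounds
  obtain ⟨L, hL0, hL⟩ := hK.exists_abs_sub_le
  obtain ⟨A, hA0, hA⟩ := hφ.exists_tsum_translate_sub_le
  have hnear : ∀ ε, 0 < ε → ∀ u : Space d, ‖u‖ < ε / 2 → φ (‖u‖ ^ 2 / ε ^ 2) = 0 := by
    intro ε hε u hu
    refine hφ.eq_zero (by positivity) ?_
    rw [div_lt_div_iff₀ (by positivity) (by norm_num)]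
    nlinarith [norm_nonneg u]
  have hsize : ∀ u : Space d, u ≠ 0 → |K u| ≤ C / ‖u‖ ^ n := fun u hu => (hC u hu).1
  have hzero : ∀ ε, 0 < ε → truncKernel K φ ε (0 : Space d) = 0 := by
    intro ε hε
    rw [truncKernel, hnear ε hε 0 (by simpa using hε), zero_mul]
  have hexp : ∀ u : Space d, u ≠ 0 → ∀ ε, 0 < ε →
      φ (‖u‖ ^ 2 / ε ^ 2) = φ (Real.exp (-2 * Real.log ε + 2 * Real.log ‖u‖)) := by
    intro u hu ε hε
    congr 1
    rw [Real.exp_add, mul_comm (-2), mul_comm 2, Real.exp_mul, Real.exp_mul, Real.exp_log hε,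
      Real.exp_log (norm_pos_iff.2 hu), Real.rpow_neg hε.le]
    norm_cast
    rw [div_eq_inv_mul]
  have hprof : ∀ u : Space d, ∀ ε : ℤ → ℝ, Antitone ε → (∀ m, 0 < ε m) →
      ∑' m : ℤ, ENNReal.ofReal |φ (‖u‖ ^ 2 / (ε (m + 1)) ^ 2) - φ (‖u‖ ^ 2 / (ε m) ^ 2)| ≤ 1 := by
    intro u ε h₁ h₂
    have := tsum_abs_sub_le_of_monotone (a := fun m => φ (‖u‖ ^ 2 / (ε m) ^ 2)) (α := 0) (β := 1)
      (fun i j hij => hφ.mono (by simp; positivity) (by simp; positivity) (by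
        have := h₂ j
        have := h₁ hij
        gcongr))
      (fun m => hφ.mem_Icc (by positivity))
    simpa using this
  refine ⟨C + L + A * 4 * C * 2 ^ n, by positivity, ?_, ?_, ?_, ?_, ?_, ?_⟩
  · intro ε hε
    rw [continuous_iff_continuousAt]
    intro u
    rcases eq_or_ne u 0 with rfl | hu
    · have : truncKernel K φ ε =ᶠ[𝓝 (0 : Space d)] fun _ => (0 : ℝ) := by
        filter_upwards [Metric.ball_mem_nhds (0 : Space d) (half_pos hε)] with v hv
        rw [truncKernel, hnear ε hε v (by simpa using hv), zero_mul]
      exact (continuousAt_const.congr this.symm)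
    · refine ContinuousAt.mul ?_ (hK.continuousAt hu)
      have h1 : ContinuousAt (fun v : Space d => ‖v‖ ^ 2 / ε ^ 2) u := by fun_prop
      have h2 : ContinuousAt φ (‖u‖ ^ 2 / ε ^ 2) := by
        refine (hφ.smooth.continuousOn).continuousAt (Ici_mem_nhds ?_)
        have : 0 < ‖u‖ := norm_pos_iff.2 hu
        positivity
      exact ContinuousAt.comp (f := fun v : Space d => ‖v‖ ^ 2 / ε ^ 2) h2 h1
  · intro ε hε u
    rcases eq_or_ne u 0 with rfl | hu
    · rw [hzero ε hε, abs_zero]; positivity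
    · rw [truncKernel, abs_mul]
      have h1 := hφ.mem_Icc (t := ‖u‖ ^ 2 / ε ^ 2) (by positivity)
      have h2 := hsize u hu
      rw [abs_of_nonneg h1.1]
      calc φ (‖u‖ ^ 2 / ε ^ 2) * |K u| ≤ 1 * (C / ‖u‖ ^ n) := by
            gcongr; exact h1.2
        _ ≤ _ := by
            rw [one_mul]
            gcongr
            have : 0 ≤ A * 4 * C * 2 ^ n := by positivity
            linarith
  · intro ε hε u hu
    rw [truncKernel, hnear ε hε u hu, zero_mul]
  · intro ε ε' hε hε' u h h'
    have key : ∀ ε, 0 < ε → 2 * ε ≤ ‖u‖ → φ (‖u‖ ^ 2 / ε ^ 2) = 1 := by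
      intro ε hε h
      refine hφ.eq_one ?_
      rw [le_div_iff₀ (by positivity)]
      nlinarith
    rw [truncKernel, truncKernel, key ε hε h, key ε' hε' h']
  · intro u ε h₁ h₂
    rcases eq_or_ne u 0 with rfl | hu
    · simp [hzero _ (h₂ _)]
    · calc ∑' m : ℤ, ENNReal.ofReal |truncKernel K φ (ε (m + 1)) u - truncKernel K φ (ε m) u|
          = ENNReal.ofReal |K u| * ∑' m : ℤ,
            ENNReal.ofReal |φ (‖u‖ ^ 2 / (ε (m + 1)) ^ 2) - φ (‖u‖ ^ 2 / (ε m) ^ 2)| := by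
            rw [← ENNReal.tsum_mul_left]
            refine tsum_congr fun m => ?_
            rw [← ENNReal.ofReal_mul (abs_nonneg _), truncKernel, truncKernel, ← sub_mul, abs_mul,
              mul_comm]
        _ ≤ ENNReal.ofReal |K u| * 1 := by gcongr; exact hprof u ε h₁ h₂
        _ ≤ _ := by
            rw [mul_one]
            refine ENNReal.ofReal_le_ofReal ((hsize u hu).trans ?_)
            gcongr
            have : 0 ≤ A * 4 * C * 2 ^ n := by positivity
            linarith
  · intro u v hu huv ε h₁ h₂
    have hu0 : 0 < ‖u‖ := norm_pos_iff.2 hu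
    have hv := norm_ge_half_of_norm_sub_le huv
    have hv0 : 0 < ‖v‖ := (half_pos hu0).trans_le hv
    have hv' : v ≠ 0 := norm_pos_iff.1 hv0
    have hlog := abs_log_norm_sub_le hu huv
    have hlog1 : 2 * ‖u - v‖ / ‖u‖ ≤ 1 := by
      rw [div_le_one hu0]; linarith
    have htr := hA (2 * Real.log ‖u‖) (2 * Real.log ‖v‖)
      (by rw [← mul_sub, abs_mul, abs_two]; linarith) (fun m => -2 * Real.log (ε m))
      (fun i j hij => by
        have := Real.log_le_log (h₂ j) (h₁ hij)
        simp only; linarith)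
    have hKv : |K v| ≤ C * 2 ^ n / ‖u‖ ^ n := by
      refine (hsize v hv').trans ?_
      calc C / ‖v‖ ^ n ≤ C / (‖u‖ / 2) ^ n := by gcongr
        _ = _ := by rw [div_pow]; field_simp
    calc ∑' m : ℤ, ENNReal.ofReal
          |(truncKernel K φ (ε (m + 1)) u - truncKernel K φ (ε (m + 1)) v) -
            (truncKernel K φ (ε m) u - truncKernel K φ (ε m) v)|
        ≤ ∑' m : ℤ, (ENNReal.ofReal |K u - K v| *
            ENNReal.ofReal |φ (‖u‖ ^ 2 / (ε (m + 1)) ^ 2) - φ (‖u‖ ^ 2 / (ε m) ^ 2)| +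
          ENNReal.ofReal |K v| * ENNReal.ofReal
            |(φ (‖u‖ ^ 2 / (ε (m + 1)) ^ 2) - φ (‖v‖ ^ 2 / (ε (m + 1)) ^ 2)) -
              (φ (‖u‖ ^ 2 / (ε m) ^ 2) - φ (‖v‖ ^ 2 / (ε m) ^ 2))|) := by
          refine ENNReal.tsum_le_tsum fun m => ?_
          rw [← ENNReal.ofReal_mul (abs_nonneg _), ← ENNReal.ofReal_mul (abs_nonneg _),
            ← ENNReal.ofReal_add (by positivity) (by positivity), ← abs_mul, ← abs_mul]
          refine ENNReal.ofReal_le_ofReal (le_trans (le_of_eq ?_) (abs_add_le _ _))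
          simp only [truncKernel]
          congr 1
          ring
      _ ≤ ENNReal.ofReal |K u - K v| * 1 +
          ENNReal.ofReal |K v| * ENNReal.ofReal (A * |2 * Real.log ‖u‖ - 2 * Real.log ‖v‖|) := by
          rw [ENNReal.tsum_add, ENNReal.tsum_mul_left, ENNReal.tsum_mul_left]
          gcongr
          · exact hprof u ε h₁ h₂
          · simpa only [hexp u hu _ (h₂ _), hexp v hv' _ (h₂ _)] using htr
      _ ≤ _ := by
          rw [mul_one, ← ENNReal.ofReal_mul (abs_nonneg _),
            ← ENNReal.ofReal_add (by positivity) (by positivity)]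
          refine ENNReal.ofReal_le_ofReal ?_
          rw [← mul_sub, abs_mul, abs_two]
          calc |K u - K v| + |K v| * (A * (2 * |Real.log ‖u‖ - Real.log ‖v‖|))
              ≤ L * ‖u - v‖ / ‖u‖ ^ (n + 1) +
                C * 2 ^ n / ‖u‖ ^ n * (A * (2 * (2 * ‖u - v‖ / ‖u‖))) := by
                gcongr
                exact hL u v hu huv
            _ = (L + A * 4 * C * 2 ^ n) * ‖u - v‖ / ‖u‖ ^ (n + 1) := by
                field_simp
                ring
            _ ≤ _ := by
                gcongr
                linarith

/-! ### Potentials of signed measures in polar form -/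

/-- The potentials `∫ k_ε(x - y) s(y) dτ(y)` of the signed measure `s τ`, for a family of kernels
`k_ε`. Either `|s| ≤ 1`, so that `τ` bounds the total variation of `s τ` (polar form), or `s` is a
function in `L^p(τ)`. -/
noncomputable def potential {d : ℕ} (k : ℝ → Space d → ℝ) (τ : Measure (Space d))
    (s : Space d → ℝ) (ε : ℝ) (x : Space d) : ℝ :=
  ∫ y, k ε (x - y) * s y ∂τ

/-- The total variation of `ε ↦ ∫ κ_ε s dτ` is at most the integral of that of `ε ↦ κ_ε`. -/
lemma paramVar_integral_le {X : Type*} [MeasurableSpace X] {ρ : ℝ} (hρ : 1 ≤ ρ) {τ : Measure X}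
    {s : X → ℝ} (hs1 : ∀ x, |s x| ≤ 1) {κ : ℝ → X → ℝ}
    (hκ : ∀ ε, 0 < ε → Measurable (κ ε))
    (hint : ∀ ε, 0 < ε → Integrable (fun w => κ ε w * s w) τ) {B : X → ℝ≥0∞}
    (hB : ∀ ε : ℤ → ℝ, Antitone ε → (∀ m, 0 < ε m) →
      ∀ᵐ w ∂τ, ∑' m : ℤ, ENNReal.ofReal |κ (ε (m + 1)) w - κ (ε m) w| ≤ B w) :
    paramVar ρ (fun ε => ∫ w, κ ε w * s w ∂τ) ≤ ∫⁻ w, B w ∂τ := by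
  refine paramVar_le_of_tsum_le hρ fun ε h₁ h₂ => ?_
  calc ∑' m : ℤ, ENNReal.ofReal |∫ w, κ (ε (m + 1)) w * s w ∂τ - ∫ w, κ (ε m) w * s w ∂τ|
      ≤ ∑' m : ℤ, ∫⁻ w, ENNReal.ofReal |κ (ε (m + 1)) w - κ (ε m) w| ∂τ := by
        refine ENNReal.tsum_le_tsum fun m => ?_
        rw [← integral_sub (hint _ (h₂ _)) (hint _ (h₂ _)), ← Real.enorm_eq_ofReal_abs]
        refine (enorm_integral_le_lintegral_enorm _).trans (lintegral_mono fun w => ?_)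
        rw [← sub_mul, Real.enorm_eq_ofReal_abs, abs_mul]
        exact ENNReal.ofReal_le_ofReal (mul_le_of_le_one_right (abs_nonneg _) (hs1 w))
    _ = ∫⁻ w, ∑' m : ℤ, ENNReal.ofReal |κ (ε (m + 1)) w - κ (ε m) w| ∂τ := by
        refine (lintegral_tsum fun m => ?_).symm
        have h1 := hκ _ (h₂ (m + 1))
        have h2 := hκ _ (h₂ m)
        exact (ENNReal.measurable_ofReal.comp
          (continuous_abs.measurable.comp (h1.sub h2))).aemeasurable
    _ ≤ _ := lintegral_mono_ae (hB ε h₁ h₂)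

section Potential

variable {d n : ℕ} {C : ℝ} {k : ℝ → Space d → ℝ}

lemma IsTruncatedFamily.abs_le (hk : IsTruncatedFamily n C k) {ε : ℝ} (hε : 0 < ε) (u : Space d) :
    |k ε u| ≤ C / (ε / 2) ^ n := by
  have hC := hk.nonneg
  rcases lt_or_ge ‖u‖ (ε / 2) with h | h
  · rw [hk.eq_zero ε hε u h, abs_zero]; positivity
  · exact (hk.size ε hε u).trans (by gcongr)

lemma IsTruncatedFamily.continuous_sub (hk : IsTruncatedFamily n C k) {ε : ℝ} (hε : 0 < ε)
    (x : Space d) : Continuous fun y => k ε (x - y) :=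
  (hk.continuous ε hε).comp (by fun_prop)

lemma IsTruncatedFamily.integrable (hk : IsTruncatedFamily n C k) {τ : Measure (Space d)}
    [IsFiniteMeasure τ] {s : Space d → ℝ} (hs : Measurable s) (hs1 : ∀ x, |s x| ≤ 1) {ε : ℝ}
    (hε : 0 < ε) (x : Space d) : Integrable (fun y => k ε (x - y) * s y) τ := by
  refine Integrable.of_bound
    ((hk.continuous_sub hε x).measurable.mul hs).aestronglyMeasurable (C / (ε / 2) ^ n)
    (Eventually.of_forall fun y => ?_)
  rw [Real.norm_eq_abs, abs_mul]
  exact (mul_le_of_le_one_right (abs_nonneg _) (hs1 y)).trans (hk.abs_le hε _)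

lemma IsTruncatedFamily.continuous_potential (hk : IsTruncatedFamily n C k)
    {τ : Measure (Space d)} [IsFiniteMeasure τ] {s : Space d → ℝ} (hs : Measurable s)
    (hs1 : ∀ x, |s x| ≤ 1) {ε : ℝ} (hε : 0 < ε) : Continuous (potential k τ s ε) := by
  refine continuous_of_dominated (bound := fun _ => C / (ε / 2) ^ n) (fun x => ?_) (fun x => ?_)
    (integrable_const _) ?_
  · exact ((hk.continuous_sub hε x).measurable.mul hs).aestronglyMeasurable
  · refine Eventually.of_forall fun y => ?_
    rw [Real.norm_eq_abs, abs_mul]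
    exact (mul_le_of_le_one_right (abs_nonneg _) (hs1 y)).trans (hk.abs_le hε _)
  · refine Eventually.of_forall fun y => ?_
    exact ((hk.continuous ε hε).comp (by fun_prop)).mul continuous_const

lemma IsTruncatedFamily.isOpen_lt (hk : IsTruncatedFamily n C k) {ρ : ℝ} (hρ : 1 ≤ ρ)
    {τ : Measure (Space d)} [IsFiniteMeasure τ] {s : Space d → ℝ} (hs : Measurable s)
    (hs1 : ∀ x, |s x| ≤ 1) (t : ℝ≥0∞) : IsOpen {x | t < rhoVariation ρ (potential k τ s) x} :=
  (lowerSemicontinuous_rhoVariation hρ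
    fun _ hε => hk.continuous_potential hs hs1 hε).isOpen_preimage t

/-- The size estimate for the variation: no cancellation is used. -/
lemma IsTruncatedFamily.rhoVariation_le (hk : IsTruncatedFamily n C k) {ρ : ℝ} (hρ : 1 ≤ ρ)
    {τ : Measure (Space d)} [IsFiniteMeasure τ] {s : Space d → ℝ} (hs : Measurable s)
    (hs1 : ∀ x, |s x| ≤ 1) (x : Space d) :
    rhoVariation ρ (potential k τ s) x ≤ ∫⁻ w, ENNReal.ofReal (C / ‖x - w‖ ^ n) ∂τ :=
  paramVar_integral_le hρ hs1 (κ := fun ε w => k ε (x - w))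
    (fun _ hε => (hk.continuous_sub hε x).measurable) (fun _ hε => hk.integrable hs hs1 hε x)
    fun ε h₁ h₂ => Eventually.of_forall fun w => hk.tsum_le (x - w) ε h₁ h₂

lemma potential_add_compl (hk : IsTruncatedFamily n C k) {τ : Measure (Space d)}
    [IsFiniteMeasure τ] {s : Space d → ℝ} (hs : Measurable s) (hs1 : ∀ x, |s x| ≤ 1)
    {A : Set (Space d)} (hA : MeasurableSet A) {ε : ℝ} (hε : 0 < ε) (x : Space d) :
    potential k τ s ε x = potential k (τ.restrict A) s ε x + potential k (τ.restrict Aᶜ) s ε x :=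
  (integral_add_compl hA (hk.integrable hs hs1 hε x)).symm

lemma rhoVariation_potential_le_add (hk : IsTruncatedFamily n C k) {ρ : ℝ} (hρ : 1 ≤ ρ)
    {τ : Measure (Space d)} [IsFiniteMeasure τ] {s : Space d → ℝ} (hs : Measurable s)
    (hs1 : ∀ x, |s x| ≤ 1) {A : Set (Space d)} (hA : MeasurableSet A) (x : Space d) :
    rhoVariation ρ (potential k τ s) x ≤ rhoVariation ρ (potential k (τ.restrict A) s) x +
      rhoVariation ρ (potential k (τ.restrict Aᶜ) s) x := by
  simp only [rhoVariation_eq_paramVar]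
  refine le_trans (le_of_eq ?_) (paramVar_add_le hρ _ _)
  exact paramVar_congr fun ε hε => potential_add_compl hk hs hs1 hA hε x

end Potential

/-! ### Signed measures in polar form -/

lemma integral_lsmul_toSignedMeasure {X : Type*} [MeasurableSpace X] (μ : Measure X)
    [IsFiniteMeasure μ] (f : X → ℝ) : ∫ᵛ x, f x ∂•μ.toSignedMeasure = ∫ x, f x ∂μ := by
  rw [← VectorMeasure.integral_toSignedMeasure]
  congr 1
  ext
  simp

lemma integrable_toSignedMeasure_iff {X : Type*} [MeasurableSpace X] {μ : Measure X}
    [IsFiniteMeasure μ] {f : X → ℝ} : μ.toSignedMeasure.Integrable f ↔ Integrable f μ := by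
  rw [VectorMeasure.Integrable, Measure.variation_toSignedMeasure]

/-- Each signed measure is of the form `s τ` with `|s| = 1` and `τ` its total variation. -/
lemma exists_polar {X : Type*} [MeasurableSpace X] (ν : SignedMeasure X) :
    ∃ s : X → ℝ, Measurable s ∧ (∀ x, |s x| ≤ 1) ∧ IsFiniteMeasure ν.variation ∧
      ∀ f : X → ℝ, Integrable f ν.variation →
        ∫ᵛ x, f x ∂•ν = ∫ x, f x * s x ∂ν.variation := by
  classical
  set j := ν.toJordanDecomposition with hj
  have hvar : ν.variation = j.posPart + j.negPart := by
    rw [← SignedMeasure.totalVariation_eq_variation, SignedMeasure.totalVariation]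
  have hν : ν = j.posPart.toSignedMeasure - j.negPart.toSignedMeasure :=
    (ν.toSignedMeasure_toJordanDecomposition).symm
  obtain ⟨S, hS, hS1, hS2⟩ := j.mutuallySingular
  refine ⟨fun x => if x ∈ S then -1 else 1, Measurable.ite hS measurable_const measurable_const,
    fun x => by dsimp only; split_ifs <;> simp, by rw [hvar]; infer_instance, fun f hf => ?_⟩
  rw [hvar] at hf ⊢
  obtain ⟨hf1, hf2⟩ := integrable_add_measure.1 hf
  have h1 : (fun x => f x * (if x ∈ S then -1 else 1)) =ᵐ[j.posPart] f := by
    have : ∀ᵐ x ∂j.posPart, x ∉ S := measure_eq_zero_iff_ae_notMem.1 hS1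
    filter_upwards [this] with x hx
    simp [hx]
  have h2 : (fun x => f x * (if x ∈ S then -1 else 1)) =ᵐ[j.negPart] fun x => -f x := by
    have : ∀ᵐ x ∂j.negPart, x ∉ Sᶜ := measure_eq_zero_iff_ae_notMem.1 hS2
    filter_upwards [this] with x hx
    simp [not_not.1 hx]
  rw [integral_add_measure (hf1.congr h1.symm) (hf2.neg.congr h2.symm), integral_congr_ae h1,
    integral_congr_ae h2, integral_neg, ← sub_eq_add_neg]
  conv_lhs => rw [hν]
  rw [VectorMeasure.integral_sub_vectorMeasure (integrable_toSignedMeasure_iff.2 hf1)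
      (integrable_toSignedMeasure_iff.2 hf2),
    integral_lsmul_toSignedMeasure, integral_lsmul_toSignedMeasure]

/-- Conversely, `s τ` is a signed measure of total variation at most `τ` when `|s| ≤ 1`. -/
lemma exists_signedMeasure_of_polar {X : Type*} [MeasurableSpace X] (τ : Measure X)
    [IsFiniteMeasure τ] {s : X → ℝ} (hs : Measurable s) (hs1 : ∀ x, |s x| ≤ 1) :
    ∃ ν : SignedMeasure X, ν.variation ≤ τ ∧
      ∀ f : X → ℝ, Integrable f τ → ∫ᵛ x, f x ∂•ν = ∫ x, f x * s x ∂τ := by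
  have hp : Measurable fun x => ENNReal.ofReal (s x) := hs.ennreal_ofReal
  have hm : Measurable fun x => ENNReal.ofReal (-s x) := hs.neg.ennreal_ofReal
  have hsum : ∀ x, ENNReal.ofReal (s x) + ENNReal.ofReal (-s x) ≤ 1 := by
    intro x
    rcases le_total 0 (s x) with h | h
    · rw [ENNReal.ofReal_of_nonpos (neg_nonpos.2 h), add_zero]
      exact ENNReal.ofReal_le_one.2 ((le_abs_self _).trans (hs1 x))
    · rw [ENNReal.ofReal_of_nonpos h, zero_add]
      exact ENNReal.ofReal_le_one.2 ((neg_le_abs _).trans (hs1 x))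
  have hp1 : ∀ x, ENNReal.ofReal (s x) ≤ 1 := fun x => le_self_add.trans (hsum x)
  have hm1 : ∀ x, ENNReal.ofReal (-s x) ≤ 1 := fun x => le_add_self.trans (hsum x)
  have hle : ∀ g : X → ℝ≥0∞, (∀ x, g x ≤ 1) → τ.withDensity g ≤ τ := fun g hg => by
    conv_rhs => rw [← withDensity_one (μ := τ)]
    exact withDensity_mono (Eventually.of_forall hg)
  set P := τ.withDensity fun x => ENNReal.ofReal (s x) with hP
  set N := τ.withDensity fun x => ENNReal.ofReal (-s x) with hN
  have : IsFiniteMeasure P := isFiniteMeasure_of_le τ (hle _ hp1)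
  have : IsFiniteMeasure N := isFiniteMeasure_of_le τ (hle _ hm1)
  refine ⟨P.toSignedMeasure - N.toSignedMeasure, ?_, fun f hf => ?_⟩
  · refine VectorMeasure.variation_sub_le.trans ?_
    rw [Measure.variation_toSignedMeasure, Measure.variation_toSignedMeasure, hP, hN,
      ← withDensity_add_left hp]
    exact hle _ hsum
  · have hfP : Integrable f P := hf.mono_measure (hle _ hp1)
    have hfN : Integrable f N := hf.mono_measure (hle _ hm1)
    rw [VectorMeasure.integral_sub_vectorMeasure (integrable_toSignedMeasure_iff.2 hfP)
        (integrable_toSignedMeasure_iff.2 hfN),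
      integral_lsmul_toSignedMeasure, integral_lsmul_toSignedMeasure, hP, hN,
      integral_withDensity_eq_integral_toReal_smul hp (Eventually.of_forall fun x => by simp),
      integral_withDensity_eq_integral_toReal_smul hm (Eventually.of_forall fun x => by simp)]
    have hb : ∀ r : ℝ, |r| ≤ 1 → (ENNReal.ofReal r).toReal ≤ 1 := fun r hr =>
      ENNReal.toReal_le_of_le_ofReal zero_le_one
        (ENNReal.ofReal_le_ofReal ((le_abs_self r).trans hr))
    rw [← integral_sub]
    · refine integral_congr_ae (Eventually.of_forall fun x => ?_)
      simp only [smul_eq_mul, ← sub_mul, mul_comm (f x)]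
      congr 1
      rcases le_total 0 (s x) with h | h
      · rw [ENNReal.ofReal_of_nonpos (neg_nonpos.2 h), ENNReal.toReal_ofReal h]; simp
      · rw [ENNReal.ofReal_of_nonpos h, ENNReal.toReal_ofReal (neg_nonneg.2 h)]; simp
    · exact hf.bdd_mul (c := 1) hp.ennreal_toReal.aestronglyMeasurable
        (Eventually.of_forall fun x => by
          rw [Real.norm_of_nonneg ENNReal.toReal_nonneg]; exact hb _ (hs1 x))
    · exact hf.bdd_mul (c := 1) hm.ennreal_toReal.aestronglyMeasurable
        (Eventually.of_forall fun x => by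
          rw [Real.norm_of_nonneg ENNReal.toReal_nonneg]; exact hb _ (by simpa using hs1 x))

/-- The weak type `(1,1)` bound for the `ρ`-variation of the potentials of the measures `s τ`, with
respect to the measure `σ`. -/
def PolarWeakBound {d : ℕ} (k : ℝ → Space d → ℝ) (ρ : ℝ) (σ : Measure (Space d))
    (C : ℝ≥0) : Prop :=
  ∀ (τ : Measure (Space d)) [IsFiniteMeasure τ] (s : Space d → ℝ), Measurable s →
    (∀ x, |s x| ≤ 1) → ∀ t : ℝ≥0, 0 < t →
      t * σ {x | t < rhoVariation ρ (potential k τ s) x} ≤ C * τ univ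

lemma weakBound_iff_polarWeakBound {d n : ℕ} {C : ℝ} {K : Space d → ℝ} {φ : ℝ → ℝ}
    (hk : IsTruncatedFamily n C (truncKernel K φ)) {ρ : ℝ} {σ : Measure (Space d)} {A : ℝ≥0} :
    WeakBound K φ ρ σ A ↔ PolarWeakBound (truncKernel K φ) ρ σ A := by
  have hint : ∀ (τ : Measure (Space d)) [IsFiniteMeasure τ] (ε : ℝ), 0 < ε → ∀ x,
      Integrable (fun y => truncKernel K φ ε (x - y)) τ := by
    intro τ _ ε hε x
    simpa using hk.integrable (τ := τ) (s := fun _ => 1) measurable_const (by simp) hε x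
  constructor
  · intro h τ _ s hs hs1 t ht
    obtain ⟨ν, hν, hν'⟩ := exists_signedMeasure_of_polar τ hs hs1
    have heq : rhoVariation ρ (truncMeasure K φ ν) =
        rhoVariation ρ (potential (truncKernel K φ) τ s) := by
      ext x
      simp only [rhoVariation_eq_paramVar]
      exact paramVar_congr fun ε hε => hν' _ (hint τ ε hε x)
    rw [← heq]
    refine (h ν t ht).trans ?_
    gcongr
  · intro h ν t ht
    obtain ⟨s, hs, hs1, hfin, hν⟩ := exists_polar ν
    have heq : rhoVariation ρ (truncMeasure K φ ν) =
        rhoVariation ρ (potential (truncKernel K φ) ν.variation s) := by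
      ext x
      simp only [rhoVariation_eq_paramVar]
      exact paramVar_congr fun ε hε => hν _ (hint _ ε hε x)
    rw [heq]
    exact h ν.variation s hs hs1 t ht

/-! ### Ahlfors-David regular measures -/

section Regular

variable {d n : ℕ} {μ : Measure (Space d)}

/-- The upper bound in the definition of regularity holds, with another constant, for balls with
arbitrary centres and radii. -/
lemma IsADRegular.exists_ball_le (hμ : IsADRegular n μ) (hpt : ∀ x, μ.support ≠ {x}) :
    ∃ A : ℝ, 0 < A ∧ ∀ x r, 0 < r → μ (Metric.ball x r) ≤ ENNReal.ofReal (A * r ^ n) := by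
  obtain ⟨C, hC0, hC⟩ := hμ
  have hnull : μ μ.supportᶜ = 0 := Measure.measure_compl_support
  suffices h : ∃ A : ℝ, 0 < A ∧ ∀ x ∈ μ.support, ∀ r, 0 < r →
      μ (Metric.ball x r) ≤ ENNReal.ofReal (A * r ^ n) by
    obtain ⟨A, hA0, hA⟩ := h
    refine ⟨A * 2 ^ n, by positivity, fun x r hr => ?_⟩
    by_cases hne : (Metric.ball x r ∩ μ.support).Nonempty
    · obtain ⟨y, hy, hys⟩ := hne
      calc μ (Metric.ball x r) ≤ μ (Metric.ball y (2 * r)) := by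
            refine measure_mono (Metric.ball_subset_ball' ?_)
            rw [Metric.mem_ball, dist_comm] at hy
            linarith
        _ ≤ ENNReal.ofReal (A * (2 * r) ^ n) := hA y hys _ (by positivity)
        _ = _ := by rw [mul_pow, mul_assoc]
    · have : Metric.ball x r ⊆ μ.supportᶜ := fun y hy hys => hne ⟨y, hy, hys⟩
      rw [measure_mono_null this hnull]
      positivity
  by_cases htop : Metric.ediam μ.support = ⊤
  · exact ⟨C, hC0, fun x hx r hr => (hC x hx r hr (by rw [htop]; exact le_top)).2⟩
  rcases eq_empty_or_nonempty μ.support with hemp | ⟨x₀, hx₀⟩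
  · exact ⟨1, one_pos, fun x hx => by rw [hemp] at hx; exact hx.elim⟩
  -- a bounded support is covered by finitely many of the balls of maximal admissible radius
  set D := (Metric.ediam μ.support).toReal with hD
  have hDof : ENNReal.ofReal D = Metric.ediam μ.support := ENNReal.ofReal_toReal htop
  have hD0 : 0 < D := by
    refine ENNReal.toReal_pos (fun h0 => ?_) htop
    rw [Metric.ediam_eq_zero_iff] at h0
    exact hpt x₀ (h0.eq_singleton_of_mem hx₀)
  have hcomp : IsCompact μ.support :=
    Metric.isCompact_of_isClosed_isBounded Measure.isClosed_support
      (Metric.isBounded_iff_ediam_ne_top.2 htop)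
  have hfin : μ univ < ⊤ := by
    obtain ⟨t, ht, hcov⟩ := hcomp.elim_nhds_subcover (fun x => Metric.ball x D)
      (fun x _ => Metric.ball_mem_nhds x hD0)
    have h1 : μ μ.support < ⊤ := by
      refine (measure_mono hcov).trans_lt ((measure_biUnion_finset_le _ _).trans_lt ?_)
      refine ENNReal.sum_lt_top.2 fun x hx => ?_
      exact (hC x (ht x hx) D hD0 hDof.le).2.trans_lt ENNReal.ofReal_lt_top
    calc μ univ ≤ μ μ.support + μ μ.supportᶜ := by
          rw [← union_compl_self μ.support]; exact measure_union_le _ _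
      _ < ⊤ := by rw [hnull, add_zero]; exact h1
  set m := (μ univ).toReal with hm
  have hm0 : 0 ≤ m := ENNReal.toReal_nonneg
  refine ⟨C + m / D ^ n, by positivity, fun x hx r hr => ?_⟩
  rcases le_total r D with h | h
  · refine (hC x hx r hr ((ENNReal.ofReal_le_ofReal h).trans hDof.le)).2.trans ?_
    refine ENNReal.ofReal_le_ofReal ?_
    have : 0 ≤ m / D ^ n := by positivity
    gcongr
    linarith
  · calc μ (Metric.ball x r) ≤ μ univ := measure_mono (subset_univ _)
      _ = ENNReal.ofReal m := (ENNReal.ofReal_toReal hfin.ne).symm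
      _ ≤ _ := by
        refine ENNReal.ofReal_le_ofReal ?_
        calc m = m / D ^ n * D ^ n := by field_simp
          _ ≤ (C + m / D ^ n) * r ^ n := by
            gcongr
            linarith

lemma IsADRegular.exists_le_ball (hμ : IsADRegular n μ) :
    ∃ c : ℝ, 0 < c ∧ ∀ x ∈ μ.support, ∀ r, 0 < r → ENNReal.ofReal r ≤ Metric.ediam μ.support →
      ENNReal.ofReal (c * r ^ n) ≤ μ (Metric.ball x r) := by
  obtain ⟨C, hC0, hC⟩ := hμ
  exact ⟨C⁻¹, by positivity, fun x hx r hr h => (hC x hx r hr h).1⟩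

/-- A measure with `n`-dimensional growth is dominated by the `n`-dimensional Hausdorff measure. -/
lemma le_mul_hausdorffMeasure {A : ℝ} (hA0 : 0 < A)
    (hA : ∀ x r, 0 < r → μ (Metric.ball x r) ≤ ENNReal.ofReal (A * r ^ n)) (E : Set (Space d)) :
    μ E ≤ ENNReal.ofReal A * Measure.hausdorffMeasure (n : ℝ) E := by
  have hA' : ENNReal.ofReal A ≠ 0 := by simpa using hA0
  have key : (ENNReal.ofReal A)⁻¹ • μ ≤ Measure.hausdorffMeasure (n : ℝ) := by
    refine Measure.le_hausdorffMeasure n _ 1 one_pos fun s hs => ?_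
    rw [Measure.smul_apply, smul_eq_mul, ENNReal.rpow_natCast, mul_comm, ← div_eq_mul_inv]
    refine ENNReal.div_le_of_le_mul ?_
    rcases eq_empty_or_nonempty s with rfl | ⟨x, hx⟩
    · simp
    have htop : Metric.ediam s ≠ ⊤ := (hs.trans_lt ENNReal.one_lt_top).ne
    set δ := (Metric.ediam s).toReal with hδ
    have hδ0 : 0 ≤ δ := ENNReal.toReal_nonneg
    have hδof : ENNReal.ofReal δ = Metric.ediam s := ENNReal.ofReal_toReal htop
    have h1 : ∀ r, δ < r → μ s ≤ ENNReal.ofReal (A * r ^ n) := by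
      intro r hr
      refine (measure_mono fun y hy => ?_).trans (hA x r (hδ0.trans_lt hr))
      have h2 : edist y x ≤ ENNReal.ofReal δ := by
        rw [hδof]; exact Metric.edist_le_ediam_of_mem hy hx
      rw [Metric.mem_ball]
      rw [edist_dist, ENNReal.ofReal_le_ofReal_iff hδ0] at h2
      exact h2.trans_lt hr
    have h2 : Tendsto (fun r => ENNReal.ofReal (A * r ^ n)) (𝓝[>] δ)
        (𝓝 (ENNReal.ofReal (A * δ ^ n))) := by
      have hc : Continuous fun r : ℝ => ENNReal.ofReal (A * r ^ n) :=
        ENNReal.continuous_ofReal.comp (by fun_prop)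
      exact hc.continuousWithinAt
    have h3 := ge_of_tendsto h2 (eventually_mem_nhdsWithin.mono fun r hr => h1 r hr)
    rwa [ENNReal.ofReal_mul hA0.le, ENNReal.ofReal_pow hδ0, hδof, mul_comm] at h3
  have := key E
  rw [Measure.smul_apply, smul_eq_mul, mul_comm, ← div_eq_mul_inv,
    ENNReal.div_le_iff hA' ENNReal.ofReal_ne_top, mul_comm] at this
  exact this

/-- The integral of a power of the distance over the exterior of a ball, by decomposition into
dyadic annuli. -/
lemma lintegral_compl_ball_rpow_le (n : ℕ) {β : ℝ} (hβ : 0 < β) {τ : Measure (Space d)}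
    {x : Space d} {R : ℝ} (hR : 0 < R) {M : ℝ≥0∞}
    (hM : ∀ s, R ≤ s → τ (Metric.ball x s) ≤ M * ENNReal.ofReal (s ^ n)) :
    ∫⁻ w in (Metric.ball x R)ᶜ, ENNReal.ofReal (‖x - w‖ ^ (-((n : ℝ) + β))) ∂τ ≤
      M * ENNReal.ofReal (2 ^ n / (1 - 2 ^ (-β)) * R ^ (-β)) := by
  set q : ℝ := 2 ^ (-β) with hq
  have hq0 : 0 < q := by positivity
  have hq1 : q < 1 := Real.rpow_lt_one_of_one_lt_of_neg one_lt_two (neg_lt_zero.2 hβ)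
  have hpt : ∀ w ∈ (Metric.ball x R)ᶜ, ENNReal.ofReal (‖x - w‖ ^ (-((n : ℝ) + β))) ≤
      ∑' j : ℕ, (Metric.ball x (2 ^ (j + 1) * R)).indicator
        (fun _ => ENNReal.ofReal ((2 ^ j * R) ^ (-((n : ℝ) + β)))) w := by
    intro w hw
    have hw' : R ≤ ‖x - w‖ := by
      rw [mem_compl_iff, Metric.mem_ball, not_lt, dist_comm, dist_eq_norm] at hw
      exact hw
    obtain ⟨j, hj1, hj2⟩ := exists_nat_pow_near (x := ‖x - w‖ / R) (y := (2 : ℝ))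
      (by rwa [one_le_div hR]) one_lt_two
    rw [le_div_iff₀ hR] at hj1
    rw [div_lt_iff₀ hR] at hj2
    refine le_trans ?_ (ENNReal.le_tsum j)
    rw [indicator_of_mem (by rwa [Metric.mem_ball, dist_comm, dist_eq_norm])]
    refine ENNReal.ofReal_le_ofReal (Real.rpow_le_rpow_of_nonpos (by positivity) hj1 ?_)
    have : 0 ≤ (n : ℝ) := n.cast_nonneg
    linarith
  have hterm : ∀ j : ℕ, (2 ^ j * R) ^ (-((n : ℝ) + β)) * (2 ^ (j + 1) * R) ^ n =
      2 ^ n * R ^ (-β) * q ^ j := by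
    intro j
    have hb : (0 : ℝ) < 2 ^ j * R := by positivity
    have h2 : ((2 : ℝ) ^ j) ^ (-β) = q ^ j := by
      rw [hq, ← Real.rpow_natCast, ← Real.rpow_mul (by norm_num), ← Real.rpow_natCast,
        ← Real.rpow_mul (by norm_num), mul_comm]
    calc (2 ^ j * R) ^ (-((n : ℝ) + β)) * (2 ^ (j + 1) * R) ^ n
        = (2 ^ j * R) ^ (-(n : ℝ)) * (2 ^ j * R) ^ (-β) * (2 ^ n * (2 ^ j * R) ^ n) := by
          rw [neg_add, Real.rpow_add hb, ← mul_pow]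
          congr 2
          ring
      _ = 2 ^ n * (2 ^ j * R) ^ (-β) := by
          rw [Real.rpow_neg hb.le, Real.rpow_natCast]
          field_simp
      _ = _ := by
          rw [Real.mul_rpow (by positivity) hR.le, h2]
          ring
  calc ∫⁻ w in (Metric.ball x R)ᶜ, ENNReal.ofReal (‖x - w‖ ^ (-((n : ℝ) + β))) ∂τ
      ≤ ∫⁻ w in (Metric.ball x R)ᶜ, ∑' j : ℕ, (Metric.ball x (2 ^ (j + 1) * R)).indicator
        (fun _ => ENNReal.ofReal ((2 ^ j * R) ^ (-((n : ℝ) + β)))) w ∂τ :=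
        setLIntegral_mono' Metric.isOpen_ball.measurableSet.compl hpt
    _ ≤ ∫⁻ w, ∑' j : ℕ, (Metric.ball x (2 ^ (j + 1) * R)).indicator
        (fun _ => ENNReal.ofReal ((2 ^ j * R) ^ (-((n : ℝ) + β)))) w ∂τ :=
        setLIntegral_le_lintegral _ _
    _ = ∑' j : ℕ, ENNReal.ofReal ((2 ^ j * R) ^ (-((n : ℝ) + β))) *
          τ (Metric.ball x (2 ^ (j + 1) * R)) := by
        rw [lintegral_tsum fun j => (measurable_const.indicator
          Metric.isOpen_ball.measurableSet).aemeasurable]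
        exact tsum_congr fun j => lintegral_indicator_const Metric.isOpen_ball.measurableSet _
    _ ≤ ∑' j : ℕ, M * ENNReal.ofReal (2 ^ n * R ^ (-β) * q ^ j) := by
        refine ENNReal.tsum_le_tsum fun j => ?_
        rw [← hterm, ENNReal.ofReal_mul (by positivity), mul_left_comm]
        gcongr
        refine hM _ ?_
        have : (1 : ℝ) ≤ 2 ^ (j + 1) := one_le_pow₀ one_le_two
        nlinarith
    _ = M * ENNReal.ofReal (2 ^ n / (1 - q) * R ^ (-β)) := by
        rw [ENNReal.tsum_mul_left, ← ENNReal.ofReal_tsum_of_nonneg (fun j => by positivity)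
          ((summable_geometric_of_lt_one hq0.le hq1).mul_left _), tsum_mul_left,
          tsum_geometric_of_lt_one hq0.le hq1]
        congr 2
        field_simp

end Regular

/-! ### The maximal function -/

section Maximal

variable {d : ℕ}

/-- The centred `n`-dimensional maximal function `sup_r τ(B(x,r)) / r^n`, augmented by the mean
`τ(ℝ^d) / μ(ℝ^d)`. The latter only matters when `μ` is finite: it accounts for the scales beyond
the diameter of the support of `μ`. -/
noncomputable def maximalFun (n : ℕ) (μ τ : Measure (Space d)) (x : Space d) : ℝ≥0∞ :=
  max (⨆ (r : ℝ) (_ : 0 < r), τ (Metric.ball x r) / ENNReal.ofReal (r ^ n)) (τ univ / μ univ)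

variable {n : ℕ} {μ τ : Measure (Space d)}

lemma lt_maximalFun_iff {x : Space d} {t : ℝ≥0∞} : t < maximalFun n μ τ x ↔
    (∃ r : ℝ, 0 < r ∧ t * ENNReal.ofReal (r ^ n) < τ (Metric.ball x r)) ∨
      t < τ univ / μ univ := by
  simp only [maximalFun, lt_max_iff, lt_iSup_iff, exists_prop]
  refine or_congr_left (exists_congr fun r => and_congr_right fun hr => ?_)
  rw [ENNReal.lt_div_iff_mul_lt]
  · left; simp; positivity
  · left; exact ENNReal.ofReal_ne_top

lemma measure_ball_le_of_maximalFun_le {x : Space d} {t : ℝ≥0∞} (h : maximalFun n μ τ x ≤ t)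
    {r : ℝ} (hr : 0 < r) : τ (Metric.ball x r) ≤ t * ENNReal.ofReal (r ^ n) := by
  by_contra hc
  exact not_lt.2 h (lt_maximalFun_iff.2 (Or.inl ⟨r, hr, not_le.1 hc⟩))

lemma isOpen_lt_maximalFun (t : ℝ≥0∞) : IsOpen {x | t < maximalFun n μ τ x} := by
  simp only [lt_maximalFun_iff, ofPred_or]
  refine IsOpen.union ?_ isOpen_const
  rw [isOpen_iff_mem_nhds]
  rintro x ⟨r, hr, hlt⟩
  have hball : Metric.ball x r = ⋃ j : ℕ, Metric.ball x (r - r / (j + 2)) := by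
    ext y
    simp only [Metric.mem_ball, mem_iUnion]
    constructor
    · intro hy
      obtain ⟨j, hj⟩ := exists_nat_gt (r / (r - dist y x))
      refine ⟨j, ?_⟩
      have h1 : 0 < r - dist y x := sub_pos.2 hy
      rw [div_lt_iff₀ h1] at hj
      have h2 : r / (j + 2) < r - dist y x := by
        rw [div_lt_iff₀ (by positivity)]
        nlinarith
      linarith
    · rintro ⟨j, hj⟩
      have : 0 < r / ((j : ℝ) + 2) := by positivity
      linarith
  have hmono : Monotone fun j : ℕ => Metric.ball x (r - r / ((j : ℝ) + 2)) := by
    intro i j hij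
    refine Metric.ball_subset_ball (sub_le_sub_left ?_ _)
    have : (i : ℝ) ≤ j := by exact_mod_cast hij
    gcongr
  rw [hball, hmono.measure_iUnion, lt_iSup_iff] at hlt
  obtain ⟨j, hj⟩ := hlt
  have hpos : 0 < r / ((j : ℝ) + 2) := by positivity
  filter_upwards [Metric.ball_mem_nhds x hpos] with y hy
  refine ⟨r, hr, hj.trans_le (measure_mono (Metric.ball_subset_ball' ?_))⟩
  rw [Metric.mem_ball, dist_comm] at hy
  linarith

lemma measurable_maximalFun : Measurable (maximalFun n μ τ) :=
  measurable_of_Ioi fun t => (isOpen_lt_maximalFun t).measurableSet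

/-- The weak type `(1,1)` bound for the maximal function, by the Vitali covering lemma. -/
lemma mul_measure_lt_maximalFun_le (hn : 1 ≤ n) {A : ℝ} (hA0 : 0 < A)
    (hA : ∀ x r, 0 < r → μ (Metric.ball x r) ≤ ENNReal.ofReal (A * r ^ n))
    [IsFiniteMeasure τ] {t : ℝ≥0} (ht : 0 < t) :
    t * μ {x | t < maximalFun n μ τ x} ≤ ENNReal.ofReal (A * 4 ^ n + 1) * τ univ := by
  set E := {x : Space d | ∃ r : ℝ, 0 < r ∧ t * ENNReal.ofReal (r ^ n) < τ (Metric.ball x r)}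
    with hE
  have hsub : {x | (t : ℝ≥0∞) < maximalFun n μ τ x} ⊆ E ∪ {_x | (t : ℝ≥0∞) < τ univ / μ univ} := by
    intro x hx
    exact lt_maximalFun_iff.1 hx
  have h2 : t * μ {_x : Space d | (t : ℝ≥0∞) < τ univ / μ univ} ≤ τ univ := by
    by_cases h : (t : ℝ≥0∞) < τ univ / μ univ
    · simp only [h, ofPred_true]
      exact ENNReal.mul_le_of_le_div h.le
    · simp [h]
  have h1 : t * μ E ≤ ENNReal.ofReal (A * 4 ^ n) * τ univ := by
    choose! r hr0 hr using fun x (hx : x ∈ E) => hx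
    have hbdd : ∃ R : ℝ, ∀ x ∈ E, r x ≤ R := by
      refine ⟨max 1 ((τ univ).toReal / t), fun x hx => ?_⟩
      rcases le_total (r x) 1 with h | h
      · exact h.trans (le_max_left _ _)
      · refine le_trans ?_ (le_max_right _ _)
        have ht' : (0 : ℝ) < t := by exact_mod_cast ht
        rw [le_div_iff₀ ht']
        have h3 : ENNReal.ofReal (t * r x ^ n) ≤ τ univ := by
          rw [ENNReal.ofReal_mul ht'.le, ENNReal.ofReal_coe_nnreal]
          exact (hr x hx).le.trans (measure_mono (subset_univ _))
        have h4 := (ENNReal.ofReal_le_iff_le_toReal (measure_ne_top τ univ)).1 h3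
        have h5 : r x ≤ r x ^ n := le_self_pow₀ h (by lia)
        nlinarith
    obtain ⟨R, hR⟩ := hbdd
    obtain ⟨u, huE, hdisj, hcov⟩ := Vitali.exists_disjoint_subfamily_covering_enlargement_ball
      E id r R hR 4 (by norm_num)
    have hcount : u.Countable := hdisj.countable_of_isOpen (fun _ _ => Metric.isOpen_ball)
      (fun x hx => ⟨x, Metric.mem_ball_self (hr0 x (huE hx))⟩)
    have hEsub : E ⊆ ⋃ x ∈ u, Metric.ball x (4 * r x) := by
      intro x hx
      obtain ⟨y, hy, hxy⟩ := hcov x hx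
      exact mem_iUnion₂.2 ⟨y, hy, hxy (Metric.mem_ball_self (hr0 x hx))⟩
    have : Countable u := hcount.to_subtype
    calc t * μ E ≤ t * ∑' x : u, μ (Metric.ball (x : Space d) (4 * r x)) := by
          gcongr
          exact (measure_mono hEsub).trans (measure_biUnion_le μ hcount _)
      _ ≤ ∑' x : u, ENNReal.ofReal (A * 4 ^ n) * τ (Metric.ball (x : Space d) (r x)) := by
          rw [← ENNReal.tsum_mul_left]
          refine ENNReal.tsum_le_tsum fun x => ?_
          have hx := huE x.2
          calc t * μ (Metric.ball (x : Space d) (4 * r x))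
              ≤ t * ENNReal.ofReal (A * (4 * r x) ^ n) := by
                gcongr
                exact hA _ _ (by have := hr0 x hx; positivity)
            _ = ENNReal.ofReal (A * 4 ^ n) * (t * ENNReal.ofReal (r x ^ n)) := by
                rw [mul_pow, ← mul_assoc, ENNReal.ofReal_mul (by positivity)]
                ring
            _ ≤ _ := by gcongr; exact (hr x hx).le
      _ = ENNReal.ofReal (A * 4 ^ n) * τ (⋃ x ∈ u, Metric.ball x (r x)) := by
          rw [ENNReal.tsum_mul_left, measure_biUnion (f := fun x => Metric.ball x (r x)) hcount
            hdisj fun _ _ => Metric.isOpen_ball.measurableSet]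
      _ ≤ _ := by gcongr; exact subset_univ _
  calc t * μ {x | (t : ℝ≥0∞) < maximalFun n μ τ x}
      ≤ t * (μ E + μ {_x : Space d | (t : ℝ≥0∞) < τ univ / μ univ}) := by
        gcongr
        exact (measure_mono hsub).trans (measure_union_le _ _)
    _ ≤ ENNReal.ofReal (A * 4 ^ n) * τ univ + τ univ := by
        rw [mul_add]
        exact add_le_add h1 h2
    _ = _ := by
        rw [ENNReal.ofReal_add (by positivity) zero_le_one, ENNReal.ofReal_one, add_mul, one_mul]

end Maximal

/-! ### The far part of a measure -/

section Far

variable {d n : ℕ} {C : ℝ} {k : ℝ → Space d → ℝ}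

/-- The variation of the potential of the part of `τ` away from a ball varies by at most a multiple
of the maximal function between two points at distance comparable to the radius. -/
lemma IsTruncatedFamily.rhoVariation_far_le_far (hk : IsTruncatedFamily n C k) {ρ : ℝ}
    (hρ : 1 ≤ ρ) {τ : Measure (Space d)} [IsFiniteMeasure τ] {s : Space d → ℝ} (hs : Measurable s)
    (hs1 : ∀ x, |s x| ≤ 1) {x y z : Space d} {r : ℝ} (hr : 0 < r) (hy : dist y x ≤ r)
    (hz : dist z x ≤ 10 * r) {M : ℝ≥0∞}
    (hM : ∀ R, 30 * r ≤ R → τ (Metric.ball x R) ≤ M * ENNReal.ofReal (R ^ n)) :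
    rhoVariation ρ (potential k (τ.restrict (Metric.ball x (30 * r))ᶜ) s) y ≤
      rhoVariation ρ (potential k (τ.restrict (Metric.ball x (30 * r))ᶜ) s) z +
        M * ENNReal.ofReal (C * 2 ^ (2 * n + 2)) := by
  have hC := hk.nonneg
  set τ₂ := τ.restrict (Metric.ball x (30 * r))ᶜ with hτ₂
  have hyz : ‖y - z‖ ≤ 11 * r := by
    rw [← dist_eq_norm]
    have := dist_triangle_right y z x
    linarith
  have hfar : ∀ w ∈ (Metric.ball x (30 * r))ᶜ, 30 * r ≤ ‖x - w‖ ∧ ‖x - w‖ ≤ ‖y - w‖ + r := by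
    intro w hw
    rw [mem_compl_iff, Metric.mem_ball, not_lt, dist_comm, dist_eq_norm] at hw
    refine ⟨hw, ?_⟩
    rw [← dist_eq_norm, ← dist_eq_norm]
    have := dist_triangle x y w
    rw [dist_comm x y] at this
    linarith
  have hdiff : paramVar ρ (fun ε => ∫ w, (k ε (y - w) - k ε (z - w)) * s w ∂τ₂) ≤
      ∫⁻ w, ENNReal.ofReal (C * (11 * r) * 2 ^ (n + 1)) *
        ENNReal.ofReal (‖x - w‖ ^ (-((n : ℝ) + 1))) ∂τ₂ := by
    refine paramVar_integral_le hρ hs1 (κ := fun ε w => k ε (y - w) - k ε (z - w))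
      (fun ε hε => ((hk.continuous_sub hε y).sub (hk.continuous_sub hε z)).measurable)
      (fun ε hε => ?_) (fun ε h₁ h₂ => ?_)
    · simp only [sub_mul]
      exact (hk.integrable hs hs1 hε y).sub (hk.integrable hs hs1 hε z)
    · refine (ae_restrict_iff' Metric.isOpen_ball.measurableSet.compl).2
        (Eventually.of_forall fun w hw => ?_)
      obtain ⟨hw1, hw2⟩ := hfar w hw
      have hyw : 29 * r ≤ ‖y - w‖ := by linarith
      have hyw0 : 0 < ‖y - w‖ := by linarith
      have hxw0 : 0 < ‖x - w‖ := by linarith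
      have hsub : (y - w) - (z - w) = y - z := by abel
      have := hk.tsum_sub_le (y - w) (z - w) (norm_pos_iff.1 hyw0)
        (by rw [hsub]; linarith) ε h₁ h₂
      refine this.trans ?_
      rw [← ENNReal.ofReal_mul (by positivity), hsub]
      refine ENNReal.ofReal_le_ofReal ?_
      have h3 : ‖x - w‖ / 2 ≤ ‖y - w‖ := by linarith
      rw [Real.rpow_neg hxw0.le, ← Nat.cast_add_one, Real.rpow_natCast]
      calc C * ‖y - z‖ / ‖y - w‖ ^ (n + 1)
          ≤ C * (11 * r) / (‖x - w‖ / 2) ^ (n + 1) := by gcongr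
        _ = _ := by rw [div_pow]; field_simp
  have htail : ∫⁻ w, ENNReal.ofReal (C * (11 * r) * 2 ^ (n + 1)) *
        ENNReal.ofReal (‖x - w‖ ^ (-((n : ℝ) + 1))) ∂τ₂ ≤
      M * ENNReal.ofReal (C * 2 ^ (2 * n + 2)) := by
    rw [lintegral_const_mul' _ _ ENNReal.ofReal_ne_top]
    calc _ ≤ ENNReal.ofReal (C * (11 * r) * 2 ^ (n + 1)) *
          (M * ENNReal.ofReal (2 ^ n / (1 - 2 ^ (-(1 : ℝ))) * (30 * r) ^ (-(1 : ℝ)))) := by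
          gcongr
          exact lintegral_compl_ball_rpow_le n one_pos (by positivity) hM
      _ = M * ENNReal.ofReal ((C * (11 * r) * 2 ^ (n + 1)) *
            (2 ^ n / (1 - 2 ^ (-(1 : ℝ))) * (30 * r) ^ (-(1 : ℝ)))) := by
          rw [ENNReal.ofReal_mul (p := C * (11 * r) * 2 ^ (n + 1)) (by positivity)]
          ring
      _ ≤ _ := by
          refine mul_le_mul_right (ENNReal.ofReal_le_ofReal ?_) _
          rw [Real.rpow_neg_one, Real.rpow_neg_one]
          have : (C * (11 * r) * 2 ^ (n + 1)) * (2 ^ n / (1 - 2⁻¹) * (30 * r)⁻¹) =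
              C * 2 ^ (2 * n + 2) * (11 / 30) := by
            rw [show 2 * n + 2 = (n + 1) + n + 1 by ring, pow_succ _ (n + 1 + n), pow_add]
            field_simp
            ring
          rw [this]
          have : 0 ≤ C * 2 ^ (2 * n + 2) := by positivity
          linarith
  simp only [rhoVariation_eq_paramVar]
  calc paramVar ρ (fun ε => potential k τ₂ s ε y)
      = paramVar ρ (fun ε => potential k τ₂ s ε z +
          ∫ w, (k ε (y - w) - k ε (z - w)) * s w ∂τ₂) := by
        refine paramVar_congr fun ε hε => ?_
        simp only [sub_mul, potential]
        rw [integral_sub (hk.integrable hs hs1 hε y) (hk.integrable hs hs1 hε z)]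
        ring
    _ ≤ _ := (paramVar_add_le hρ _ _).trans (add_le_add_right (hdiff.trans htail) _)

/-- Removing the part of `τ` near a point changes the variation at that point by at most a multiple
of the maximal function. Large truncations do not see the removed part, and the small ones are
sensitive to the remaining part in an annulus only. -/
lemma IsTruncatedFamily.rhoVariation_far_le (hk : IsTruncatedFamily n C k) {ρ : ℝ}
    (hρ : 1 ≤ ρ) {τ : Measure (Space d)} [IsFiniteMeasure τ] {s : Space d → ℝ} (hs : Measurable s)
    (hs1 : ∀ x, |s x| ≤ 1) {x z : Space d} {r : ℝ} (hr : 0 < r) (hz : dist z x ≤ 10 * r)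
    {M : ℝ≥0∞} (hM : ∀ R, 30 * r ≤ R → τ (Metric.ball x R) ≤ M * ENNReal.ofReal (R ^ n)) :
    rhoVariation ρ (potential k (τ.restrict (Metric.ball x (30 * r))ᶜ) s) z ≤
      rhoVariation ρ (potential k τ s) z + M * ENNReal.ofReal (C * 11 ^ n) := by
  have hC := hk.nonneg
  set τ₂ := τ.restrict (Metric.ball x (30 * r))ᶜ with hτ₂
  have hms : MeasurableSet (Metric.ball x (30 * r)) := Metric.isOpen_ball.measurableSet
  simp only [rhoVariation_eq_paramVar]
  refine (paramVar_le_split hρ _ (100 * r)).trans (add_le_add ?_ ?_)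
  · calc paramVar ρ (fun ε => potential k τ₂ s (max ε (100 * r)) z)
        = paramVar ρ (fun ε => potential k τ s (max ε (100 * r)) z) := by
          refine paramVar_congr fun ε hε => ?_
          have hε' : 0 < max ε (100 * r) := lt_max_of_lt_left hε
          rw [potential_add_compl (τ := τ) hk hs hs1 hms hε' z, right_eq_add]
          refine setIntegral_eq_zero_of_forall_eq_zero fun w hw => ?_
          rw [hk.eq_zero _ hε', zero_mul]
          rw [Metric.mem_ball, dist_comm] at hw
          rw [← dist_eq_norm]
          have h1 := dist_triangle z x w
          have h2 := le_max_right ε (100 * r)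
          linarith
      _ ≤ paramVar ρ (fun ε => potential k τ s ε z) :=
          paramVar_comp_le (fun ε => potential k τ s ε z) (θ := fun ε => max ε (100 * r))
            (fun a _ b _ hab => max_le_max_right _ hab) fun ε hε => lt_max_of_lt_left hε
  · have hmin : ∀ ε, 0 < ε → 0 < min ε (100 * r) := fun ε hε => lt_min hε (by positivity)
    calc paramVar ρ (fun ε => potential k τ₂ s (min ε (100 * r)) z)
        ≤ ∫⁻ w, (Metric.ball x (210 * r)).indicator
            (fun _ => ENNReal.ofReal (C / (20 * r) ^ n)) w ∂τ₂ := by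
          refine paramVar_integral_le hρ hs1 (κ := fun ε w => k (min ε (100 * r)) (z - w))
            (fun ε hε => (hk.continuous_sub (hmin ε hε) z).measurable)
            (fun ε hε => hk.integrable hs hs1 (hmin ε hε) z) (fun ε h₁ h₂ => ?_)
          refine (ae_restrict_iff' hms.compl).2 (Eventually.of_forall fun w hw => ?_)
          rw [mem_compl_iff, Metric.mem_ball, not_lt] at hw
          have hzw : 20 * r ≤ ‖z - w‖ := by
            rw [← dist_eq_norm]
            have := dist_triangle_left w x z
            linarith
          by_cases hw2 : w ∈ Metric.ball x (210 * r)
          · rw [indicator_of_mem hw2]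
            refine (hk.tsum_le (z - w) (fun m => min (ε m) (100 * r))
              (fun i j hij => min_le_min_right _ (h₁ hij)) (fun m => hmin _ (h₂ m))).trans ?_
            exact ENNReal.ofReal_le_ofReal (by gcongr)
          · have hzw2 : 200 * r ≤ ‖z - w‖ := by
              rw [← dist_eq_norm]
              rw [Metric.mem_ball, not_lt] at hw2
              have := dist_triangle_left w x z
              linarith
            rw [indicator_of_notMem hw2]
            refine le_of_eq (ENNReal.tsum_eq_zero.2 fun m => ?_)
            have hle : ∀ i, 2 * min (ε i) (100 * r) ≤ ‖z - w‖ := fun i => by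
              have := min_le_right (ε i) (100 * r)
              linarith
            rw [hk.eq_of_le _ _ (hmin _ (h₂ (m + 1))) (hmin _ (h₂ m)) (z - w) (hle _) (hle _)]
            simp
      _ ≤ ENNReal.ofReal (C / (20 * r) ^ n) * τ (Metric.ball x (210 * r)) := by
          rw [lintegral_indicator_const Metric.isOpen_ball.measurableSet]
          gcongr
          exact Measure.restrict_le_self
      _ ≤ ENNReal.ofReal (C / (20 * r) ^ n) * (M * ENNReal.ofReal ((220 * r) ^ n)) := by
          gcongr
          refine (hM _ (by linarith)).trans ?_
          gcongr
          norm_num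
      _ = M * ENNReal.ofReal (C / (20 * r) ^ n * (220 * r) ^ n) := by
          rw [ENNReal.ofReal_mul (p := C / (20 * r) ^ n) (by positivity)]
          ring
      _ = M * ENNReal.ofReal (C * 11 ^ n) := by
          congr 2
          rw [show 220 * r = 11 * (20 * r) by ring, mul_pow 11]
          field_simp

/-- Comparison of the variation of the far part at `y` with the full variation at `z`. -/
lemma IsTruncatedFamily.rhoVariation_far_le_of_ball (hk : IsTruncatedFamily n C k) {ρ : ℝ}
    (hρ : 1 ≤ ρ) {τ : Measure (Space d)} [IsFiniteMeasure τ] {s : Space d → ℝ} (hs : Measurable s)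
    (hs1 : ∀ x, |s x| ≤ 1) {x y z ξ : Space d} {r : ℝ} (hr : 0 < r) (hy : dist y x ≤ r)
    (hz : dist z x ≤ 10 * r) (hξ : dist ξ x ≤ r) {m : ℝ≥0∞}
    (hm : ∀ R, 0 < R → τ (Metric.ball ξ R) ≤ m * ENNReal.ofReal (R ^ n)) :
    rhoVariation ρ (potential k (τ.restrict (Metric.ball x (30 * r))ᶜ) s) y ≤
      rhoVariation ρ (potential k τ s) z +
        m * ENNReal.ofReal (2 ^ n * (C * 11 ^ n + C * 2 ^ (2 * n + 2))) := by
  have hC := hk.nonneg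
  have hM : ∀ R, 30 * r ≤ R →
      τ (Metric.ball x R) ≤ (m * ENNReal.ofReal (2 ^ n)) * ENNReal.ofReal (R ^ n) := by
    intro R hR
    calc τ (Metric.ball x R) ≤ τ (Metric.ball ξ (2 * R)) := by
          refine measure_mono (Metric.ball_subset_ball' ?_)
          rw [dist_comm]
          linarith
      _ ≤ m * ENNReal.ofReal ((2 * R) ^ n) := hm _ (by linarith)
      _ = _ := by rw [mul_pow, ENNReal.ofReal_mul (by positivity), mul_assoc]
  refine (hk.rhoVariation_far_le_far hρ hs hs1 hr hy hz hM).trans ?_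
  refine (add_le_add_left (hk.rhoVariation_far_le hρ hs hs1 hr hz hM) _).trans (le_of_eq ?_)
  rw [ENNReal.ofReal_mul (p := 2 ^ n) (by positivity),
    ENNReal.ofReal_add (p := C * 11 ^ n) (by positivity) (by positivity)]
  ring

end Far

/-! ### The good `λ` inequality -/

/-- A regular measure `μ` such that each ball centred on its support contains a big piece of a set
on which the variation operator is of weak type `(1,1)`, with all the constants displayed. -/
structure HasBigPieces {d : ℕ} (n : ℕ) (k : ℝ → Space d → ℝ) (ρ : ℝ) (μ : Measure (Space d))
    (C A c : ℝ) (C₀ C₁ : ℝ≥0) : Prop where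
  one_le : 1 ≤ n
  one_le_exponent : 1 ≤ ρ
  family : IsTruncatedFamily n C k
  pos_upper : 0 < A
  pos_lower : 0 < c
  ball_le : ∀ x r, 0 < r → μ (Metric.ball x r) ≤ ENNReal.ofReal (A * r ^ n)
  le_ball : ∀ x ∈ μ.support, ∀ r, 0 < r → ENNReal.ofReal r ≤ Metric.ediam μ.support →
    ENNReal.ofReal (c * r ^ n) ≤ μ (Metric.ball x r)
  pos_piece : 0 < C₀
  exists_piece : ∀ x ∈ μ.support, ∀ r : ℝ, 0 < r → ∃ F : Set (Space d),
    C₀ * μ (Metric.ball x r) ≤ μ (F ∩ Metric.ball x r) ∧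
    PolarWeakBound k ρ ((Measure.hausdorffMeasure (n : ℝ)).restrict F) C₁

namespace HasBigPieces

variable {d n : ℕ} {k : ℝ → Space d → ℝ} {ρ : ℝ} {μ : Measure (Space d)} {C A c : ℝ} {C₀ C₁ : ℝ≥0}

/-- The weak type bound on a big piece, in terms of `μ`. -/
lemma mul_measure_inter_le (h : HasBigPieces n k ρ μ C A c C₀ C₁) {F : Set (Space d)}
    (hF : PolarWeakBound k ρ ((Measure.hausdorffMeasure (n : ℝ)).restrict F) C₁)
    (τ : Measure (Space d)) [IsFiniteMeasure τ] {s : Space d → ℝ} (hs : Measurable s)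
    (hs1 : ∀ x, |s x| ≤ 1) {t : ℝ≥0} (ht : 0 < t) :
    t * μ (F ∩ {x | t < rhoVariation ρ (potential k τ s) x}) ≤
      ENNReal.ofReal A * C₁ * τ univ := by
  set U := {x | (t : ℝ≥0∞) < rhoVariation ρ (potential k τ s) x} with hU
  have hUo : IsOpen U := h.family.isOpen_lt h.one_le_exponent hs hs1 _
  have h1 := le_mul_hausdorffMeasure h.pos_upper h.ball_le (F ∩ U)
  have h2 := hF τ s hs hs1 t ht
  rw [← hU, Measure.restrict_apply hUo.measurableSet, inter_comm U F] at h2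
  calc t * μ (F ∩ U) ≤ t * (ENNReal.ofReal A * Measure.hausdorffMeasure (n : ℝ) (F ∩ U)) := by
        gcongr
    _ = ENNReal.ofReal A * (t * Measure.hausdorffMeasure (n : ℝ) (F ∩ U)) := by ring
    _ ≤ ENNReal.ofReal A * (C₁ * τ univ) := by gcongr
    _ = _ := by rw [mul_assoc]

/-- The constant of `IsTruncatedFamily.rhoVariation_far_le_of_ball`. -/
noncomputable def farConst (n : ℕ) (C : ℝ) : ℝ≥0 :=
  (2 ^ n * (C * 11 ^ n + C * 2 ^ (2 * n + 2))).toNNReal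

/-- The good `λ` inequality on one ball: a fixed proportion of a ball `B` which has a point `z` with
`V(z) ≤ λ` nearby is outside the set where `V > (1 + 2e)λ` and the maximal function is small. -/
lemma half_mul_measure_ball_le (h : HasBigPieces n k ρ μ C A c C₀ C₁) {e γ : ℝ≥0} (he : 0 < e)
    (hγ1 : farConst n C * γ ≤ e) (hγ2 : A * C₁ * 31 ^ n * γ ≤ e * (c * (C₀ / 2)))
    (τ : Measure (Space d)) [IsFiniteMeasure τ] {s : Space d → ℝ} (hs : Measurable s)
    (hs1 : ∀ x, |s x| ≤ 1) {l : ℝ≥0} (hl : 0 < l) {x z : Space d} (hx : x ∈ μ.support) {r : ℝ}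
    (hr : 0 < r) (hrd : ENNReal.ofReal r ≤ Metric.ediam μ.support) (hzx : dist z x ≤ 10 * r)
    (hz : rhoVariation ρ (potential k τ s) z ≤ l) :
    ((C₀ / 2 : ℝ≥0) : ℝ≥0∞) * μ (Metric.ball x r) ≤
      μ (Metric.ball x r \ {y | ((1 + 2 * e) * l : ℝ≥0) < rhoVariation ρ (potential k τ s) y ∧
        maximalFun n μ τ y ≤ (γ * l : ℝ≥0)}) := by
  set G := {y | (((1 + 2 * e) * l : ℝ≥0) : ℝ≥0∞) < rhoVariation ρ (potential k τ s) y ∧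
    maximalFun n μ τ y ≤ (γ * l : ℝ≥0)} with hG
  set B := Metric.ball x r with hB
  have hA0 := h.pos_upper
  have hc0 := h.pos_lower
  obtain ⟨F, hF0, hF1⟩ := h.exists_piece x hx r hr
  have hsplit : (C₀ : ℝ≥0∞) = ((C₀ / 2 : ℝ≥0) : ℝ≥0∞) + ((C₀ / 2 : ℝ≥0) : ℝ≥0∞) := by
    rw [← ENNReal.coe_add, add_halves]
  rcases eq_empty_or_nonempty (B ∩ G) with hemp | ⟨ξ, hξB, hξG⟩
  · have : B \ G = B := sdiff_eq_left.2 (disjoint_iff_inter_eq_empty.2 hemp)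
    rw [this]
    refine le_trans ?_ (hF0.trans (measure_mono inter_subset_right))
    rw [hsplit, add_mul]
    exact le_self_add
  have hmax : ∀ R, 0 < R → τ (Metric.ball ξ R) ≤ (γ * l : ℝ≥0) * ENNReal.ofReal (R ^ n) :=
    fun R hR => measure_ball_le_of_maximalFun_le hξG.2 hR
  have hξx : dist ξ x ≤ r := (Metric.mem_ball.1 hξB).le
  set τ₁ := τ.restrict (Metric.ball x (30 * r)) with hτ₁
  have hsub : F ∩ B ∩ G ⊆
      F ∩ {y | ((e * l : ℝ≥0) : ℝ≥0∞) < rhoVariation ρ (potential k τ₁ s) y} := by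
    rintro y ⟨⟨hyF, hyB⟩, hyG⟩
    refine ⟨hyF, ?_⟩
    by_contra hcon
    rw [mem_ofPred_eq, not_lt] at hcon
    have h1 := rhoVariation_potential_le_add h.family h.one_le_exponent hs hs1
      (τ := τ) (Metric.isOpen_ball (x := x) (ε := 30 * r)).measurableSet y
    have h2 := h.family.rhoVariation_far_le_of_ball h.one_le_exponent hs hs1 hr
      (Metric.mem_ball.1 hyB).le hzx hξx hmax
    have h3 : rhoVariation ρ (potential k τ s) y ≤ ((1 + 2 * e) * l : ℝ≥0) := by
      calc rhoVariation ρ (potential k τ s) y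
          ≤ (e * l : ℝ≥0) + (l + (γ * l : ℝ≥0) * (farConst n C : ℝ≥0)) :=
            h1.trans (add_le_add hcon (h2.trans (add_le_add_left hz _)))
        _ ≤ ((1 + 2 * e) * l : ℝ≥0) := by
            norm_cast
            calc e * l + (l + γ * l * farConst n C) = (1 + e + farConst n C * γ) * l := by ring
              _ ≤ (1 + e + e) * l := by gcongr
              _ = _ := by ring
    exact not_lt.2 h3 hyG.1
  have hBfin : μ B ≠ ⊤ := ((h.ball_le x r hr).trans_lt ENNReal.ofReal_lt_top).ne
  have hsmall : μ (F ∩ B ∩ G) ≤ ((C₀ / 2 : ℝ≥0) : ℝ≥0∞) * μ B := by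
    have h1 := h.mul_measure_inter_le hF1 τ₁ hs hs1 (mul_pos he hl)
    have h2 : τ₁ univ ≤ (γ * l : ℝ≥0) * ENNReal.ofReal ((31 * r) ^ n) := by
      rw [hτ₁, Measure.restrict_apply_univ]
      refine le_trans (measure_mono (Metric.ball_subset_ball' ?_)) (hmax (31 * r) (by positivity))
      rw [dist_comm]
      linarith
    have hel : ((e * l : ℝ≥0) : ℝ≥0∞) ≠ 0 := by
      simpa using ⟨he.ne', hl.ne'⟩
    have h3 : ((e * l : ℝ≥0) : ℝ≥0∞) * μ (F ∩ B ∩ G) ≤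
        ((e * l : ℝ≥0) : ℝ≥0∞) * (((C₀ / 2 : ℝ≥0) : ℝ≥0∞) * μ B) := by
      calc ((e * l : ℝ≥0) : ℝ≥0∞) * μ (F ∩ B ∩ G)
          ≤ ENNReal.ofReal A * C₁ * ((γ * l : ℝ≥0) * ENNReal.ofReal ((31 * r) ^ n)) := by
            refine (mul_le_mul_right (measure_mono hsub) _).trans (h1.trans ?_)
            gcongr
        _ = ENNReal.ofReal (A * C₁ * 31 ^ n * γ * (l * r ^ n)) := by
            rw [← ENNReal.ofReal_coe_nnreal, ← ENNReal.ofReal_coe_nnreal,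
              ← ENNReal.ofReal_mul hA0.le, ← ENNReal.ofReal_mul (by positivity),
              ← ENNReal.ofReal_mul (by positivity)]
            congr 1
            push_cast
            ring
        _ ≤ ENNReal.ofReal (e * (c * (C₀ / 2)) * (l * r ^ n)) := by
            refine ENNReal.ofReal_le_ofReal ?_
            gcongr
        _ = ((e * l : ℝ≥0) : ℝ≥0∞) * (((C₀ / 2 : ℝ≥0) : ℝ≥0∞) * ENNReal.ofReal (c * r ^ n)) := by
            rw [← ENNReal.ofReal_coe_nnreal, ← ENNReal.ofReal_coe_nnreal,
              ← ENNReal.ofReal_mul (by positivity), ← ENNReal.ofReal_mul (by positivity)]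
            congr 1
            push_cast
            ring
        _ ≤ _ := by
            gcongr
            exact h.le_ball x hx r hr hrd
    exact (ENNReal.mul_le_mul_iff_right hel ENNReal.coe_ne_top).1 h3
  have hfin : ((C₀ / 2 : ℝ≥0) : ℝ≥0∞) * μ B ≠ ⊤ := ENNReal.mul_ne_top ENNReal.coe_ne_top hBfin
  refine (ENNReal.add_le_add_iff_left hfin).1 ?_
  calc ((C₀ / 2 : ℝ≥0) : ℝ≥0∞) * μ B + ((C₀ / 2 : ℝ≥0) : ℝ≥0∞) * μ B
      = C₀ * μ B := by rw [← add_mul, ← hsplit]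
    _ ≤ μ (F ∩ B) := hF0
    _ ≤ μ (F ∩ B ∩ G) + μ ((F ∩ B) \ G) := measure_le_inter_add_sdiff _ _ _
    _ ≤ _ := add_le_add hsmall (measure_mono (sdiff_subset_sdiff_left inter_subset_right))

/-- When `V > λ` on the whole support, the maximal function is large because of its mean value
part. -/
lemma lt_mean_of_support_subset (h : HasBigPieces n k ρ μ C A c C₀ C₁) {γ : ℝ≥0}
    (hγ : A * C₁ * γ < C₀) (τ : Measure (Space d)) [IsFiniteMeasure τ] {s : Space d → ℝ}
    (hs : Measurable s) (hs1 : ∀ x, |s x| ≤ 1) {l : ℝ≥0} (hl : 0 < l) (hne : μ ≠ 0)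
    (hsub : μ.support ⊆ {x | l < rhoVariation ρ (potential k τ s) x}) :
    ((γ * l : ℝ≥0) : ℝ≥0∞) < τ univ / μ univ := by
  obtain ⟨x₀, hx₀⟩ := Measure.nonempty_support hne
  have hnull : μ μ.supportᶜ = 0 := Measure.measure_compl_support
  set U := {x | (l : ℝ≥0∞) < rhoVariation ρ (potential k τ s) x} with hU
  have hball : ∀ j : ℕ, l * (C₀ * μ (Metric.ball x₀ (j + 1))) ≤
      ENNReal.ofReal A * C₁ * τ univ := by
    intro j
    obtain ⟨F, hF0, hF1⟩ := h.exists_piece x₀ hx₀ (j + 1) (by positivity)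
    have h1 := h.mul_measure_inter_le hF1 τ hs hs1 hl
    refine le_trans ?_ h1
    gcongr
    refine hF0.trans ?_
    calc μ (F ∩ Metric.ball x₀ (j + 1)) ≤ μ ((F ∩ U) ∪ μ.supportᶜ) := by
          refine measure_mono fun y hy => ?_
          by_cases hys : y ∈ μ.support
          · exact Or.inl ⟨hy.1, hsub hys⟩
          · exact Or.inr hys
      _ ≤ μ (F ∩ U) + μ μ.supportᶜ := measure_union_le _ _
      _ = μ (F ∩ U) := by rw [hnull, add_zero]
  have huniv : l * (C₀ * μ univ) ≤ ENNReal.ofReal A * C₁ * τ univ := by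
    have hU' : (⋃ j : ℕ, Metric.ball x₀ ((j : ℝ) + 1)) = univ := by
      refine eq_univ_of_forall fun y => mem_iUnion.2 ?_
      obtain ⟨j, hj⟩ := exists_nat_gt (dist y x₀)
      exact ⟨j, by rw [Metric.mem_ball]; linarith⟩
    have hmono : Monotone fun j : ℕ => Metric.ball x₀ ((j : ℝ) + 1) := fun i j hij =>
      Metric.ball_subset_ball (by gcongr)
    have hsup : μ univ = ⨆ j : ℕ, μ (Metric.ball x₀ ((j : ℝ) + 1)) := by
      rw [← hU', hmono.measure_iUnion]
    rw [hsup, ENNReal.mul_iSup, ENNReal.mul_iSup]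
    exact iSup_le hball
  have hl' : (l : ℝ≥0∞) ≠ 0 := by simpa using hl.ne'
  have hC₀' : (C₀ : ℝ≥0∞) ≠ 0 := by simpa using h.pos_piece.ne'
  have huniv0 : μ univ ≠ 0 := by simpa using hne
  have hfin : μ univ ≠ ⊤ := by
    intro htop
    rw [htop, ENNReal.mul_top hC₀', ENNReal.mul_top hl', top_le_iff] at huniv
    exact ENNReal.mul_ne_top (ENNReal.mul_ne_top ENNReal.ofReal_ne_top ENNReal.coe_ne_top)
      (measure_ne_top τ univ) huniv
  rw [ENNReal.lt_div_iff_mul_lt (Or.inl huniv0) (Or.inl hfin)]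
  by_contra hcon
  rw [not_lt] at hcon
  have h1 : (l * μ univ) * C₀ ≤ (l * μ univ) * (ENNReal.ofReal A * C₁ * γ) := by
    calc (l * μ univ) * C₀ = l * (C₀ * μ univ) := by ring
      _ ≤ ENNReal.ofReal A * C₁ * ((γ * l : ℝ≥0) * μ univ) := huniv.trans (by gcongr)
      _ = _ := by push_cast; ring
  have h2 := (ENNReal.mul_le_mul_iff_right (mul_ne_zero hl' huniv0)
    (ENNReal.mul_ne_top ENNReal.coe_ne_top hfin)).1 h1
  rw [← ENNReal.ofReal_coe_nnreal, ← ENNReal.ofReal_coe_nnreal, ← ENNReal.ofReal_coe_nnreal,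
    ← ENNReal.ofReal_mul h.pos_upper.le,
    ← ENNReal.ofReal_mul (by have := h.pos_upper; positivity),
    ENNReal.ofReal_le_ofReal_iff (by have := h.pos_upper; positivity)] at h2
  exact not_lt.2 h2 hγ

/-- A proportion of the set `{V > λ}`, when of finite measure, is outside the set where
`V > (1 + 2e)λ` and the maximal function is small. The local estimates are summed over a Vitali
family of balls `B` with radius comparable to the distance to `{V ≤ λ} ∩ supp μ`. -/
lemma mul_measure_lt_le_measure_sdiff (h : HasBigPieces n k ρ μ C A c C₀ C₁) {e γ : ℝ≥0}
    (he : 0 < e) (hγ1 : farConst n C * γ ≤ e) (hγ2 : A * C₁ * 31 ^ n * γ ≤ e * (c * (C₀ / 2)))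
    (τ : Measure (Space d)) [IsFiniteMeasure τ] {s : Space d → ℝ} (hs : Measurable s)
    (hs1 : ∀ x, |s x| ≤ 1) {l : ℝ≥0} (hl : 0 < l)
    (hfin : μ {x | l < rhoVariation ρ (potential k τ s) x} ≠ ⊤)
    (hne : (μ.support \ {x | l < rhoVariation ρ (potential k τ s) x}).Nonempty) :
    ENNReal.ofReal (C₀ / 2 * (c / (A * 4 ^ n))) *
        μ {x | l < rhoVariation ρ (potential k τ s) x} ≤
      μ ({x | l < rhoVariation ρ (potential k τ s) x} \
        {y | ((1 + 2 * e) * l : ℝ≥0) < rhoVariation ρ (potential k τ s) y ∧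
          maximalFun n μ τ y ≤ (γ * l : ℝ≥0)}) := by
  have hA0 := h.pos_upper
  have hc0 := h.pos_lower
  set Ω := {x | (l : ℝ≥0∞) < rhoVariation ρ (potential k τ s) x} with hΩ
  set G := {y | (((1 + 2 * e) * l : ℝ≥0) : ℝ≥0∞) < rhoVariation ρ (potential k τ s) y ∧
    maximalFun n μ τ y ≤ (γ * l : ℝ≥0)} with hG
  have hΩo : IsOpen Ω := h.family.isOpen_lt h.one_le_exponent hs hs1 _
  have hGm : MeasurableSet G :=
    (h.family.isOpen_lt h.one_le_exponent hs hs1 _).measurableSet.inter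
      (measurableSet_le measurable_maximalFun measurable_const)
  have hnull : μ μ.supportᶜ = 0 := Measure.measure_compl_support
  set Z := μ.support \ Ω with hZ
  have hZc : IsClosed Z := Measure.isClosed_support.sdiff hΩo
  set E := Ω ∩ μ.support with hE
  set r : Space d → ℝ := fun x => Metric.infDist x Z / 10 with hr
  have hr0 : ∀ x ∈ E, 0 < r x := by
    intro x hx
    have : 0 < Metric.infDist x Z :=
      (hZc.notMem_iff_infDist_pos hne).1 fun hxZ => hxZ.2 hx.1
    simp only [hr]; positivity
  have hnear : ∀ x, ∃ z ∈ Z, dist z x = 10 * r x := by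
    intro x
    obtain ⟨z, hz, hzx⟩ := hZc.exists_infDist_eq_dist hne x
    refine ⟨z, hz, ?_⟩
    rw [dist_comm, ← hzx]
    simp only [hr]; ring
  have hrd : ∀ x ∈ E, ENNReal.ofReal (r x) ≤ Metric.ediam μ.support := by
    intro x hx
    obtain ⟨z, hz, hzx⟩ := hnear x
    have h1 : edist z x ≤ Metric.ediam μ.support := Metric.edist_le_ediam_of_mem hz.1 hx.2
    refine le_trans ?_ h1
    rw [edist_dist, hzx]
    exact ENNReal.ofReal_le_ofReal (by linarith [hr0 x hx])
  have hBsub : ∀ x ∈ E, Metric.ball x (r x) ⊆ Ω ∪ μ.supportᶜ := by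
    intro x hx y hy
    by_cases hys : y ∈ μ.support
    · left
      by_contra hyΩ
      have h1 := Metric.infDist_le_dist_of_mem (x := x) (show y ∈ Z from ⟨hys, hyΩ⟩)
      rw [Metric.mem_ball, dist_comm] at hy
      have h2 := hr0 x hx
      simp only [hr] at hy h2
      linarith
    · exact Or.inr hys
  have hbdd : ∀ x ∈ E, r x ≤ max 1 ((μ Ω).toReal / c) := by
    intro x hx
    rcases le_total (r x) 1 with h1 | h1
    · exact h1.trans (le_max_left _ _)
    · refine le_trans ?_ (le_max_right _ _)
      rw [le_div_iff₀ hc0]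
      have h2 : ENNReal.ofReal (c * r x ^ n) ≤ μ Ω := by
        refine (h.le_ball x hx.2 _ (hr0 x hx) (hrd x hx)).trans ?_
        calc μ (Metric.ball x (r x)) ≤ μ Ω + μ μ.supportᶜ :=
              (measure_mono (hBsub x hx)).trans (measure_union_le _ _)
          _ = μ Ω := by rw [hnull, add_zero]
      have h3 := (ENNReal.ofReal_le_iff_le_toReal hfin).1 h2
      have h4 : r x ≤ r x ^ n := le_self_pow₀ h1 (by have := h.one_le; lia)
      nlinarith
  obtain ⟨u, huE, hdisj, hcov⟩ := Vitali.exists_disjoint_subfamily_covering_enlargement_ball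
    E id r _ hbdd 4 (by norm_num)
  have hcount : u.Countable := hdisj.countable_of_isOpen (fun _ _ => Metric.isOpen_ball)
    (fun x hx => ⟨x, Metric.mem_ball_self (hr0 x (huE hx))⟩)
  have : Countable u := hcount.to_subtype
  have hΩsub : Ω ⊆ (⋃ x ∈ u, Metric.ball x (4 * r x)) ∪ μ.supportᶜ := by
    intro x hx
    by_cases hxs : x ∈ μ.support
    · obtain ⟨y, hy, hxy⟩ := hcov x ⟨hx, hxs⟩
      exact Or.inl (mem_iUnion₂.2 ⟨y, hy, hxy (Metric.mem_ball_self (hr0 x ⟨hx, hxs⟩))⟩)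
    · exact Or.inr hxs
  calc ENNReal.ofReal (C₀ / 2 * (c / (A * 4 ^ n))) * μ Ω
      ≤ ENNReal.ofReal (C₀ / 2 * (c / (A * 4 ^ n))) *
          ∑' x : u, μ (Metric.ball (x : Space d) (4 * r x)) := by
        gcongr
        calc μ Ω ≤ μ (⋃ x ∈ u, Metric.ball x (4 * r x)) + μ μ.supportᶜ :=
              (measure_mono hΩsub).trans (measure_union_le _ _)
          _ ≤ _ := by
              rw [hnull, add_zero]
              exact measure_biUnion_le μ hcount _
    _ ≤ ∑' x : u, μ (Metric.ball (x : Space d) (r x) \ G) := by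
        rw [← ENNReal.tsum_mul_left]
        refine ENNReal.tsum_le_tsum fun x => ?_
        have hx := huE x.2
        have hrx := hr0 x hx
        obtain ⟨z, hz, hzx⟩ := hnear x
        calc ENNReal.ofReal (C₀ / 2 * (c / (A * 4 ^ n))) * μ (Metric.ball (x : Space d) (4 * r x))
            ≤ ENNReal.ofReal (C₀ / 2 * (c / (A * 4 ^ n))) *
                ENNReal.ofReal (A * (4 * r x) ^ n) := by
              gcongr
              exact h.ball_le _ _ (by positivity)
          _ = ((C₀ / 2 : ℝ≥0) : ℝ≥0∞) * ENNReal.ofReal (c * r x ^ n) := by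
              rw [← ENNReal.ofReal_coe_nnreal, ← ENNReal.ofReal_mul (by positivity),
                ← ENNReal.ofReal_mul (by positivity), mul_pow]
              congr 1
              push_cast
              field_simp
          _ ≤ ((C₀ / 2 : ℝ≥0) : ℝ≥0∞) * μ (Metric.ball (x : Space d) (r x)) := by
              gcongr
              exact h.le_ball x hx.2 _ hrx (hrd x hx)
          _ ≤ _ := h.half_mul_measure_ball_le he hγ1 hγ2 τ hs hs1 hl hx.2 hrx (hrd x hx) hzx.le
              (not_lt.1 hz.2)
    _ = μ (⋃ x ∈ u, Metric.ball x (r x) \ G) := by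
        rw [measure_biUnion (f := fun x => Metric.ball x (r x) \ G) hcount]
        · exact fun x hx y hy hxy => (hdisj hx hy hxy).mono sdiff_subset sdiff_subset
        · exact fun x _ => MeasurableSet.diff Metric.isOpen_ball.measurableSet hGm
    _ ≤ μ ((Ω \ G) ∪ μ.supportᶜ) := by
        refine measure_mono (iUnion₂_subset fun x hx y hy => ?_)
        rcases hBsub x (huE hx) hy.1 with h1 | h1
        · exact Or.inl ⟨h1, hy.2⟩
        · exact Or.inr h1
    _ ≤ μ (Ω \ G) := (measure_union_le _ _).trans (by rw [hnull, add_zero])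

/-- The good `λ` inequality. The proportion `q` does not depend on the increment `e`. -/
theorem exists_good_lambda (h : HasBigPieces n k ρ μ C A c C₀ C₁) :
    ∃ q : ℝ≥0, q < 1 ∧ ∀ e : ℝ≥0, 0 < e → ∃ γ : ℝ≥0, 0 < γ ∧
      ∀ (τ : Measure (Space d)) [IsFiniteMeasure τ] (s : Space d → ℝ), Measurable s →
        (∀ x, |s x| ≤ 1) → ∀ l : ℝ≥0, 0 < l →
          μ {x | ((1 + 2 * e) * l : ℝ≥0) < rhoVariation ρ (potential k τ s) x} ≤
            q * μ {x | l < rhoVariation ρ (potential k τ s) x} +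
              μ {x | (γ * l : ℝ≥0) < maximalFun n μ τ x} := by
  have hA0 := h.pos_upper
  have hc0 := h.pos_lower
  have hC₀ := h.pos_piece
  set κ : ℝ := C₀ / 2 * (c / (A * 4 ^ n)) with hκ
  have hκ0 : 0 < κ := by
    have : (0 : ℝ) < C₀ := by exact_mod_cast hC₀
    positivity
  set κ' : ℝ≥0 := min κ.toNNReal (1 / 2) with hκ'
  have hκ'0 : 0 < κ' := lt_min (by simpa using hκ0) (by norm_num)
  have hκ'1 : κ' < 1 := (min_le_right _ _).trans_lt (by norm_num [div_lt_one])
  refine ⟨1 - κ', tsub_lt_self one_pos hκ'0, fun e he => ?_⟩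
  have he' : (0 : ℝ) < e := by exact_mod_cast he
  have hC₀' : (0 : ℝ) < C₀ := by exact_mod_cast hC₀
  obtain ⟨γ, hγ0, hγ1, hγ2, hγ3⟩ : ∃ γ : ℝ≥0, 0 < γ ∧ farConst n C * γ ≤ e ∧
      A * C₁ * 31 ^ n * γ ≤ e * (c * (C₀ / 2)) ∧ A * C₁ * γ < C₀ := by
    have hev : ∀ D η : ℝ, 0 < η → ∀ᶠ g : ℝ in 𝓝[>] 0, D * g < η := by
      intro D η hη
      have : Tendsto (fun g : ℝ => D * g) (𝓝 0) (𝓝 (D * 0)) := by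
        exact (continuous_const.mul continuous_id).tendsto 0
      rw [mul_zero] at this
      exact (this.mono_left nhdsWithin_le_nhds).eventually_lt_const hη
    obtain ⟨g, ⟨⟨h1, h2⟩, h3⟩, h4⟩ := (((hev (farConst n C) e he').and
      (hev (A * C₁ * 31 ^ n) (e * (c * (C₀ / 2))) (by positivity))).and
      (hev (A * C₁) C₀ hC₀')).and eventually_mem_nhdsWithin |>.exists
    have hg : (0 : ℝ) < g := h4
    refine ⟨⟨g, hg.le⟩, by exact_mod_cast hg, ?_, h2.le, h3⟩
    exact_mod_cast h1.le
  refine ⟨γ, hγ0, fun τ _ s hs hs1 l hl => ?_⟩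
  set Ω := {x | (l : ℝ≥0∞) < rhoVariation ρ (potential k τ s) x} with hΩ
  set G := {y | (((1 + 2 * e) * l : ℝ≥0) : ℝ≥0∞) < rhoVariation ρ (potential k τ s) y ∧
    maximalFun n μ τ y ≤ (γ * l : ℝ≥0)} with hG
  rcases eq_or_ne μ 0 with hμ0 | hμ0
  · simp [hμ0]
  have hsub : {x | (((1 + 2 * e) * l : ℝ≥0) : ℝ≥0∞) < rhoVariation ρ (potential k τ s) x} ⊆
      G ∪ {x | ((γ * l : ℝ≥0) : ℝ≥0∞) < maximalFun n μ τ x} := by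
    intro x hx
    rcases lt_or_ge ((γ * l : ℝ≥0) : ℝ≥0∞) (maximalFun n μ τ x) with h1 | h1
    · exact Or.inr h1
    · exact Or.inl ⟨hx, h1⟩
  refine (measure_mono hsub).trans ((measure_union_le _ _).trans (add_le_add_left ?_ _))
  have hq0 : ((1 - κ' : ℝ≥0) : ℝ≥0∞) ≠ 0 := by
    rw [Ne, ENNReal.coe_eq_zero, tsub_eq_zero_iff_le, not_le]
    exact hκ'1
  by_cases hfin : μ Ω = ⊤
  · rw [hfin, ENNReal.mul_top hq0]
    exact le_top
  rcases eq_empty_or_nonempty (μ.support \ Ω) with hemp | hne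
  · have h1 := h.lt_mean_of_support_subset hγ3 τ hs hs1 hl hμ0 (sdiff_eq_empty.1 hemp)
    have : G = ∅ := by
      refine eq_empty_of_forall_notMem fun y hy => ?_
      exact not_lt.2 hy.2 (lt_maximalFun_iff.2 (Or.inr h1))
    simp [this]
  · have h1 := h.mul_measure_lt_le_measure_sdiff he hγ1 hγ2 τ hs hs1 hl hfin hne
    have hGΩ : G ⊆ Ω := by
      intro y hy
      refine lt_of_le_of_lt ?_ hy.1
      norm_cast
      exact le_mul_of_one_le_left l.2 (by simp)
    have hGm : MeasurableSet G :=
      (h.family.isOpen_lt h.one_le_exponent hs hs1 _).measurableSet.inter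
        (measurableSet_le measurable_maximalFun measurable_const)
    have h2 : (κ' : ℝ≥0∞) * μ Ω ≤ μ (Ω \ G) := by
      refine le_trans (mul_le_mul_left ?_ _) h1
      exact ENNReal.coe_le_coe.2 (min_le_left _ _)
    have h3 : μ G + μ (Ω \ G) = μ Ω := by
      rw [← measure_inter_add_sdiff Ω hGm, inter_eq_self_of_subset_right hGΩ]
    have hκfin : (κ' : ℝ≥0∞) * μ Ω ≠ ⊤ := ENNReal.mul_ne_top ENNReal.coe_ne_top hfin
    refine (ENNReal.add_le_add_iff_right hκfin).1 ?_
    calc μ G + κ' * μ Ω ≤ μ G + μ (Ω \ G) := by gcongr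
      _ = μ Ω := h3
      _ = ((1 - κ' : ℝ≥0) : ℝ≥0∞) * μ Ω + κ' * μ Ω := by
          rw [← add_mul, ← ENNReal.coe_add, tsub_add_cancel_of_le hκ'1.le, ENNReal.coe_one,
            one_mul]

end HasBigPieces

/-! ### The weak type `(1,1)` bound -/

/-- Absorption of a finite quantity into the left-hand side. -/
lemma le_inv_mul_of_le_mul_add {S W : ℝ≥0∞} {θ : ℝ≥0} (hS : S ≠ ⊤) (hθ : θ < 1)
    (h : S ≤ θ * S + W) : S ≤ ((1 - θ)⁻¹ : ℝ≥0) * W := by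
  have hθ' : (1 - θ : ℝ≥0) ≠ 0 := (tsub_pos_of_lt hθ).ne'
  have hfin : (θ : ℝ≥0∞) * S ≠ ⊤ := ENNReal.mul_ne_top ENNReal.coe_ne_top hS
  have h1 : ((1 - θ : ℝ≥0) : ℝ≥0∞) * S ≤ W := by
    refine (ENNReal.add_le_add_iff_left hfin).1 ?_
    refine le_trans (le_of_eq ?_) h
    rw [← add_mul, ← ENNReal.coe_add, add_tsub_cancel_of_le hθ.le, ENNReal.coe_one, one_mul]
  calc S = ((1 - θ)⁻¹ : ℝ≥0) * (((1 - θ : ℝ≥0) : ℝ≥0∞) * S) := by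
        rw [← mul_assoc, ← ENNReal.coe_mul, inv_mul_cancel₀ hθ', ENNReal.coe_one, one_mul]
    _ ≤ _ := by gcongr

/-- The variation of the potentials is dominated by the lower limit of the variations of the
potentials of the restrictions to large balls. -/
lemma paramVar_potential_le_liminf {d : ℕ} {k : ℝ → Space d → ℝ} {ρ : ℝ} (hρ : 1 ≤ ρ)
    {μ : Measure (Space d)} {f : Space d → ℝ} {x : Space d}
    (hint : ∀ ε, 0 < ε → Integrable (fun y => k ε (x - y) * f y) μ) :
    rhoVariation ρ (potential k μ f) x ≤ liminf (fun j : ℕ =>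
      rhoVariation ρ (potential k (μ.restrict (Metric.ball 0 ((j : ℝ) + 1))) f) x) atTop := by
  simp only [rhoVariation_eq_paramVar]
  refine paramVar_le_liminf hρ (g := fun ε => potential k μ f ε x) (G := fun (j : ℕ) ε =>
    potential k (μ.restrict (Metric.ball 0 ((j : ℝ) + 1))) f ε x) fun ε hε => ?_
  have hU : (⋃ j : ℕ, Metric.ball (0 : Space d) ((j : ℝ) + 1)) = univ :=
    Metric.iUnion_ball_nat_succ 0
  have := tendsto_setIntegral_of_monotone (μ := μ) (f := fun y => k ε (x - y) * f y)
    (s := fun j : ℕ => Metric.ball (0 : Space d) ((j : ℝ) + 1))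
    (fun _ => Metric.isOpen_ball.measurableSet)
    (fun i j hij => Metric.ball_subset_ball (by gcongr))
    (by rw [hU]; exact (hint ε hε).integrableOn)
  rw [hU, Measure.restrict_univ] at this
  exact this

namespace HasBigPieces

variable {d n : ℕ} {k : ℝ → Space d → ℝ} {ρ : ℝ} {μ : Measure (Space d)} {C A c : ℝ} {C₀ C₁ : ℝ≥0}

/-- For a compactly supported measure the level sets of the variation have finite measure, uniformly
for levels in a bounded interval after multiplication by the level: at infinity the variation decays
like `|x|^{-n}`. -/
lemma exists_mul_measure_lt_le (h : HasBigPieces n k ρ μ C A c C₀ C₁) (τ : Measure (Space d))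
    [IsFiniteMeasure τ] {s : Space d → ℝ} (hs : Measurable s) (hs1 : ∀ x, |s x| ≤ 1) {R : ℝ}
    (hR : 0 < R) (hτ : ∀ᵐ w ∂τ, w ∈ Metric.ball (0 : Space d) R) (L : ℝ≥0) :
    ∃ D : ℝ≥0∞, D ≠ ⊤ ∧ ∀ l : ℝ≥0, 0 < l → l ≤ L →
      l * μ {x | l < rhoVariation ρ (potential k τ s) x} ≤ D := by
  have hA0 := h.pos_upper
  have hC := h.family.nonneg
  have hn := h.one_le
  set m := (τ univ).toReal with hm
  have hm0 : 0 ≤ m := ENNReal.toReal_nonneg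
  set D := C * 2 ^ n * m with hD
  have hD0 : 0 ≤ D := by positivity
  have hdecay : ∀ x : Space d, 2 * R ≤ ‖x‖ →
      rhoVariation ρ (potential k τ s) x ≤ ENNReal.ofReal (D / ‖x‖ ^ n) := by
    intro x hx
    have hx0 : 0 < ‖x‖ := by linarith
    refine (h.family.rhoVariation_le h.one_le_exponent hs hs1 x).trans ?_
    calc ∫⁻ w, ENNReal.ofReal (C / ‖x - w‖ ^ n) ∂τ
        ≤ ∫⁻ _, ENNReal.ofReal (C / (‖x‖ / 2) ^ n) ∂τ := by
          refine lintegral_mono_ae ?_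
          filter_upwards [hτ] with w hw
          refine ENNReal.ofReal_le_ofReal ?_
          have h1 : ‖w‖ < R := by simpa using hw
          have h2 := norm_sub_norm_le x w
          have : ‖x‖ / 2 ≤ ‖x - w‖ := by linarith
          gcongr
      _ = ENNReal.ofReal (D / ‖x‖ ^ n) := by
          rw [lintegral_const, ← ENNReal.ofReal_toReal (measure_ne_top τ univ), ← hm,
            ← ENNReal.ofReal_mul (by positivity)]
          congr 1
          rw [hD, div_pow]
          field_simp
  refine ⟨L * ENNReal.ofReal (A * (2 * R) ^ n) + ENNReal.ofReal (A * (D + 1)),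
    by finiteness, fun l hl hlL => ?_⟩
  have hl' : (0 : ℝ) < l := by exact_mod_cast hl
  set t : ℝ := ((D + 1) / l) ^ (1 / (n : ℝ)) with ht
  have ht0 : 0 < t := by positivity
  have htn : t ^ n = (D + 1) / l := by
    rw [ht, ← Real.rpow_natCast, ← Real.rpow_mul (by positivity), one_div,
      inv_mul_cancel₀ (by exact_mod_cast (by lia : n ≠ 0)), Real.rpow_one]
  have hsub : {x | (l : ℝ≥0∞) < rhoVariation ρ (potential k τ s) x} ⊆
      Metric.ball 0 (2 * R) ∪ Metric.ball 0 t := by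
    intro x hx
    by_contra hcon
    simp only [mem_union, Metric.mem_ball, dist_zero_right, not_or, not_lt] at hcon
    have h1 := hdecay x hcon.1
    have h2 : (D + 1) / l ≤ ‖x‖ ^ n := by
      rw [← htn]; exact pow_le_pow_left₀ ht0.le hcon.2 n
    have hx0 : 0 < ‖x‖ := ht0.trans_le hcon.2
    have h3 : ENNReal.ofReal (D / ‖x‖ ^ n) ≤ l := by
      rw [← ENNReal.ofReal_coe_nnreal]
      refine ENNReal.ofReal_le_ofReal ?_
      rw [div_le_iff₀ (by positivity)]
      rw [div_le_iff₀ hl'] at h2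
      linarith
    exact not_lt.2 (h1.trans h3) hx
  calc l * μ {x | (l : ℝ≥0∞) < rhoVariation ρ (potential k τ s) x}
      ≤ l * (ENNReal.ofReal (A * (2 * R) ^ n) + ENNReal.ofReal (A * t ^ n)) := by
        gcongr
        exact (measure_mono hsub).trans ((measure_union_le _ _).trans
          (add_le_add (h.ball_le _ _ (by positivity)) (h.ball_le _ _ ht0)))
    _ = l * ENNReal.ofReal (A * (2 * R) ^ n) + ENNReal.ofReal (A * (D + 1)) := by
        rw [mul_add, htn]
        congr 1
        rw [← ENNReal.ofReal_coe_nnreal, ← ENNReal.ofReal_mul hl'.le]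
        congr 1
        field_simp
    _ ≤ _ := by gcongr

/-- The weak type `(1,1)` bound with respect to the whole of `μ`. -/
theorem exists_polarWeakBound (h : HasBigPieces n k ρ μ C A c C₀ C₁) :
    ∃ D : ℝ≥0, PolarWeakBound k ρ μ D := by
  have hA0 := h.pos_upper
  obtain ⟨q, hq1, hgood⟩ := h.exists_good_lambda
  set e : ℝ≥0 := (1 - q) / 4 with he
  have he0 : 0 < e := div_pos (tsub_pos_of_lt hq1) (by norm_num)
  set b : ℝ≥0 := 1 + 2 * e with hb
  have hb0 : 0 < b := by positivity
  have hbq : b * q < 1 := by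
    have h1 : (q : ℝ) < 1 := by exact_mod_cast hq1
    have h2 : (0 : ℝ) ≤ q := q.2
    rw [← NNReal.coe_lt_coe, hb, he]
    push_cast [NNReal.coe_sub hq1.le]
    nlinarith
  obtain ⟨γ, hγ0, hγ⟩ := hgood e he0
  set W : ℝ≥0 := b / γ * (A * 4 ^ n + 1).toNNReal with hW
  refine ⟨(1 - b * q)⁻¹ * W, ?_⟩
  have hmax : ∀ (τ : Measure (Space d)) [IsFiniteMeasure τ] (l : ℝ≥0), 0 < l →
      b * l * μ {x | (γ * l : ℝ≥0) < maximalFun n μ τ x} ≤ W * τ univ := by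
    intro τ _ l hl
    have h1 := mul_measure_lt_maximalFun_le h.one_le hA0 h.ball_le (τ := τ) (mul_pos hγ0 hl)
    calc (b : ℝ≥0∞) * l * μ {x | ((γ * l : ℝ≥0) : ℝ≥0∞) < maximalFun n μ τ x}
        = ((b / γ : ℝ≥0) : ℝ≥0∞) * (((γ * l : ℝ≥0) : ℝ≥0∞) *
            μ {x | ((γ * l : ℝ≥0) : ℝ≥0∞) < maximalFun n μ τ x}) := by
          rw [← mul_assoc, ← ENNReal.coe_mul, ← ENNReal.coe_mul]
          congr 2
          field_simp
      _ ≤ ((b / γ : ℝ≥0) : ℝ≥0∞) * (ENNReal.ofReal (A * 4 ^ n + 1) * τ univ) := by gcongr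
      _ = _ := by
          rw [hW, ← mul_assoc, ENNReal.coe_mul]
          rfl
  -- For compactly supported measures the inequality is absorbed.
  have hcpt : ∀ (τ : Measure (Space d)) [IsFiniteMeasure τ] (s : Space d → ℝ), Measurable s →
      (∀ x, |s x| ≤ 1) → ∀ R, 0 < R → (∀ᵐ w ∂τ, w ∈ Metric.ball (0 : Space d) R) →
      ∀ t : ℝ≥0, 0 < t → t * μ {x | t < rhoVariation ρ (potential k τ s) x} ≤
        ((1 - b * q)⁻¹ * W : ℝ≥0) * τ univ := by
    intro τ _ s hs hs1 R hR hτ t ht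
    obtain ⟨D, hDtop, hD⟩ := h.exists_mul_measure_lt_le τ hs hs1 hR hτ t
    set S : ℝ≥0∞ := ⨆ (l : ℝ≥0) (_ : 0 < l) (_ : l ≤ t),
      l * μ {x | l < rhoVariation ρ (potential k τ s) x} with hS
    have hle : ∀ l : ℝ≥0, 0 < l → l ≤ t →
        l * μ {x | l < rhoVariation ρ (potential k τ s) x} ≤ S := fun l h1 h2 =>
      le_iSup_of_le l (le_iSup_of_le h1 (le_iSup_of_le h2 le_rfl))
    have hSfin : S ≠ ⊤ :=
      ((iSup_le fun l => iSup_le fun h1 => iSup_le fun h2 => hD l h1 h2).trans_lt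
        hDtop.lt_top).ne
    have hrec : S ≤ (b * q : ℝ≥0) * S + W * τ univ := by
      refine iSup_le fun l => iSup_le fun h1 => iSup_le fun h2 => ?_
      set l' := l / b with hl'
      have hl'0 : 0 < l' := div_pos h1 hb0
      have hbl : b * l' = l := mul_div_cancel₀ l hb0.ne'
      have hl't : l' ≤ t := by
        refine le_trans ?_ h2
        rw [← hbl]
        exact le_mul_of_one_le_left l'.2 (by simp [hb])
      have h3 := hγ τ s hs hs1 l' hl'0
      rw [← hb, hbl] at h3
      calc (l : ℝ≥0∞) * μ {x | (l : ℝ≥0∞) < rhoVariation ρ (potential k τ s) x}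
          ≤ l * (q * μ {x | l' < rhoVariation ρ (potential k τ s) x} +
              μ {x | (γ * l' : ℝ≥0) < maximalFun n μ τ x}) := by gcongr
        _ = (b * q : ℝ≥0) * (l' * μ {x | l' < rhoVariation ρ (potential k τ s) x}) +
              b * l' * μ {x | (γ * l' : ℝ≥0) < maximalFun n μ τ x} := by
            rw [← hbl]
            push_cast
            ring
        _ ≤ _ := add_le_add (mul_le_mul_right (hle l' hl'0 hl't) _) (hmax τ l' hl'0)
    have := le_inv_mul_of_le_mul_add hSfin hbq hrec
    rw [← mul_assoc, ← ENNReal.coe_mul] at this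
    exact (hle t ht le_rfl).trans this
  intro τ _ s hs hs1 t ht
  set U : ℕ → Set (Space d) := fun j =>
    {x | t < rhoVariation ρ (potential k (τ.restrict (Metric.ball 0 ((j : ℝ) + 1))) s) x} with hU
  have hsub : {x | (t : ℝ≥0∞) < rhoVariation ρ (potential k τ s) x} ⊆
      ⋃ N : ℕ, ⋂ j ≥ N, U j := by
    intro x hx
    have h1 := hx.trans_le (paramVar_potential_le_liminf h.one_le_exponent (μ := τ) (f := s)
      fun ε hε => h.family.integrable hs hs1 hε x)
    obtain ⟨N, hN⟩ := eventually_atTop.1 (eventually_lt_of_lt_liminf h1)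
    exact mem_iUnion.2 ⟨N, mem_iInter₂.2 fun j hj => hN j hj⟩
  have hmono : Monotone fun N : ℕ => ⋂ j ≥ N, U j := fun N N' hNN' =>
    biInter_subset_biInter_left fun j hj => le_trans hNN' hj
  calc t * μ {x | (t : ℝ≥0∞) < rhoVariation ρ (potential k τ s) x}
      ≤ t * μ (⋃ N : ℕ, ⋂ j ≥ N, U j) := by gcongr
    _ = ⨆ N : ℕ, t * μ (⋂ j ≥ N, U j) := by rw [hmono.measure_iUnion, ENNReal.mul_iSup]
    _ ≤ _ := by
        refine iSup_le fun N => ?_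
        calc t * μ (⋂ j ≥ N, U j) ≤ t * μ (U N) := by
              gcongr
              exact biInter_subset_of_mem (le_refl N)
          _ ≤ ((1 - b * q)⁻¹ * W : ℝ≥0) * (τ.restrict (Metric.ball 0 ((N : ℝ) + 1))) univ :=
              hcpt _ s hs hs1 ((N : ℝ) + 1) (by positivity)
                (ae_restrict_mem Metric.isOpen_ball.measurableSet) t ht
          _ ≤ _ := by
              gcongr
              exact Measure.restrict_le_self

end HasBigPieces

/-! ### Sums over geometric scales -/

/-- A bi-infinite sequence obeying a contractive recurrence and vanishing at `-∞` is summable. -/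
lemma tsum_le_of_recurrence {a B : ℤ → ℝ≥0∞} {θ : ℝ≥0} (hθ : θ < 1) (hfin : ∀ i, a i ≠ ⊤)
    (hrec : ∀ i, a (i + 1) ≤ θ * a i + B i)
    (hlim : Tendsto (fun N : ℕ => a (-(N : ℤ))) atTop (𝓝 0)) :
    ∑' i, a i ≤ ((1 - θ)⁻¹ : ℝ≥0) * ∑' i, B i := by
  have hpart : ∀ N J : ℕ, ∑ j ∈ Finset.range (J + 1), a (j - N) ≤
      ((1 - θ)⁻¹ : ℝ≥0) * (∑' i, B i + a (-(N : ℤ))) := by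
    intro N J
    refine le_inv_mul_of_le_mul_add (ENNReal.sum_ne_top.2 fun j _ => hfin _) hθ ?_
    calc ∑ j ∈ Finset.range (J + 1), a (j - N)
        = ∑ j ∈ Finset.range J, a ((j - N : ℤ) + 1) + a (-(N : ℤ)) := by
          rw [Finset.sum_range_succ']
          congr 1
          · refine Finset.sum_congr rfl fun j _ => ?_
            congr 1
            push_cast
            ring
          · congr 1; simp
      _ ≤ ∑ j ∈ Finset.range J, (θ * a (j - N) + B (j - N)) + a (-(N : ℤ)) := by
          gcongr
          exact hrec _
      _ = θ * ∑ j ∈ Finset.range J, a (j - N) + ∑ j ∈ Finset.range J, B (j - N) +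
            a (-(N : ℤ)) := by
          rw [Finset.sum_add_distrib, Finset.mul_sum]
      _ ≤ θ * ∑ j ∈ Finset.range (J + 1), a (j - N) + ∑' i, B i + a (-(N : ℤ)) := by
          gcongr
          · lia
          · refine (ENNReal.sum_le_tsum (f := fun j : ℕ => B (j - N)) _).trans ?_
            exact ENNReal.tsum_comp_le_tsum_of_injective
              (f := fun j : ℕ => (j - N : ℤ)) (fun i j hij => by simpa using hij) B
      _ = _ := by rw [add_assoc]
  have hlim' : Tendsto (fun N : ℕ => ((1 - θ)⁻¹ : ℝ≥0) * (∑' i, B i + a (-(N : ℤ)))) atTop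
      (𝓝 (((1 - θ)⁻¹ : ℝ≥0) * (∑' i, B i + 0))) :=
    ENNReal.Tendsto.const_mul (tendsto_const_nhds.add hlim) (Or.inr ENNReal.coe_ne_top)
  rw [add_zero] at hlim'
  rw [ENNReal.tsum_eq_iSup_sum]
  refine iSup_le fun F => ge_of_tendsto hlim' ?_
  obtain ⟨M, hM⟩ : ∃ M : ℕ, ∀ i ∈ F, -(M : ℤ) ≤ i ∧ i ≤ M := by
    refine ⟨F.sup Int.natAbs, fun i hi => ?_⟩
    have := Finset.le_sup (f := Int.natAbs) hi
    lia
  filter_upwards [eventually_ge_atTop M] with N hN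
  refine le_trans ?_ (hpart N (2 * N))
  rw [← Finset.sum_image (s := Finset.range (2 * N + 1)) (g := fun j : ℕ => (j - N : ℤ)) (f := a)
    (fun i _ j _ hij => by simpa using hij)]
  refine Finset.sum_le_sum_of_subset fun i hi => ?_
  obtain ⟨h1, h2⟩ := hM i hi
  refine Finset.mem_image.2 ⟨(i + N).toNat, ?_, ?_⟩
  · rw [Finset.mem_range]; lia
  · lia

section Scales

variable {b : ℝ≥0}

lemma tsum_rpow_scale_lt_le (hb : 1 < b) {q : ℝ} (hq : 0 < q) (y : ℝ≥0∞) :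
    ∑' i : ℤ, {z : ℝ≥0∞ | ((b ^ i : ℝ≥0) : ℝ≥0∞) < z}.indicator
        (fun _ => ((b ^ i : ℝ≥0) : ℝ≥0∞) ^ q) y ≤
      ((1 - b ^ (-q))⁻¹ : ℝ≥0) * y ^ q := by
  have hb0 : b ≠ 0 := (zero_lt_one.trans hb).ne'
  have hr1 : b ^ (-q) < 1 := by
    rw [NNReal.rpow_neg]
    exact inv_lt_one_of_one_lt₀ (NNReal.one_lt_rpow hb hq)
  have hr0 : (1 - b ^ (-q))⁻¹ ≠ 0 := inv_ne_zero (tsub_pos_of_lt hr1).ne'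
  induction y using ENNReal.recTopCoe with
  | top =>
    rw [ENNReal.top_rpow_of_pos hq, ENNReal.mul_top (by exact_mod_cast hr0)]
    exact le_top
  | coe y =>
    rcases eq_or_ne y 0 with rfl | hy
    · simp
    obtain ⟨i₀, hi₀, hi₁⟩ := NNReal.exists_mem_Ioc_zpow hy hb
    set f : ℤ → ℝ≥0∞ := fun i => {z : ℝ≥0∞ | ((b ^ i : ℝ≥0) : ℝ≥0∞) < z}.indicator
        (fun _ => ((b ^ i : ℝ≥0) : ℝ≥0∞) ^ q) (y : ℝ≥0∞) with hf
    have hinj : Function.Injective fun j : ℕ => i₀ - (j : ℤ) := fun i j hij => by simpa using hij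
    have hsupp : Function.support f ⊆ range fun j : ℕ => i₀ - (j : ℤ) := by
      intro i hi
      have h1 : ((b ^ i : ℝ≥0) : ℝ≥0∞) < y := by
        by_contra hc
        exact hi (indicator_of_notMem
          (show (y : ℝ≥0∞) ∉ {z : ℝ≥0∞ | ((b ^ i : ℝ≥0) : ℝ≥0∞) < z} from hc) _)
      have h2 : b ^ i < b ^ (i₀ + 1) := (ENNReal.coe_lt_coe.1 h1).trans_le hi₁
      have h3 : i < i₀ + 1 := (zpow_lt_zpow_iff_right₀ hb).1 h2
      exact ⟨(i₀ - i).toNat, by simp only; lia⟩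
    rw [← hinj.tsum_eq hsupp]
    have hterm : ∀ j : ℕ, f (i₀ - (j : ℤ)) ≤
        (y : ℝ≥0∞) ^ q * ((b ^ (-q) : ℝ≥0) : ℝ≥0∞) ^ j := by
      intro j
      refine (indicator_le_self _ _ _).trans ?_
      rw [← ENNReal.coe_rpow_of_nonneg _ hq.le, ← ENNReal.coe_rpow_of_nonneg _ hq.le,
        ← ENNReal.coe_pow, ← ENNReal.coe_mul, ENNReal.coe_le_coe, zpow_sub₀ hb0, zpow_natCast,
        div_eq_mul_inv, NNReal.mul_rpow]
      have h1 : ((b ^ j)⁻¹) ^ q = (b ^ (-q)) ^ j := by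
        rw [NNReal.inv_rpow, ← NNReal.rpow_natCast, ← NNReal.rpow_natCast, ← NNReal.rpow_mul,
          ← NNReal.rpow_mul, ← NNReal.rpow_neg]
        congr 1
        ring
      rw [h1]
      gcongr
    calc ∑' j : ℕ, f (i₀ - (j : ℤ))
        ≤ ∑' j : ℕ, (y : ℝ≥0∞) ^ q * ((b ^ (-q) : ℝ≥0) : ℝ≥0∞) ^ j :=
          ENNReal.tsum_le_tsum hterm
      _ = _ := by
          rw [ENNReal.tsum_mul_left, ENNReal.tsum_geometric, mul_comm,
            ENNReal.coe_inv (tsub_pos_of_lt hr1).ne', ENNReal.coe_sub, ENNReal.coe_one]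

lemma rpow_le_tsum_scale_lt (hb : 1 < b) {p : ℝ} (hp : 0 < p) (y : ℝ≥0∞) :
    y ^ p ≤ (b : ℝ≥0∞) ^ p * ∑' i : ℤ, {z : ℝ≥0∞ | ((b ^ i : ℝ≥0) : ℝ≥0∞) < z}.indicator
        (fun _ => ((b ^ i : ℝ≥0) : ℝ≥0∞) ^ p) y := by
  have hb0 : b ≠ 0 := (zero_lt_one.trans hb).ne'
  induction y using ENNReal.recTopCoe with
  | top =>
    have hinj : Function.Injective fun j : ℕ => (j : ℤ) := fun i j hij => by simpa using hij
    have h1 : (⊤ : ℝ≥0∞) ≤ ∑' i : ℤ, {z : ℝ≥0∞ | ((b ^ i : ℝ≥0) : ℝ≥0∞) < z}.indicator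
        (fun _ => ((b ^ i : ℝ≥0) : ℝ≥0∞) ^ p) ⊤ := by
      calc (⊤ : ℝ≥0∞) = ∑' _ : ℕ, (1 : ℝ≥0∞) :=
            (ENNReal.tsum_const_eq_top_of_ne_zero one_ne_zero).symm
        _ ≤ ∑' j : ℕ, {z : ℝ≥0∞ | ((b ^ (j : ℤ) : ℝ≥0) : ℝ≥0∞) < z}.indicator
              (fun _ => ((b ^ (j : ℤ) : ℝ≥0) : ℝ≥0∞) ^ p) ⊤ := by
            refine ENNReal.tsum_le_tsum fun j => ?_
            rw [indicator_of_mem (by simp)]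
            refine ENNReal.one_le_rpow ?_ hp
            rw [zpow_natCast]
            exact_mod_cast one_le_pow₀ hb.le
        _ ≤ _ := ENNReal.tsum_comp_le_tsum_of_injective hinj fun i : ℤ =>
            {z : ℝ≥0∞ | ((b ^ i : ℝ≥0) : ℝ≥0∞) < z}.indicator
              (fun _ => ((b ^ i : ℝ≥0) : ℝ≥0∞) ^ p) ⊤
    rw [top_le_iff.1 h1, ENNReal.mul_top]
    · exact le_top
    · simp [hb0]
  | coe y =>
    rcases eq_or_ne y 0 with rfl | hy
    · simp [hp]
    obtain ⟨i₀, hi₀, hi₁⟩ := NNReal.exists_mem_Ioc_zpow hy hb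
    refine le_trans ?_ (mul_le_mul_right (ENNReal.le_tsum i₀) _)
    rw [indicator_of_mem (show (y : ℝ≥0∞) ∈ {z : ℝ≥0∞ | ((b ^ i₀ : ℝ≥0) : ℝ≥0∞) < z} from
      ENNReal.coe_lt_coe.2 hi₀), ← ENNReal.mul_rpow_of_nonneg _ _ hp.le]
    refine ENNReal.rpow_le_rpow ?_ hp.le
    rw [zpow_add_one₀ hb0, mul_comm] at hi₁
    exact_mod_cast hi₁

end Scales

/-! ### The maximal function on `L^p` -/

section MaximalLp

variable {d n : ℕ} {μ : Measure (Space d)}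

lemma maximalFun_add_le (τ τ' : Measure (Space d)) (x : Space d) :
    maximalFun n μ (τ + τ') x ≤ maximalFun n μ τ x + maximalFun n μ τ' x := by
  refine max_le (iSup₂_le fun r hr => ?_) ?_
  · rw [Measure.add_apply, ENNReal.add_div]
    exact add_le_add (le_max_of_le_left (le_iSup₂_of_le r hr le_rfl))
      (le_max_of_le_left (le_iSup₂_of_le r hr le_rfl))
  · rw [Measure.add_apply, ENNReal.add_div]
    exact add_le_add (le_max_right _ _) (le_max_right _ _)

/-- The `L^∞` bound for the maximal function. -/
lemma maximalFun_withDensity_le {A : ℝ} (hA0 : 0 < A)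
    (hA : ∀ x r, 0 < r → μ (Metric.ball x r) ≤ ENNReal.ofReal (A * r ^ n)) {g : Space d → ℝ≥0∞}
    {L : ℝ≥0∞} (hg : ∀ y, g y ≤ L) (x : Space d) :
    maximalFun n μ (μ.withDensity g) x ≤ L * ENNReal.ofReal (A + 1) := by
  have hle : ∀ s, MeasurableSet s → μ.withDensity g s ≤ L * μ s := fun s hs => by
    rw [withDensity_apply _ hs]
    refine (lintegral_mono hg).trans (le_of_eq ?_)
    rw [lintegral_const, Measure.restrict_apply_univ]
  have h1 : (1 : ℝ≥0∞) ≤ ENNReal.ofReal (A + 1) := by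
    rw [ENNReal.one_le_ofReal]; linarith
  refine max_le (iSup₂_le fun r hr => ?_) ?_
  · refine ENNReal.div_le_of_le_mul ((hle _ Metric.isOpen_ball.measurableSet).trans ?_)
    rw [mul_assoc, ← ENNReal.ofReal_mul (by positivity)]
    gcongr
    refine (hA x r hr).trans (ENNReal.ofReal_le_ofReal ?_)
    gcongr
    linarith
  · refine ENNReal.div_le_of_le_mul ((hle _ MeasurableSet.univ).trans ?_)
    gcongr
    exact le_mul_of_one_le_right' h1

/-- The weak type `(1,1)` bound for the maximal function, localized to the large values of the
density. -/
lemma mul_measure_lt_maximalFun_withDensity_le (hn : 1 ≤ n) {A : ℝ} (hA0 : 0 < A)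
    (hA : ∀ x r, 0 < r → μ (Metric.ball x r) ≤ ENNReal.ofReal (A * r ^ n)) {g : Space d → ℝ≥0∞}
    (hg : Measurable g) (hgfin : ∫⁻ x, g x ∂μ ≠ ⊤) {t : ℝ≥0} (ht : 0 < t) :
    t * μ {x | t < maximalFun n μ (μ.withDensity g) x} ≤
      2 * ENNReal.ofReal (A * 4 ^ n + 1) *
        ∫⁻ x in {x | t < 2 * ENNReal.ofReal (A + 1) * g x}, g x ∂μ := by
  set H := {x | (t : ℝ≥0∞) < 2 * ENNReal.ofReal (A + 1) * g x} with hH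
  have hHm : MeasurableSet H := measurableSet_lt measurable_const (hg.const_mul _)
  set g₁ := H.indicator g with hg₁
  set g₂ := Hᶜ.indicator g with hg₂
  have hA1 : ENNReal.ofReal (A + 1) ≠ 0 := by
    rw [Ne, ENNReal.ofReal_eq_zero, not_le]; linarith
  have hsum : μ.withDensity g = μ.withDensity g₁ + μ.withDensity g₂ := by
    rw [← withDensity_add_left (hg.indicator hHm)]
    congr 1
    exact (indicator_self_add_compl H g).symm
  have hg₂le : ∀ y, g₂ y ≤ ((t / 2 : ℝ≥0) : ℝ≥0∞) / ENNReal.ofReal (A + 1) := by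
    intro y
    by_cases hy : y ∈ H
    · simp [hg₂, hy]
    · rw [hg₂, indicator_of_mem (show y ∈ Hᶜ from hy), ENNReal.le_div_iff_mul_le (Or.inl hA1)
        (Or.inl ENNReal.ofReal_ne_top)]
      have h1 : 2 * ENNReal.ofReal (A + 1) * g y ≤ t := not_lt.1 hy
      rw [ENNReal.coe_div two_ne_zero, ENNReal.le_div_iff_mul_le (Or.inl (by simp))
        (Or.inl (by simp))]
      calc g y * ENNReal.ofReal (A + 1) * ((2 : ℝ≥0) : ℝ≥0∞)
          = 2 * ENNReal.ofReal (A + 1) * g y := by push_cast; ring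
        _ ≤ t := h1
  have hsmall : ∀ x, maximalFun n μ (μ.withDensity g₂) x ≤ ((t / 2 : ℝ≥0) : ℝ≥0∞) := fun x =>
    (maximalFun_withDensity_le hA0 hA hg₂le x).trans
      (le_of_eq (ENNReal.div_mul_cancel hA1 ENNReal.ofReal_ne_top))
  have hg₁int : ∫⁻ x, g₁ x ∂μ = ∫⁻ x in H, g x ∂μ := lintegral_indicator hHm g
  have : IsFiniteMeasure (μ.withDensity g₁) := isFiniteMeasure_withDensity (by
    rw [hg₁int]
    exact ((setLIntegral_le_lintegral _ _).trans_lt hgfin.lt_top).ne)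
  have hsub : {x | (t : ℝ≥0∞) < maximalFun n μ (μ.withDensity g) x} ⊆
      {x | ((t / 2 : ℝ≥0) : ℝ≥0∞) < maximalFun n μ (μ.withDensity g₁) x} := by
    intro x hx
    by_contra hc
    rw [mem_ofPred_eq, not_lt] at hc
    refine absurd (show (t : ℝ≥0∞) < maximalFun n μ (μ.withDensity g) x from hx) (not_lt.2 ?_)
    rw [hsum]
    refine (maximalFun_add_le _ _ x).trans ((add_le_add hc (hsmall x)).trans (le_of_eq ?_))
    rw [← ENNReal.coe_add, add_halves]
  have hweak := mul_measure_lt_maximalFun_le (τ := μ.withDensity g₁) hn hA0 hA (half_pos ht)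
  rw [withDensity_apply _ MeasurableSet.univ, Measure.restrict_univ, hg₁int] at hweak
  calc t * μ {x | (t : ℝ≥0∞) < maximalFun n μ (μ.withDensity g) x}
      ≤ t * μ {x | ((t / 2 : ℝ≥0) : ℝ≥0∞) < maximalFun n μ (μ.withDensity g₁) x} := by gcongr
    _ = 2 * (((t / 2 : ℝ≥0) : ℝ≥0∞) *
          μ {x | ((t / 2 : ℝ≥0) : ℝ≥0∞) < maximalFun n μ (μ.withDensity g₁) x}) := by
        rw [← mul_assoc]
        congr 1
        norm_cast
        rw [mul_div_cancel₀ t two_ne_zero]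
    _ ≤ 2 * (ENNReal.ofReal (A * 4 ^ n + 1) * ∫⁻ x in H, g x ∂μ) := by gcongr
    _ = _ := by rw [mul_assoc]

/-- The `L^p` bound for the maximal function, as a sum over geometric scales. -/
lemma tsum_rpow_mul_measure_lt_maximalFun_le (hn : 1 ≤ n) {A : ℝ} (hA0 : 0 < A)
    (hA : ∀ x r, 0 < r → μ (Metric.ball x r) ≤ ENNReal.ofReal (A * r ^ n)) {b γ : ℝ≥0}
    (hb : 1 < b) (hγ : 0 < γ) {p : ℝ} (hp : 1 < p) :
    ∃ D : ℝ≥0, ∀ g : Space d → ℝ≥0∞, Measurable g → ∫⁻ x, g x ∂μ ≠ ⊤ →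
      ∑' i : ℤ, ((b ^ i : ℝ≥0) : ℝ≥0∞) ^ p *
          μ {x | (γ * b ^ i : ℝ≥0) < maximalFun n μ (μ.withDensity g) x} ≤
        D * ∫⁻ x, g x ^ p ∂μ := by
  have hb0 : b ≠ 0 := (zero_lt_one.trans hb).ne'
  have hγ' : (γ : ℝ≥0∞) ≠ 0 := by simpa using hγ.ne'
  set D₁ : ℝ≥0 := 2 * (A * 4 ^ n + 1).toNNReal with hD₁
  set D₂ : ℝ≥0 := 2 * (A + 1).toNNReal / γ with hD₂
  refine ⟨γ⁻¹ * D₁ * ((1 - b ^ (-(p - 1)))⁻¹ * D₂ ^ (p - 1)), fun g hg hgfin => ?_⟩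
  set w : ℤ → ℝ≥0∞ := fun i => ((b ^ i : ℝ≥0) : ℝ≥0∞) with hw
  have hp1 : 0 < p - 1 := by linarith
  have hterm : ∀ i : ℤ, w i ^ p *
      μ {x | (γ * b ^ i : ℝ≥0) < maximalFun n μ (μ.withDensity g) x} ≤
        (γ⁻¹ * D₁ : ℝ≥0) * ∫⁻ x, {z : ℝ≥0∞ | w i < z}.indicator (fun _ => w i ^ (p - 1))
          (D₂ * g x) * g x ∂μ := by
    intro i
    have hbi : 0 < b ^ i := zpow_pos (zero_lt_one.trans hb) i
    have h1 := mul_measure_lt_maximalFun_withDensity_le hn hA0 hA hg hgfin (mul_pos hγ hbi)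
    have hset : {x | ((γ * b ^ i : ℝ≥0) : ℝ≥0∞) < 2 * ENNReal.ofReal (A + 1) * g x} =
        {x | w i < D₂ * g x} := by
      ext x
      have : 2 * ENNReal.ofReal (A + 1) * g x = γ * (D₂ * g x) := by
        rw [← mul_assoc, hD₂, ← ENNReal.coe_mul, mul_div_cancel₀ _ hγ.ne', ENNReal.coe_mul]
        rfl
      rw [mem_ofPred_eq, mem_ofPred_eq, this, ENNReal.coe_mul,
        ENNReal.mul_lt_mul_iff_right hγ' ENNReal.coe_ne_top]
    rw [hset] at h1
    have hS : MeasurableSet {x | w i < D₂ * g x} :=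
      measurableSet_lt measurable_const (hg.const_mul _)
    have hrw : ∫⁻ x, {z : ℝ≥0∞ | w i < z}.indicator (fun _ => w i ^ (p - 1)) (D₂ * g x) * g x ∂μ =
        w i ^ (p - 1) * ∫⁻ x in {x | w i < D₂ * g x}, g x ∂μ := by
      rw [← lintegral_indicator hS, ← lintegral_const_mul _ (hg.indicator hS)]
      refine lintegral_congr fun x => ?_
      by_cases hx : w i < D₂ * g x
      · rw [indicator_of_mem (show (D₂ : ℝ≥0∞) * g x ∈ {z : ℝ≥0∞ | w i < z} from hx),
          indicator_of_mem (show x ∈ {x | w i < D₂ * g x} from hx)]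
      · rw [indicator_of_notMem (show ¬ (D₂ : ℝ≥0∞) * g x ∈ {z : ℝ≥0∞ | w i < z} from hx),
          indicator_of_notMem (show x ∉ {x | w i < D₂ * g x} from hx), zero_mul, mul_zero]
    rw [hrw]
    have hwp : w i ^ p = w i ^ (p - 1) * w i := by
      conv_rhs => rw [← ENNReal.rpow_one (w i), ← ENNReal.rpow_mul, one_mul,
        ← ENNReal.rpow_add_of_nonneg _ _ hp1.le zero_le_one, sub_add_cancel]
    calc w i ^ p * μ {x | (γ * b ^ i : ℝ≥0) < maximalFun n μ (μ.withDensity g) x}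
        = w i ^ (p - 1) * ((γ⁻¹ : ℝ≥0) * ((γ * b ^ i : ℝ≥0) *
            μ {x | (γ * b ^ i : ℝ≥0) < maximalFun n μ (μ.withDensity g) x})) := by
          rw [hwp, mul_assoc]
          congr 1
          rw [← mul_assoc, ← ENNReal.coe_mul, inv_mul_cancel_left₀ hγ.ne']
      _ ≤ w i ^ (p - 1) * ((γ⁻¹ : ℝ≥0) * (D₁ * ∫⁻ x in {x | w i < D₂ * g x}, g x ∂μ)) := by
          refine mul_le_mul_right (mul_le_mul_right (h1.trans (le_of_eq ?_)) _) _
          rw [hD₁, ENNReal.coe_mul]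
          rfl
      _ = _ := by rw [ENNReal.coe_mul γ⁻¹ D₁]; ring
  have hmeas : ∀ i : ℤ, Measurable fun x =>
      {z : ℝ≥0∞ | w i < z}.indicator (fun _ => w i ^ (p - 1)) (D₂ * g x) * g x := fun i =>
    ((measurable_const.indicator measurableSet_Ioi).comp (hg.const_mul _)).mul hg
  calc _ ≤ ∑' i : ℤ, ((γ⁻¹ * D₁ : ℝ≥0) : ℝ≥0∞) * ∫⁻ x, {z : ℝ≥0∞ | w i < z}.indicator
          (fun _ => w i ^ (p - 1)) (D₂ * g x) * g x ∂μ := ENNReal.tsum_le_tsum hterm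
    _ = ((γ⁻¹ * D₁ : ℝ≥0) : ℝ≥0∞) * ∫⁻ x, (∑' i : ℤ, {z : ℝ≥0∞ | w i < z}.indicator
          (fun _ => w i ^ (p - 1)) (D₂ * g x)) * g x ∂μ := by
        rw [ENNReal.tsum_mul_left, ← lintegral_tsum fun i => (hmeas i).aemeasurable]
        congr 1
        exact lintegral_congr fun x => ENNReal.tsum_mul_right
    _ ≤ ((γ⁻¹ * D₁ : ℝ≥0) : ℝ≥0∞) * ∫⁻ x,
          (((1 - b ^ (-(p - 1)))⁻¹ * D₂ ^ (p - 1) : ℝ≥0) : ℝ≥0∞) * g x ^ p ∂μ := by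
        refine mul_le_mul_right (lintegral_mono fun x => ?_) _
        refine (mul_le_mul_left (tsum_rpow_scale_lt_le hb hp1 (D₂ * g x)) _).trans (le_of_eq ?_)
        rw [ENNReal.mul_rpow_of_nonneg _ _ hp1.le, ENNReal.coe_mul,
          ENNReal.coe_rpow_of_nonneg _ hp1.le]
        have hgp : g x ^ p = g x ^ (p - 1) * g x := by
          conv_rhs => rw [← ENNReal.rpow_one (g x), ← ENNReal.rpow_mul, one_mul,
            ← ENNReal.rpow_add_of_nonneg _ _ hp1.le zero_le_one, sub_add_cancel]
        rw [hgp]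
        ring
    _ = _ := by
        rw [lintegral_const_mul' _ _ ENNReal.coe_ne_top, ← mul_assoc, ← ENNReal.coe_mul]

end MaximalLp

namespace HasBigPieces

variable {d n : ℕ} {k : ℝ → Space d → ℝ} {ρ : ℝ} {μ : Measure (Space d)} {C A c : ℝ} {C₀ C₁ : ℝ≥0}

/-- The `L^p` bound for the potentials of `s g μ` with `g` integrable. The good `λ` inequality is
summed over the levels `b^i`, the weak type bound guaranteeing convergence. -/
theorem exists_lintegral_rpow_le (h : HasBigPieces n k ρ μ C A c C₀ C₁) {p : ℝ} (hp : 1 < p) :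
    ∃ D : ℝ≥0, ∀ g : Space d → ℝ≥0∞, Measurable g → ∫⁻ x, g x ∂μ ≠ ⊤ →
      ∀ s : Space d → ℝ, Measurable s → (∀ x, |s x| ≤ 1) →
        ∫⁻ x, rhoVariation ρ (potential k (μ.withDensity g) s) x ^ p ∂μ ≤
          D * ∫⁻ x, g x ^ p ∂μ := by
  have hp0 : 0 < p := by linarith
  obtain ⟨q, hq1, hgood⟩ := h.exists_good_lambda
  obtain ⟨W, hW⟩ := h.exists_polarWeakBound
  obtain ⟨e, he0, heq⟩ : ∃ e : ℝ≥0, 0 < e ∧ (1 + 2 * e) ^ p * q < 1 := by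
    have hcont : Tendsto (fun e : ℝ≥0 => (1 + 2 * e) ^ p * q) (𝓝[>] 0) (𝓝 ((1 + 2 * 0) ^ p * q)) :=
      by
        have : Continuous fun e : ℝ≥0 => (1 + 2 * e) ^ p * q :=
          ((NNReal.continuous_rpow_const hp0.le).comp (by fun_prop)).mul continuous_const
        exact this.continuousWithinAt
    have hlt : (1 + 2 * (0 : ℝ≥0)) ^ p * q < 1 := by simpa using hq1
    obtain ⟨e, h1, h2⟩ := ((hcont.eventually_lt_const hlt).and eventually_mem_nhdsWithin).exists
    exact ⟨e, h2, h1⟩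
  set b : ℝ≥0 := 1 + 2 * e with hb
  have hb1 : 1 < b := by
    rw [hb]
    exact lt_add_of_pos_right _ (by positivity)
  have hb0 : b ≠ 0 := (zero_lt_one.trans hb1).ne'
  obtain ⟨γ, hγ0, hγ⟩ := hgood e he0
  obtain ⟨D, hD⟩ := tsum_rpow_mul_measure_lt_maximalFun_le (μ := μ) h.one_le h.pos_upper h.ball_le
    hb1 hγ0 hp
  refine ⟨b ^ p * ((1 - b ^ p * q)⁻¹ * (b ^ p * D)), fun g hg hgfin s hs hs1 => ?_⟩
  have : IsFiniteMeasure (μ.withDensity g) := isFiniteMeasure_withDensity hgfin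
  set τ := μ.withDensity g with hτ
  set V := rhoVariation ρ (potential k τ s) with hV
  have hVm : ∀ t : ℝ≥0∞, MeasurableSet {x | t < V x} := fun t =>
    (h.family.isOpen_lt h.one_le_exponent hs hs1 t).measurableSet
  set w : ℤ → ℝ≥0∞ := fun i => ((b ^ i : ℝ≥0) : ℝ≥0∞) with hw
  have hbpos : ∀ i : ℤ, 0 < b ^ i := fun i => zpow_pos (zero_lt_one.trans hb1) i
  have hwb : ∀ i, w (i + 1) = b * w i := fun i => by
    simp only [hw]
    rw [zpow_add_one₀ hb0, mul_comm, ENNReal.coe_mul]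
  have hw0 : ∀ i, w i ≠ 0 := fun i => by simpa [hw] using (hbpos i).ne'
  set a : ℤ → ℝ≥0∞ := fun i => w i ^ p * μ {x | w i < V x} with ha
  set B : ℤ → ℝ≥0∞ := fun i => (b : ℝ≥0∞) ^ p * (w i ^ p *
    μ {x | (γ * b ^ i : ℝ≥0) < maximalFun n μ τ x}) with hB
  have hbp : ((b ^ p * q : ℝ≥0) : ℝ≥0∞) = (b : ℝ≥0∞) ^ p * q := by
    rw [ENNReal.coe_mul, ENNReal.coe_rpow_of_nonneg _ hp0.le]
  have hrec : ∀ i, a (i + 1) ≤ (b ^ p * q : ℝ≥0) * a i + B i := by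
    intro i
    have h1 := hγ τ s hs hs1 (b ^ i) (hbpos i)
    rw [← hb] at h1
    calc a (i + 1) = (b : ℝ≥0∞) ^ p * (w i ^ p * μ {x | ((b * b ^ i : ℝ≥0) : ℝ≥0∞) < V x}) := by
          simp only [ha, hwb, ENNReal.mul_rpow_of_nonneg _ _ hp0.le, mul_assoc]
          simp only [hw, ENNReal.coe_mul]
      _ ≤ (b : ℝ≥0∞) ^ p * (w i ^ p * (q * μ {x | w i < V x} +
            μ {x | (γ * b ^ i : ℝ≥0) < maximalFun n μ τ x})) := by gcongr
      _ = _ := by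
          rw [hbp]
          simp only [ha, hB]
          ring
  have hale : ∀ i, a i ≤ W * τ univ * w i ^ (p - 1) := by
    intro i
    have h1 := hW τ s hs hs1 (b ^ i) (hbpos i)
    calc a i = w i ^ (p - 1) * (w i * μ {x | w i < V x}) := by
          simp only [ha]
          rw [← mul_assoc]
          congr 1
          conv_rhs => rw [← ENNReal.rpow_one (w i), ← ENNReal.rpow_mul, one_mul,
            ← ENNReal.rpow_add_of_nonneg _ _ (by linarith) zero_le_one, sub_add_cancel]
      _ ≤ w i ^ (p - 1) * (W * τ univ) := by gcongr
      _ = _ := by ring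
  have hWτ : (W : ℝ≥0∞) * τ univ ≠ ⊤ := ENNReal.mul_ne_top ENNReal.coe_ne_top (measure_ne_top τ _)
  have hfin : ∀ i, a i ≠ ⊤ := fun i =>
    ((hale i).trans_lt (ENNReal.mul_lt_top hWτ.lt_top (ENNReal.rpow_lt_top_of_nonneg
      (by linarith) ENNReal.coe_ne_top))).ne
  have hlim : Tendsto (fun N : ℕ => a (-(N : ℤ))) atTop (𝓝 0) := by
    have h1 : Tendsto (fun N : ℕ => w (-(N : ℤ))) atTop (𝓝 0) := by
      have h2 : ∀ N : ℕ, w (-(N : ℤ)) = (((b⁻¹) ^ N : ℝ≥0) : ℝ≥0∞) := fun N => by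
        simp only [hw, zpow_neg, zpow_natCast, inv_pow]
      simp only [h2, ENNReal.coe_pow]
      exact ENNReal.tendsto_pow_atTop_nhds_zero_of_lt_one
        (by exact_mod_cast inv_lt_one_of_one_lt₀ hb1)
    have h3 : Tendsto (fun N : ℕ => W * τ univ * w (-(N : ℤ)) ^ (p - 1)) atTop (𝓝 0) := by
      have h4 := ENNReal.Tendsto.const_mul (a := (W : ℝ≥0∞) * τ univ)
        ((ENNReal.continuous_rpow_const (y := p - 1)).tendsto 0 |>.comp h1) (Or.inr hWτ)
      rwa [ENNReal.zero_rpow_of_pos (by linarith), mul_zero] at h4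
    exact tendsto_of_tendsto_of_tendsto_of_le_of_le tendsto_const_nhds h3 (fun _ => zero_le)
      fun N => hale _
  have hsum := tsum_le_of_recurrence heq hfin hrec hlim
  calc ∫⁻ x, V x ^ p ∂μ
      ≤ ∫⁻ x, (b : ℝ≥0∞) ^ p * ∑' i : ℤ, {x | w i < V x}.indicator (fun _ => w i ^ p) x ∂μ :=
        lintegral_mono fun x => rpow_le_tsum_scale_lt hb1 hp0 (V x)
    _ = (b : ℝ≥0∞) ^ p * ∑' i, a i := by
        rw [lintegral_const_mul' _ _ (ENNReal.rpow_ne_top_of_nonneg hp0.le ENNReal.coe_ne_top),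
          lintegral_tsum fun i => (measurable_const.indicator (hVm _)).aemeasurable]
        congr 1
        exact tsum_congr fun i => lintegral_indicator_const (hVm _) _
    _ ≤ (b : ℝ≥0∞) ^ p * (((1 - b ^ p * q)⁻¹ : ℝ≥0) * ∑' i, B i) := by gcongr
    _ ≤ (b : ℝ≥0∞) ^ p * (((1 - b ^ p * q)⁻¹ : ℝ≥0) * ((b : ℝ≥0∞) ^ p *
          (D * ∫⁻ x, g x ^ p ∂μ))) := by
        rw [ENNReal.tsum_mul_left]
        gcongr
        exact hD g hg hgfin
    _ = _ := by
        simp only [ENNReal.coe_mul, ENNReal.coe_rpow_of_nonneg _ hp0.le]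
        ring

end HasBigPieces

/-! ### The potentials of functions in `L^p` -/

section Lp

variable {d n : ℕ} {μ : Measure (Space d)}

/-- The homogeneous kernel truncated near its singularity belongs to `L^q(μ)` for `q > 1`. -/
lemma memLp_indicator_inv_norm_pow (hn : 1 ≤ n) {A : ℝ} (hA0 : 0 < A)
    (hA : ∀ x r, 0 < r → μ (Metric.ball x r) ≤ ENNReal.ofReal (A * r ^ n)) {q : ℝ≥0∞}
    (hq : 1 < q) (hq' : q ≠ ⊤) (x : Space d) {R : ℝ} (hR : 0 < R) :
    MemLp ((Metric.ball x R)ᶜ.indicator fun y => (‖x - y‖ ^ n)⁻¹) q μ := by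
  have hms : MeasurableSet (Metric.ball x R)ᶜ := Metric.isOpen_ball.measurableSet.compl
  have hmeas : Measurable fun y : Space d => (‖x - y‖ ^ n)⁻¹ := by fun_prop
  have hq1 : 1 < q.toReal := by
    rw [← ENNReal.toReal_one]
    exact (ENNReal.toReal_lt_toReal ENNReal.one_ne_top hq').2 hq
  have hn' : (1 : ℝ) ≤ n := by exact_mod_cast hn
  refine ⟨(hmeas.indicator hms).aestronglyMeasurable, ?_⟩
  rw [eLpNorm_lt_top_iff_lintegral_rpow_enorm_lt_top (zero_lt_one.trans hq).ne' hq']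
  have hβ : 0 < (n : ℝ) * (q.toReal - 1) := by nlinarith
  have htail := lintegral_compl_ball_rpow_le (τ := μ) (x := x) n hβ hR (M := ENNReal.ofReal A)
    (fun s hs => by
      rw [← ENNReal.ofReal_mul hA0.le]
      exact hA x s (hR.trans_le hs))
  calc ∫⁻ y, ‖(Metric.ball x R)ᶜ.indicator (fun y => (‖x - y‖ ^ n)⁻¹) y‖ₑ ^ q.toReal ∂μ
      = ∫⁻ y in (Metric.ball x R)ᶜ,
          ENNReal.ofReal (‖x - y‖ ^ (-((n : ℝ) + n * (q.toReal - 1)))) ∂μ := by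
        rw [← lintegral_indicator hms]
        refine lintegral_congr fun y => ?_
        by_cases hy : y ∈ (Metric.ball x R)ᶜ
        · rw [indicator_of_mem hy, indicator_of_mem hy, Real.enorm_of_nonneg (by positivity),
            ENNReal.ofReal_rpow_of_nonneg (by positivity) (by linarith)]
          congr 1
          rw [← Real.rpow_natCast, ← Real.rpow_neg (norm_nonneg _),
            ← Real.rpow_mul (norm_nonneg _)]
          congr 1
          ring
        · rw [indicator_of_notMem hy, indicator_of_notMem hy, enorm_zero,
            ENNReal.zero_rpow_of_pos (by linarith)]
    _ < ⊤ := htail.trans_lt (by finiteness)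

variable {C : ℝ} {k : ℝ → Space d → ℝ}

/-- The truncated kernels centred at points near `x₀` have a common majorant. -/
lemma IsTruncatedFamily.abs_sub_le_indicator (hk : IsTruncatedFamily n C k) {ε : ℝ} (hε : 0 < ε)
    {x₀ x : Space d} (hx : dist x x₀ < ε / 4) (y : Space d) :
    |k ε (x - y)| ≤ C * 2 ^ n *
      (Metric.ball x₀ (ε / 4))ᶜ.indicator (fun y => (‖x₀ - y‖ ^ n)⁻¹) y := by
  have hC := hk.nonneg
  rcases lt_or_ge ‖x - y‖ (ε / 2) with h | h
  · rw [hk.eq_zero ε hε _ h, abs_zero]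
    exact mul_nonneg (by positivity) (indicator_nonneg (fun _ _ => by positivity) _)
  · have h1 : ‖x - y‖ ≤ dist x x₀ + ‖x₀ - y‖ := by
      rw [← dist_eq_norm, ← dist_eq_norm]; exact dist_triangle _ _ _
    have h2 : ‖x₀ - y‖ ≤ dist x x₀ + ‖x - y‖ := by
      rw [← dist_eq_norm, ← dist_eq_norm, dist_comm x x₀]; exact dist_triangle _ _ _
    have hmem : y ∈ (Metric.ball x₀ (ε / 4))ᶜ := by
      rw [mem_compl_iff, Metric.mem_ball, not_lt, dist_comm, dist_eq_norm]
      linarith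
    rw [indicator_of_mem hmem]
    refine (hk.size ε hε _).trans ?_
    have h3 : 0 < ‖x₀ - y‖ := by linarith
    calc C / ‖x - y‖ ^ n ≤ C / (‖x₀ - y‖ / 2) ^ n := by gcongr; linarith
      _ = _ := by rw [div_pow]; field_simp

variable {f : Space d → ℝ} {p : ℝ≥0∞}

lemma integrable_indicator_inv_norm_pow_mul (hn : 1 ≤ n) {A : ℝ} (hA0 : 0 < A)
    (hA : ∀ x r, 0 < r → μ (Metric.ball x r) ≤ ENNReal.ofReal (A * r ^ n)) (hp1 : 1 < p)
    (hp : p ≠ ⊤) (hf : MemLp f p μ) (x : Space d) {R : ℝ} (hR : 0 < R) :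
    Integrable (fun y => (Metric.ball x R)ᶜ.indicator (fun y => (‖x - y‖ ^ n)⁻¹) y * f y) μ := by
  have hpr : 1 < p.toReal := by
    rw [← ENNReal.toReal_one]
    exact (ENNReal.toReal_lt_toReal ENNReal.one_ne_top hp).2 hp1
  have hconj := (Real.HolderConjugate.conjExponent hpr).ennrealOfReal
  rw [ENNReal.ofReal_toReal hp] at hconj
  have hq := (Real.HolderConjugate.conjExponent hpr).symm.lt
  have hker := memLp_indicator_inv_norm_pow hn hA0 hA
    (q := ENNReal.ofReal (Real.conjExponent p.toReal)) (by simpa using hq) ENNReal.ofReal_ne_top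
    x hR
  have := hconj.symm
  exact hker.integrable_mul hf

lemma IsTruncatedFamily.integrable_of_memLp (hk : IsTruncatedFamily n C k) (hn : 1 ≤ n) {A : ℝ}
    (hA0 : 0 < A) (hA : ∀ x r, 0 < r → μ (Metric.ball x r) ≤ ENNReal.ofReal (A * r ^ n))
    (hp1 : 1 < p) (hp : p ≠ ⊤) (hf : MemLp f p μ) {ε : ℝ} (hε : 0 < ε) (x : Space d) :
    Integrable (fun y => k ε (x - y) * f y) μ := by
  have hint := (integrable_indicator_inv_norm_pow_mul hn hA0 hA hp1 hp hf x
    (show 0 < ε / 4 by positivity)).const_mul (C * 2 ^ n)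
  refine hint.mono ((hk.continuous_sub hε x).aestronglyMeasurable.mul hf.1)
    (Eventually.of_forall fun y => ?_)
  rw [Real.norm_eq_abs, Real.norm_eq_abs, ← mul_assoc, abs_mul, abs_mul _ (f y)]
  refine mul_le_mul_of_nonneg_right ?_ (abs_nonneg _)
  exact (hk.abs_sub_le_indicator hε (by rw [dist_self]; positivity) y).trans (le_abs_self _)

lemma IsTruncatedFamily.continuous_potential_of_memLp (hk : IsTruncatedFamily n C k) (hn : 1 ≤ n)
    {A : ℝ} (hA0 : 0 < A) (hA : ∀ x r, 0 < r → μ (Metric.ball x r) ≤ ENNReal.ofReal (A * r ^ n))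
    (hp1 : 1 < p) (hp : p ≠ ⊤) (hf : MemLp f p μ) {ε : ℝ} (hε : 0 < ε) :
    Continuous (potential k μ f ε) := by
  rw [continuous_iff_continuousAt]
  intro x₀
  have hint := ((integrable_indicator_inv_norm_pow_mul hn hA0 hA hp1 hp hf x₀
    (show 0 < ε / 4 by positivity)).const_mul (C * 2 ^ n)).norm
  refine continuousAt_of_dominated (Eventually.of_forall fun x =>
    ((hk.continuous_sub hε x).aestronglyMeasurable.mul hf.1)) ?_ hint ?_
  · filter_upwards [Metric.ball_mem_nhds x₀ (show 0 < ε / 4 by positivity)] with x hx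
    refine Eventually.of_forall fun y => ?_
    rw [Real.norm_eq_abs, Real.norm_eq_abs, ← mul_assoc, abs_mul, abs_mul _ (f y)]
    refine mul_le_mul_of_nonneg_right ?_ (abs_nonneg _)
    exact (hk.abs_sub_le_indicator hε (Metric.mem_ball.1 hx) y).trans (le_abs_self _)
  · refine Eventually.of_forall fun y => ?_
    exact (((hk.continuous ε hε).comp (by fun_prop)).mul continuous_const).continuousAt

end Lp

namespace HasBigPieces

variable {d n : ℕ} {k : ℝ → Space d → ℝ} {ρ : ℝ} {μ : Measure (Space d)} {C A c : ℝ} {C₀ C₁ : ℝ≥0}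

/-- The `L^p` bound, `1 < p < ∞`. It is reduced by truncation to the case of integrable functions
with bounded support. -/
theorem exists_eLpNorm_rhoVariation_le (h : HasBigPieces n k ρ μ C A c C₀ C₁) {p : ℝ≥0∞}
    (hp1 : 1 < p) (hp : p ≠ ⊤) :
    ∃ D : ℝ≥0, ∀ f : Space d → ℝ, MemLp f p μ →
      eLpNorm (rhoVariation ρ (potential k μ f)) p μ ≤ D * eLpNorm f p μ := by
  have hpr : 1 < p.toReal := by
    rw [← ENNReal.toReal_one]
    exact (ENNReal.toReal_lt_toReal ENNReal.one_ne_top hp).2 hp1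
  have hpr0 : 0 < p.toReal := by linarith
  have hp0 : p ≠ 0 := (zero_lt_one.trans hp1).ne'
  obtain ⟨D, hD⟩ := h.exists_lintegral_rpow_le hpr
  refine ⟨D ^ (1 / p.toReal), fun f₀ hf₀ => ?_⟩
  -- Neither side depends on the representative of the class of the function.
  obtain ⟨f, hfsm, hff₀⟩ := hf₀.1
  have hfm : Measurable f := hfsm.measurable
  have hf : MemLp f p μ := (memLp_congr_ae hff₀).1 hf₀
  have hpot : potential k μ f₀ = potential k μ f := by
    ext ε x
    exact integral_congr_ae (hff₀.mono fun y hy => by simp only [hy])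
  rw [hpot, eLpNorm_congr_ae hff₀]
  set s : Space d → ℝ := fun x => if 0 ≤ f x then 1 else -1 with hs_def
  have hs : Measurable s :=
    Measurable.ite (measurableSet_le measurable_const hfm) measurable_const measurable_const
  have hs1 : ∀ x, |s x| ≤ 1 := fun x => by simp only [hs_def]; split_ifs <;> simp
  have hfs : ∀ x, |f x| * s x = f x := fun x => by
    simp only [hs_def]
    split_ifs with h0
    · rw [abs_of_nonneg h0, mul_one]
    · rw [abs_of_neg (not_le.1 h0), mul_neg_one, neg_neg]
  set U : ℕ → Set (Space d) := fun j => Metric.ball 0 ((j : ℝ) + 1) with hU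
  have hUm : ∀ j, MeasurableSet (U j) := fun j => Metric.isOpen_ball.measurableSet
  set g : ℕ → Space d → ℝ≥0∞ := fun j => (U j).indicator fun x => ‖f x‖ₑ with hg
  have hgm : ∀ j, Measurable (g j) := fun j => hfm.enorm.indicator (hUm j)
  have hgfin : ∀ j, ∫⁻ x, g j x ∂μ ≠ ⊤ := by
    intro j
    have : IsFiniteMeasure (μ.restrict (U j)) := ⟨by
      rw [Measure.restrict_apply_univ]
      exact (h.ball_le _ _ (by positivity)).trans_lt ENNReal.ofReal_lt_top⟩
    rw [hg, lintegral_indicator (hUm j)]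
    exact ((hf.restrict (U j)).integrable hp1.le).2.ne
  have hpotj : ∀ j, potential k (μ.restrict (U j)) f = potential k (μ.withDensity (g j)) s := by
    intro j
    ext ε x
    have hlt : ∀ᵐ y ∂μ, g j y < ⊤ := Eventually.of_forall fun y =>
      (indicator_le_self _ _ y).trans_lt enorm_lt_top
    rw [potential, potential, integral_withDensity_eq_integral_toReal_smul (hgm j) hlt,
      ← integral_indicator (hUm j)]
    refine integral_congr_ae (Eventually.of_forall fun y => ?_)
    by_cases hy : y ∈ U j
    · simp only [hg, indicator_of_mem hy, toReal_enorm, Real.norm_eq_abs, smul_eq_mul]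
      rw [mul_left_comm, hfs]
    · simp [hg, indicator_of_notMem hy]
  have hlsc : ∀ j, Measurable (rhoVariation ρ (potential k (μ.restrict (U j)) f)) := by
    intro j
    have : IsFiniteMeasure (μ.withDensity (g j)) := isFiniteMeasure_withDensity (hgfin j)
    rw [hpotj]
    exact (lowerSemicontinuous_rhoVariation h.one_le_exponent
      fun ε hε => h.family.continuous_potential hs hs1 hε).measurable
  have hbound : ∀ j, ∫⁻ x, rhoVariation ρ (potential k (μ.restrict (U j)) f) x ^ p.toReal ∂μ ≤
      D * ∫⁻ x, ‖f x‖ₑ ^ p.toReal ∂μ := by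
    intro j
    rw [hpotj]
    refine (hD (g j) (hgm j) (hgfin j) s hs hs1).trans ?_
    gcongr with x
    exact indicator_le_self _ _ x
  have hmain : ∫⁻ x, rhoVariation ρ (potential k μ f) x ^ p.toReal ∂μ ≤
      D * ∫⁻ x, ‖f x‖ₑ ^ p.toReal ∂μ := by
    calc ∫⁻ x, rhoVariation ρ (potential k μ f) x ^ p.toReal ∂μ
        ≤ ∫⁻ x, liminf (fun j =>
            rhoVariation ρ (potential k (μ.restrict (U j)) f) x ^ p.toReal) atTop ∂μ := by
          refine lintegral_mono fun x => ?_
          have h1 := paramVar_potential_le_liminf h.one_le_exponent (μ := μ) (f := f) (x := x)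
            (fun ε hε => h.family.integrable_of_memLp h.one_le h.pos_upper h.ball_le hp1 hp hf hε x)
          refine (ENNReal.rpow_le_rpow h1 hpr0.le).trans (le_of_eq ?_)
          exact (ENNReal.orderIsoRpow p.toReal hpr0).liminf_apply
      _ ≤ liminf (fun j =>
            ∫⁻ x, rhoVariation ρ (potential k (μ.restrict (U j)) f) x ^ p.toReal ∂μ) atTop :=
          lintegral_liminf_le fun j => (hlsc j).pow_const _
      _ ≤ _ := liminf_le_of_le (by isBoundedDefault) fun b hb => by
          obtain ⟨j, hj⟩ := hb.exists
          exact hj.trans (hbound j)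
  rw [eLpNorm_eq_lintegral_rpow_enorm_toReal hp0 hp, eLpNorm_eq_lintegral_rpow_enorm_toReal hp0 hp,
    ENNReal.coe_rpow_of_nonneg _ (by positivity), ← ENNReal.mul_rpow_of_nonneg _ _ (by positivity)]
  refine ENNReal.rpow_le_rpow ?_ (by positivity)
  simpa only [enorm_eq_self] using hmain

end HasBigPieces

end SmoothVariation

theorem theorem4p1 (n d : ℕ) (hn : 1 ≤ n) (hnd : n < d)
    (K : Space d → ℝ) (hK : IsOddKernel n K)
    (φ : ℝ → ℝ) (hφ : IsTruncationProfile φ)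
    (ρ : ℝ) (hρ : 2 < ρ)
    (μ : Measure (Space d)) (hμ : IsADRegular n μ)
    (hpt : ∀ x, μ.support ≠ {x})
    (C₀ : ℝ≥0) (hC₀ : 0 < C₀) (C₁ : ℝ≥0)
    (hF : ∀ x ∈ μ.support, ∀ r : ℝ, 0 < r → ∃ F : Set (Space d),
      C₀ * μ (Metric.ball x r) ≤ μ (F ∩ Metric.ball x r) ∧
      WeakBound K φ ρ ((Measure.hausdorffMeasure (n : ℝ)).restrict F) C₁) :
    (∃ C : ℝ≥0, WeakBound K φ ρ μ C) ∧
    ∀ p : ℝ≥0∞, 1 < p → p < ⊤ → BoundedOnLp K φ ρ μ p := by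
  obtain ⟨C, hk⟩ := exists_isTruncatedFamily hK hφ
  obtain ⟨A, hA0, hA⟩ := hμ.exists_ball_le hpt
  obtain ⟨c, hc0, hc⟩ := hμ.exists_le_ball
  have h : HasBigPieces n (truncKernel K φ) ρ μ C A c C₀ C₁ :=
    { one_le := hn
      one_le_exponent := by linarith
      family := hk
      pos_upper := hA0
      pos_lower := hc0
      ball_le := hA
      le_ball := hc
      pos_piece := hC₀
      exists_piece := fun x hx r hr => by
        obtain ⟨F, hF0, hF1⟩ := hF x hx r hr
        exact ⟨F, hF0, (weakBound_iff_polarWeakBound hk).1 hF1⟩ }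
  refine ⟨?_, fun p hp1 hp => ?_⟩
  · obtain ⟨D, hD⟩ := h.exists_polarWeakBound
    exact ⟨D, (weakBound_iff_polarWeakBound hk).2 hD⟩
  · obtain ⟨D, hD⟩ := h.exists_eLpNorm_rhoVariation_le hp1 hp.ne
    refine ⟨D, fun f hf => ⟨fun x ε hε => ?_, ?_, hD f hf⟩⟩
    · exact hk.integrable_of_memLp hn hA0 hA hp1 hp.ne hf hε x
    · exact (lowerSemicontinuous_rhoVariation h.one_le_exponent fun ε hε =>
        hk.continuous_potential_of_memLp hn hA0 hA hp1 hp.ne hf hε).measurable.aemeasurable
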